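/- Let $1\le i,\ell\le n-1$ be integers with $i+\ell\le n$, and let $m=\min\{i,\ell\}$. Let $G_{n,i}$ be the Grassmann manifold of $i$-dimensional linear subspaces of $\mathbb R^n$, with its $\mathrm O(n)$-invariant measure $d\xi$ of total mass $1$. Let $\mathbb R^\ell=\mathrm{span}(e_{n-\ell+1},\dots,e_n)$ and $$K_\ell=\left\{\begin{bmatrix} a&0\\0&b\end{bmatrix}\ :\ a\in \mathrm O(n-\ell),\ b\in \mathrm O(\ell)\right\}\subset \mathrm O(n).$$ To $\xi\in G_{n,i}$ assign the point $\boldsymbol\lambda(\xi)=(\lambda_1,\dots,\lambda_m)$ of $$\Lambda_m=\{(\lambda_1,\dots,\lambda_m): 1\ge\lambda_1\ge\dots\ge\lambda_m\ge0\}$$ formed by the eigenvalues of the matrix $\Theta^t\,\mathrm{Pr}_{\mathbb R^\ell}\,\Theta$ if $i\le\ell$, and of $\Psi^t\,\mathrm{Pr}_{\xi}\,\Psi$ if $i>\ell$, where the columns of the $n\times i$ matrix $\Theta$ and of the $n\times \ell$ matrix $\Psi$ form arbitrary fixed orthonormal bases of $\xi$ and of $\mathbb R^\ell$, and $\mathrm{Pr}$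 denotes orthogonal projection (the numbers $\arccos\sqrt{\lambda_j}$ are known as the canonical angles between $\xi$ and $\mathbb R^\ell$). On $\Lambda_m$ put $$d\nu(\boldsymbol\lambda)=\prod_{1\le j<k\le m}(\lambda_j-\lambda_k)\prod_{j=1}^m\lambda_j^{\alpha}(1-\lambda_j)^{\beta}\,d\lambda_j,\qquad \alpha=\frac{|\ell-i|-1}{2},\quad \beta=\frac{n-\ell-i-1}{2}.$$ An integrable (real- or complex-valued) function $f$ on $G_{n,i}$ is $K_\ell$-invariant if and only if there is a function $f_0\in L^1(\Lambda_m;d\nu)$ such that $f(\xi)=f_0(\boldsymbol\lambda(\xi))$. This holds both for functions defined everywhere, with invariance and representation at every $\xi$, and for functions up to null sets, with invariance under each element of $K_\ell$ and representation for almost every $\xi$. Moreover, whenever $f_0\in L^1(\Lambda_m;d\nu)$ and $f(\xi)=f_0(\boldsymbol\lambda(\xi))$ for almost every $\xi$, the function $f$ is integrable and $$\int_{G_{n,i}}f(\xi)\,d\xi=c\int_{\Lambda_m}f_0(\boldsymbol\lambda)\,d\nu(\boldsymbol\lambda),\qquad c=c_m\cdot\begin{cases}\dfrac{\Gamma_i(n/2)}{\Gamma_i(\ell/2)\,\Gamma_i((n-\ell)/2)}&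 \text{if } i\le\ell,\\[2ex] \dfrac{\Gamma_\ell(n/2)}{\Gamma_\ell(i/2)\,\Gamma_\ell((n-i)/2)}&\text{if } i\ge\ell,\end{cases}$$ where $\Gamma_k(a)=\pi^{k(k-1)/4}\prod_{j=0}^{k-1}\Gamma(a-j/2)$ is the Siegel gamma function and $c_m=\pi^{(m^2+m)/4}\Big(\prod_{j=1}^m\Gamma(j/2)\Big)^{-1}$. -/

import Mathlib

open MeasureTheory
open scoped Matrix

noncomputable section

namespace InvGrass

/-- The orthogonal group `O(n)`, as a group of real matrices. -/
abbrev On (n : ℕ) : Type := Matrix.orthogonalGroup (Fin n) ℝ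

/-- The matrix of the orthogonal projection `Pr_V` of `ℝⁿ` onto `V` in the standard basis. -/
def projMatrix {n : ℕ} (V : Submodule ℝ (EuclideanSpace ℝ (Fin n))) :
    Matrix (Fin n) (Fin n) ℝ :=
  Matrix.of fun a b => V.starProjection (EuclideanSpace.single b (1 : ℝ)) a

/-- The coordinate subspace `ℝ^k` of `ℝⁿ` spanned by the last `k` coordinate unit vectors. -/
def coordSubspace (n k : ℕ) : Submodule ℝ (EuclideanSpace ℝ (Fin n)) :=
  Submodule.span ℝ {x | ∃ j : Fin n, n ≤ (j : ℕ) + k ∧ x = EuclideanSpace.single j (1 : ℝ)}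

/-- The Grassmannian `G_{n,i}` of `i`-dimensional linear subspaces of `ℝⁿ`. -/
def Gr (n i : ℕ) : Type :=
  {ξ : Submodule ℝ (EuclideanSpace ℝ (Fin n)) // Module.finrank ℝ ξ = i}

/-- The usual topology: a subspace is identified with the orthogonal projection onto it. -/
instance (n i : ℕ) : TopologicalSpace (Gr n i) :=
  TopologicalSpace.induced (fun ξ => projMatrix ξ.1) inferInstance

instance (n i : ℕ) : MeasurableSpace (Gr n i) := borel _

instance (n i : ℕ) : BorelSpace (Gr n i) := ⟨rfl⟩

instance (n : ℕ) : MeasurableSpace (On n) := borel _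

instance (n : ℕ) : BorelSpace (On n) := ⟨rfl⟩

theorem toEuclideanLin_injective {n : ℕ} (γ : On n) :
    Function.Injective (Matrix.toEuclideanLin (γ : Matrix (Fin n) (Fin n) ℝ)) := by
  apply Function.LeftInverse.injective
    (g := Matrix.toEuclideanLin ((γ⁻¹ : On n) : Matrix (Fin n) (Fin n) ℝ))
  intro x
  simp [Matrix.toLpLin_apply, Matrix.mulVec_mulVec]

/-- The action of `O(n)` on `G_{n,i}`: `γ • ξ` is the image of `ξ` under `x ↦ γ x`. -/
instance (n i : ℕ) : MulAction (On n) (Gr n i) where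
  smul γ ξ := ⟨ξ.1.map (Matrix.toEuclideanLin (γ : Matrix (Fin n) (Fin n) ℝ)), by
    rw [← LinearEquiv.finrank_eq (Submodule.equivMapOfInjective _
      (toEuclideanLin_injective γ) ξ.1), ξ.2]⟩
  one_smul ξ := by
    apply Subtype.ext
    change ξ.1.map (Matrix.toEuclideanLin (1 : Matrix (Fin n) (Fin n) ℝ)) = ξ.1
    simp
  mul_smul γ δ ξ := by
    apply Subtype.ext
    change ξ.1.map (Matrix.toEuclideanLin ((γ : Matrix (Fin n) (Fin n) ℝ) *
        (δ : Matrix (Fin n) (Fin n) ℝ))) =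
      (ξ.1.map (Matrix.toEuclideanLin (δ : Matrix (Fin n) (Fin n) ℝ))).map
        (Matrix.toEuclideanLin (γ : Matrix (Fin n) (Fin n) ℝ))
    rw [← Submodule.map_comp]
    congr 1
    ext x : 1
    simp [Matrix.toLpLin_apply, Matrix.mulVec_mulVec]

theorem finrank_coordSubspace {n k : ℕ} (h : k ≤ n) :
    Module.finrank ℝ (coordSubspace n k) = k := by
  have hset : {x : EuclideanSpace ℝ (Fin n) | ∃ j : Fin n, n ≤ (j : ℕ) + k ∧
      x = EuclideanSpace.single j (1 : ℝ)} =
      Set.range fun t : Fin k =>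
        EuclideanSpace.single (⟨n - k + t, by omega⟩ : Fin n) (1 : ℝ) := by
    ext x
    constructor
    · rintro ⟨j, hj, rfl⟩
      exact ⟨⟨(j : ℕ) - (n - k), by omega⟩, by
        have hj' : (⟨n - k + ((j : ℕ) - (n - k)), by omega⟩ : Fin n) = j :=
          Fin.ext (by change n - k + ((j : ℕ) - (n - k)) = j; omega)
        change EuclideanSpace.single (⟨n - k + ((j : ℕ) - (n - k)), _⟩ : Fin n) (1 : ℝ) = _
        rw [hj']⟩
    · rintro ⟨t, rfl⟩
      exact ⟨_, by simp; omega, rfl⟩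
  have hinj : Function.Injective fun t : Fin k => (⟨n - k + t, by omega⟩ : Fin n) := by
    intro s t hst
    simp only [Fin.mk.injEq] at hst
    exact Fin.ext (by omega)
  have hli := ((EuclideanSpace.basisFun (Fin n) ℝ).orthonormal.linearIndependent).comp _ hinj
  have := finrank_span_eq_card hli
  rw [coordSubspace, hset]
  have hfun : (fun t : Fin k =>
      EuclideanSpace.single (⟨n - k + t, by omega⟩ : Fin n) (1 : ℝ)) =
      (EuclideanSpace.basisFun (Fin n) ℝ) ∘ fun t : Fin k => (⟨n - k + t, by omega⟩ : Fin n) := by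
    funext t
    exact (EuclideanSpace.basisFun_apply (Fin n) ℝ _).symm
  rw [hfun, this, Fintype.card_fin]

/-- `ℝ^i` as a point of `G_{n,i}`. -/
def basePoint {n i : ℕ} (h : i ≤ n) : Gr n i := ⟨coordSubspace n i, finrank_coordSubspace h⟩

instance (n : ℕ) : CompactSpace (On n) := by
  refine isCompact_iff_compactSpace.1 ?_
  have hK : IsCompact {A : Matrix (Fin n) (Fin n) ℝ | ∀ a b, A a b ∈ Set.Icc (-1 : ℝ) 1} := by
    have := isCompact_univ_pi fun _ : Fin n => isCompact_univ_pi fun _ : Fin n =>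
      (isCompact_Icc : IsCompact (Set.Icc (-1 : ℝ) 1))
    have heq : {A : Matrix (Fin n) (Fin n) ℝ | ∀ a b, A a b ∈ Set.Icc (-1 : ℝ) 1} =
        Set.univ.pi fun _ : Fin n => Set.univ.pi fun _ : Fin n => Set.Icc (-1 : ℝ) 1 := by
      refine Set.ext fun A => ?_
      exact ⟨fun h a _ b _ => h a b, fun h a b => h a trivial b trivial⟩
    rw [heq]
    exact this
  refine hK.of_isClosed_subset isClosed_unitary fun A hA a b => ?_
  exact abs_le.1 (entry_norm_bound_of_unitary hA a b)

/-- The Haar measure of `O(n)` of total mass one. -/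
def haarOn (n : ℕ) : Measure (On n) := Measure.haarMeasure ⊤

/-- The `O(n)`-invariant measure `dξ` of total mass one on `G_{n,i}`: the image of the
normalized Haar measure of `O(n)` under the orbit map `γ ↦ γ ℝ^i`. -/
def grMeasure {n i : ℕ} (h : i ≤ n) : Measure (Gr n i) :=
  (haarOn n).map fun γ => γ • basePoint h

theorem projMatrix_smul {n i : ℕ} (γ : On n) (ξ : Gr n i) :
    projMatrix (γ • ξ).1 = (γ : Matrix (Fin n) (Fin n) ℝ) * projMatrix ξ.1 *
      (γ : Matrix (Fin n) (Fin n) ℝ)ᵀ := by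
  have hmul : (γ : Matrix (Fin n) (Fin n) ℝ)ᵀ * (γ : Matrix (Fin n) (Fin n) ℝ) = 1 :=
    (Matrix.mem_orthogonalGroup_iff' (Fin n) ℝ).1 γ.2
  have hmul' : (γ : Matrix (Fin n) (Fin n) ℝ) * (γ : Matrix (Fin n) (Fin n) ℝ)ᵀ = 1 :=
    (Matrix.mem_orthogonalGroup_iff (Fin n) ℝ).1 γ.2
  let L : EuclideanSpace ℝ (Fin n) ≃ₗᵢ[ℝ] EuclideanSpace ℝ (Fin n) :=
    LinearEquiv.isometryOfInner
      (LinearEquiv.ofLinearMap (Matrix.toEuclideanLin (γ : Matrix (Fin n) (Fin n) ℝ))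
        (Matrix.toEuclideanLin (γ : Matrix (Fin n) (Fin n) ℝ)ᵀ)
        (by ext x : 1; simp [Matrix.toLpLin_apply, Matrix.mulVec_mulVec, hmul'])
        (by ext x : 1; simp [Matrix.toLpLin_apply, Matrix.mulVec_mulVec, hmul]))
      (fun x y => by
        simp [EuclideanSpace.inner_eq_star_dotProduct, Matrix.toLpLin_apply,
          Matrix.dotProduct_mulVec, ← Matrix.mulVec_transpose, Matrix.mulVec_mulVec, hmul])
  have hLs : ∀ x, L.symm x = Matrix.toEuclideanLin (γ : Matrix (Fin n) (Fin n) ℝ)ᵀ x :=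
    fun _ => rfl
  have key : ∀ x, (γ • ξ).1.starProjection x = L (ξ.1.starProjection (L.symm x)) :=
    fun x => Submodule.starProjection_map_apply L ξ.1 x
  have hP : ∀ (V : Submodule ℝ (EuclideanSpace ℝ (Fin n))) x,
      V.starProjection x = Matrix.toEuclideanLin (projMatrix V) x := by
    intro V
    suffices h : (V.starProjection : EuclideanSpace ℝ (Fin n) →ₗ[ℝ] EuclideanSpace ℝ (Fin n)) =
        Matrix.toEuclideanLin (projMatrix V) from fun x => LinearMap.congr_fun h x
    refine (EuclideanSpace.basisFun (Fin n) ℝ).toBasis.ext fun b => ?_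
    ext a
    simp [projMatrix, Matrix.toLpLin_apply]
  ext a b
  change (γ • ξ).1.starProjection (EuclideanSpace.single b (1 : ℝ)) a = _
  rw [key, hP, hLs]
  change (Matrix.toEuclideanLin (γ : Matrix (Fin n) (Fin n) ℝ) _) a = _
  simp only [Matrix.toLpLin_apply, Matrix.mulVec_mulVec, PiLp.ofLp_single,
    Matrix.mulVec_single_one]
  rfl

theorem continuous_smul_left {n i : ℕ} (γ : On n) :
    Continuous fun ξ : Gr n i => γ • ξ := by
  refine continuous_induced_rng.2 ?_
  have h : Continuous fun ξ : Gr n i => projMatrix ξ.1 := continuous_induced_dom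
  simp only [Function.comp_def, projMatrix_smul]
  fun_prop

theorem continuous_orbit {n i : ℕ} (ξ : Gr n i) : Continuous fun γ : On n => γ • ξ := by
  refine continuous_induced_rng.2 ?_
  simp only [Function.comp_def, projMatrix_smul]
  fun_prop

instance (n : ℕ) : IsProbabilityMeasure (haarOn n) :=
  ⟨by simpa [haarOn] using Measure.haarMeasure_self (K₀ := (⊤ : TopologicalSpace.PositiveCompacts (On n)))⟩

instance (n : ℕ) : (haarOn n).IsMulLeftInvariant := by
  unfold haarOn; infer_instance

theorem isProbabilityMeasure_grMeasure {n i : ℕ} (h : i ≤ n) :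
    IsProbabilityMeasure (grMeasure h) :=
  Measure.isProbabilityMeasure_map (continuous_orbit _).measurable.aemeasurable

theorem grMeasure_map_smul {n i : ℕ} (h : i ≤ n) (γ : On n) :
    (grMeasure h).map (fun ξ => γ • ξ) = grMeasure h := by
  unfold grMeasure
  rw [Measure.map_map (continuous_smul_left γ).measurable (continuous_orbit _).measurable]
  conv_rhs => rw [← map_mul_left_eq_self (haarOn n) γ]
  rw [Measure.map_map (continuous_orbit _).measurable (measurable_const_mul γ)]
  congr 1
  funext δ
  simp [mul_smul]

/-- The identification of the `n` coordinates with `n - ℓ` first and `ℓ` last coordinates. -/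
def splitEquiv {n ℓ : ℕ} (h : ℓ ≤ n) : Fin (n - ℓ) ⊕ Fin ℓ ≃ Fin n :=
  finSumFinEquiv.trans (finCongr (Nat.sub_add_cancel h))

/-- `γ ∈ K_ℓ`: `γ` is block diagonal with blocks `a ∈ O(n - ℓ)` and `b ∈ O(ℓ)`. -/
def MemK {n ℓ : ℕ} (h : ℓ ≤ n) (γ : On n) : Prop :=
  ∃ (a : On (n - ℓ)) (b : On ℓ), (γ : Matrix (Fin n) (Fin n) ℝ) =
    Matrix.reindex (splitEquiv h) (splitEquiv h)
      (Matrix.fromBlocks (a : Matrix (Fin (n - ℓ)) (Fin (n - ℓ)) ℝ) 0 0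
        (b : Matrix (Fin ℓ) (Fin ℓ) ℝ))

/-- The `n × k` matrix whose columns are the vectors of an orthonormal basis of `U`. -/
def frameMatrix {n k : ℕ} {U : Submodule ℝ (EuclideanSpace ℝ (Fin n))}
    (b : OrthonormalBasis (Fin k) ℝ U) : Matrix (Fin n) (Fin k) ℝ :=
  Matrix.of fun a j => (b j : EuclideanSpace ℝ (Fin n)) a

/-- The matrix `Θᵗ Pr_V Θ`, where the columns of `Θ` form the orthonormal basis `b` of `U`. -/
def compress {n k : ℕ} {U : Submodule ℝ (EuclideanSpace ℝ (Fin n))}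
    (b : OrthonormalBasis (Fin k) ℝ U) (V : Submodule ℝ (EuclideanSpace ℝ (Fin n))) :
    Matrix (Fin k) (Fin k) ℝ :=
  (frameMatrix b)ᵀ * projMatrix V * frameMatrix b

theorem projMatrix_isHermitian {n : ℕ} (V : Submodule ℝ (EuclideanSpace ℝ (Fin n))) :
    (projMatrix V).IsHermitian := by
  ext a b
  have h := V.inner_starProjection_left_eq_right (EuclideanSpace.single a (1 : ℝ))
    (EuclideanSpace.single b (1 : ℝ))
  simpa [projMatrix, EuclideanSpace.inner_single_left, EuclideanSpace.inner_single_right] using h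

theorem compress_isHermitian {n k : ℕ} {U : Submodule ℝ (EuclideanSpace ℝ (Fin n))}
    (b : OrthonormalBasis (Fin k) ℝ U) (V : Submodule ℝ (EuclideanSpace ℝ (Fin n))) :
    (compress b V).IsHermitian := by
  have := Matrix.isHermitian_conjTranspose_mul_mul (frameMatrix b) (projMatrix_isHermitian V)
  simpa [compress, Matrix.conjTranspose_eq_transpose_of_trivial] using this

/-- The eigenvalues of a symmetric `k × k` matrix, with multiplicity, in decreasing order. -/
def eigs {k : ℕ} {A : Matrix (Fin k) (Fin k) ℝ} (hA : A.IsHermitian) (j : Fin k) : ℝ :=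
  hA.eigenvalues₀ (Fin.cast (Fintype.card_fin k).symm j)

/-- The point `(λ_1, …, λ_m)`, `m = min {i, ℓ}`, assigned to `ξ ∈ G_{n,i}`: the eigenvalues
in decreasing order of `Θᵗ Pr_{ℝ^ℓ} Θ` if `i ≤ ℓ`, and of `Ψᵗ Pr_ξ Ψ` if `i > ℓ`, where the
columns of `Θ` and `Ψ` are orthonormal bases of `ξ` and of `ℝ^ℓ`. -/
def lam {n i ℓ : ℕ} (ξ : Gr n i) (Θ : OrthonormalBasis (Fin i) ℝ ξ.1)
    (Ψ : OrthonormalBasis (Fin ℓ) ℝ (coordSubspace n ℓ)) (j : Fin (min i ℓ)) : ℝ :=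
  if h : i ≤ ℓ then
    eigs (compress_isHermitian Θ (coordSubspace n ℓ)) (Fin.cast (min_eq_left h) j)
  else
    eigs (compress_isHermitian Ψ ξ.1) (Fin.cast (min_eq_right (le_of_not_ge h)) j)

/-- The simplex `Λ_m = {1 ≥ λ_1 ≥ … ≥ λ_m ≥ 0}`. -/
def simplex (m : ℕ) : Set (Fin m → ℝ) :=
  {x | Antitone x ∧ ∀ j, 0 ≤ x j ∧ x j ≤ 1}

/-- The measure `∏_{j<k} (λ_j - λ_k) ∏_j λ_j^α (1 - λ_j)^β dλ_j` on `Λ_m`. -/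
def nu (m : ℕ) (α β : ℝ) : Measure (Fin m → ℝ) :=
  (volume.restrict (simplex m)).withDensity fun x =>
    ENNReal.ofReal ((∏ j, ∏ k ∈ Finset.Ioi j, (x j - x k)) *
      ∏ j, x j ^ α * (1 - x j) ^ β)

/-- The Siegel gamma function `Γ_m(a) = π^{m(m-1)/4} ∏_{j=0}^{m-1} Γ(a - j/2)`. -/
def siegelGamma (m : ℕ) (a : ℝ) : ℝ :=
  Real.pi ^ ((m : ℝ) * ((m : ℝ) - 1) / 4) * ∏ j ∈ Finset.range m, Real.Gamma (a - (j : ℝ) / 2)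

/-- The constant `c_m = π^{(m²+m)/4} (∏_{j=1}^m Γ(j/2))⁻¹`. -/
def cOrd (m : ℕ) : ℝ :=
  Real.pi ^ (((m : ℝ) ^ 2 + m) / 4) / ∏ j ∈ Finset.Icc 1 m, Real.Gamma ((j : ℝ) / 2)

/-- The constant `c` of the integral formula. -/
def cConst (n i ℓ : ℕ) : ℝ :=
  cOrd (min i ℓ) *
    if i ≤ ℓ then
      siegelGamma i (n / 2) / (siegelGamma i (ℓ / 2) * siegelGamma i (((n : ℝ) - ℓ) / 2))
    else
      siegelGamma ℓ (n / 2) / (siegelGamma ℓ (i / 2) * siegelGamma ℓ (((n : ℝ) - i) / 2))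

end InvGrass

end

/-
Bases of two `i`-dimensional subspaces with the same canonical angles to `ℝ^ℓ` can be rotated so
that their compressions to `ℝ^ℓ` agree. Then the Gram matrices of their last `ℓ` rows agree, hence
also those of their first `n - ℓ` rows, and each of the two blocks of rows is moved to the other by
an orthogonal matrix. So `λ` separates the orbits of `K_ℓ`, and an invariant function factors
through `λ`; a function invariant up to null sets is first replaced by its average over `K_ℓ`.

The law of `λ` is found by induction on the dimension `k ≤ i` of the coordinate space. In the corner
of size `n - k` of the projection onto `ξᗮ`, the numbers `λ_1, …, λ_k` are eigenvalues, besides `1`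
with multiplicity `n - i - k` and `0` with multiplicity `i - k`. Conjugating this corner by a random
element of `O(n - k)` and deleting one more row and column gives the eigenvalues for `k + 1`. These
interlace the sequence `δ = (1, λ_1, …, λ_k, 0)`; they are the zeros of `∑_j y_j / (X - δ_j)`, where
`y_j` sums the squares of the coordinates of a random unit vector in the eigenspace of `δ_j`. So `y`
has a Dirichlet distribution, and the Jacobian of the passage from the zeros to `y` gives the
Dixon–Anderson density of the zeros. The Jacobi density for `k` times this conditional density is
the Jacobi density for `k + 1` times another Dixon–Anderson density, whose integral over
`λ_1, …, λ_k` is known. The case `i ≤ ℓ` follows from the case `ℓ ≤ i` by exchanging `ξ` and `ℝ^ℓ`.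
-/

noncomputable section

namespace InvGrass

section Vandermonde

open Polynomial

/-- The Vandermonde product `∏_{j<k} (x_j - x_k)`, positive for decreasing sequences; it differs by
a sign from `(Matrix.vandermonde x).det`. -/
def vandermondeProd {R : Type*} [CommRing R] {m : ℕ} (x : Fin m → R) : R :=
  ∏ j, ∏ k ∈ Finset.Ioi j, (x j - x k)

lemma vandermondeProd_cons {R : Type*} [CommRing R] {K : ℕ} (z : R) (b : Fin K → R) :
    vandermondeProd (Fin.cons z b : Fin (K + 1) → R) = (∏ l, (z - b l)) * vandermondeProd b := by
  simp [vandermondeProd, Fin.prod_univ_succ, Fin.prod_Ioi_succ]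

lemma vandermondeProd_snoc {R : Type*} [CommRing R] {K : ℕ} (b : Fin K → R) (z : R) :
    vandermondeProd (Fin.snoc b z : Fin (K + 1) → R) = vandermondeProd b * ∏ l, (b l - z) := by
  simp [vandermondeProd, ← Finset.filter_lt_eq_Ioi, Finset.prod_filter, Fin.prod_univ_castSucc,
    Finset.prod_mul_distrib, Fin.castSucc_lt_last, (Fin.le_last _).not_gt]

lemma vandermondeProd_pos {R : Type*} [CommRing R] [LinearOrder R] [IsStrictOrderedRing R] {m : ℕ}
    {x : Fin m → R} (hx : StrictAnti x) : 0 < vandermondeProd x :=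
  Finset.prod_pos fun _ _ => Finset.prod_pos fun _ hk => sub_pos.2 (hx (Finset.mem_Ioi.1 hk))

lemma abs_det_vandermonde {R : Type*} [CommRing R] [LinearOrder R] [IsStrictOrderedRing R] {m : ℕ}
    (x : Fin m → R) : |(Matrix.vandermonde x).det| = |vandermondeProd x| := by
  simp only [Matrix.det_vandermonde, vandermondeProd, Finset.abs_prod, abs_sub_comm]

lemma prod_prod_compl_abs_sub {R : Type*} [CommRing R] [LinearOrder R] [IsStrictOrderedRing R]
    {m : ℕ} (x : Fin m → R) :
    ∏ j, ∏ k ∈ ({j}ᶜ : Finset (Fin m)), |x j - x k| = |vandermondeProd x| ^ 2 := by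
  have hsymm : ∏ j, ∏ k ∈ ({j}ᶜ : Finset (Fin m)), |x j - x k| =
      ∏ j, ∏ k ∈ ({j}ᶜ : Finset (Fin m)), |x k - x j| := by
    simp only [abs_sub_comm]
  rw [hsymm, ← Finset.prod_prod_Ioi_mul_eq_prod_prod_off_diag fun k j => |x k - x j|]
  simp only [abs_sub_comm (x _) (x _), ← sq, Finset.prod_pow, vandermondeProd, Finset.abs_prod]

lemma prod_compl_singleton_eq_prod_succAbove {M : Type*} [CommMonoid M] {K : ℕ}
    (f : Fin (K + 1) → M) (j : Fin (K + 1)) :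
    ∏ k ∈ ({j}ᶜ : Finset (Fin (K + 1))), f k = ∏ l, f (j.succAbove l) := by
  rw [← Fin.image_succAbove_univ, Finset.prod_image Fin.succAbove_right_injective.injOn]

lemma det_eval_eq_det_vandermonde_mul_det_coeff {R : Type*} [CommRing R] {N : ℕ} (v : Fin N → R)
    (p : Fin N → R[X]) (hp : ∀ c, (p c).natDegree < N) :
    (Matrix.of fun r c => (p c).eval (v r)).det =
      (Matrix.vandermonde v).det * (Matrix.of fun r c : Fin N => (p c).coeff r).det := by
  rw [← Matrix.det_mul]
  congr 1
  ext r c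
  rw [Matrix.of_apply, eval_eq_sum_range' (hp c), Matrix.mul_apply, Finset.sum_range]
  simp only [Matrix.vandermonde_apply, Matrix.of_apply, mul_comm]

end Vandermonde

section PolynomialRoots

open Polynomial

lemma natDegree_C_mul_prod_X_sub_C_le {R ι : Type*} [CommRing R] (s : Finset ι) (T : R)
    (b : ι → R) : (C T * ∏ l ∈ s, (X - C (b l))).natDegree ≤ s.card := by
  nontriviality R
  exact (natDegree_C_mul_le _ _).trans (natDegree_finsetProd_X_sub_C_eq_card s b).le

lemma coeff_prod_X_sub_C_card {R : Type*} [CommRing R] {K : ℕ} (b : Fin K → R) :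
    (∏ l, (X - C (b l))).coeff K = 1 := by
  nontriviality R
  have h := (monic_prod_X_sub_C b Finset.univ).coeff_natDegree
  rwa [natDegree_finsetProd_X_sub_C_eq_card, Finset.card_univ, Fintype.card_fin] at h

lemma eq_C_coeff_mul_prod_X_sub_C {R : Type*} [CommRing R] [IsDomain R] {K : ℕ} {p : R[X]}
    (hp : p.natDegree ≤ K) {b : Fin K → R} (hb : Function.Injective b)
    (hroot : ∀ l, p.eval (b l) = 0) : p = C (p.coeff K) * ∏ l, (X - C (b l)) := by
  have hq := natDegree_C_mul_prod_X_sub_C_le Finset.univ (p.coeff K) b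
  rw [Finset.card_fin] at hq
  refine eq_of_degree_sub_lt_of_eval_index_eq Finset.univ hb.injOn ?_ fun l _ => ?_
  · rw [Finset.card_fin, degree_lt_iff_coeff_zero]
    intro m hm
    rcases hm.eq_or_lt with rfl | hm
    · rw [coeff_sub, coeff_C_mul, coeff_prod_X_sub_C_card, mul_one, sub_self]
    · rw [coeff_sub, coeff_eq_zero_of_natDegree_lt (hp.trans_lt hm),
        coeff_eq_zero_of_natDegree_lt (hq.trans_lt hm), sub_self]
  · rw [hroot, eval_mul, eval_prod, Finset.prod_eq_zero (Finset.mem_univ l) (by simp), mul_zero]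

end PolynomialRoots

section Interlacing

variable {α : Type*} {K : ℕ}

/-- The sequences `b` that strictly interlace a sequence `δ` that is meant to be decreasing:
`δ_0 > b_0 > δ_1 > ⋯ > b_{K-1} > δ_K`. -/
def interlacing [Preorder α] (δ : Fin (K + 1) → α) : Set (Fin K → α) :=
  {b | ∀ l, δ l.succ < b l ∧ b l < δ l.castSucc}

lemma strictAnti_of_mem_interlacing [Preorder α] {δ : Fin (K + 1) → α} (hδ : StrictAnti δ)
    {b : Fin K → α} (hb : b ∈ interlacing δ) : StrictAnti b := fun l m hlm =>
  (hb m).2.trans_le <| (hδ.antitone (Fin.succ_le_castSucc_iff.2 hlm)).trans (hb l).1.le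

lemma index_eq_of_mem_interlacing [LinearOrder α] {δ : Fin (K + 1) → α} (hδ : StrictAnti δ)
    {b b' : Fin K → α} (hb : b ∈ interlacing δ) (hb' : b' ∈ interlacing δ) {l m : Fin K}
    (h : b l = b' m) : l = m := by
  rcases lt_trichotomy l m with hlt | heq | hgt
  · have hgap := hδ.antitone (Fin.succ_le_castSucc_iff.2 hlt)
    exact absurd (h ▸ (hb' m).2.trans_le hgap) (hb l).1.asymm
  · exact heq
  · have hgap := hδ.antitone (Fin.succ_le_castSucc_iff.2 hgt)
    exact absurd (h ▸ (hb l).2.trans_le hgap) (hb' m).1.asymm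

lemma isOpen_setOf_mem_interlacing (α : Type*) [LinearOrder α] [TopologicalSpace α]
    [OrderClosedTopology α] (K : ℕ) :
    IsOpen {z : (Fin (K + 1) → α) × (Fin K → α) | z.2 ∈ interlacing z.1} := by
  have hδ (j : Fin (K + 1)) : Continuous fun z : (Fin (K + 1) → α) × (Fin K → α) => z.1 j :=
    (continuous_apply j).comp continuous_fst
  have hb (l : Fin K) : Continuous fun z : (Fin (K + 1) → α) × (Fin K → α) => z.2 l :=
    (continuous_apply l).comp continuous_snd
  simp only [interlacing, Set.mem_ofPred_eq]
  simp only [Set.ofPred_forall]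
  exact isOpen_iInter_of_finite fun l =>
    (isOpen_lt (hδ l.succ) (hb l)).inter (isOpen_lt (hb l) (hδ l.castSucc))

lemma isOpen_interlacing [LinearOrder α] [TopologicalSpace α] [OrderClosedTopology α]
    (δ : Fin (K + 1) → α) : IsOpen (interlacing δ) :=
  (isOpen_setOf_mem_interlacing α K).preimage (Continuous.prodMk_right δ)

end Interlacing

section Residues

open Polynomial

variable {F : Type*} [Field F] {K : ℕ} {δ : Fin (K + 1) → F}

/-- The quotient of the factor `δ_j - b_l` by the matching factor of `∏_{k ≠ j} (δ_j - δ_k)`. For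
interlacing sequences every such quotient is positive. -/
def nodeRatio (δ : Fin (K + 1) → F) (b : Fin K → F) (j : Fin (K + 1)) (l : Fin K) : F :=
  (δ j - b l) / (δ j - δ (j.succAbove l))

/-- The residues at the nodes `δ_j` of the rational function `T ∏ (X - b_l) / ∏ (X - δ_j)`, where
`x = (T, b_1, …, b_K)`. -/
def residue (δ x : Fin (K + 1) → F) (j : Fin (K + 1)) : F :=
  x 0 * ∏ l, nodeRatio δ (Fin.tail x) j l

/-- The numerator `∑_j y_j ∏_{k ≠ j} (X - δ_k)` of the partial fraction `∑_j y_j / (X - δ_j)`. -/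
def partialFractionNum (δ y : Fin (K + 1) → F) : F[X] :=
  ∑ j, C (y j) * ∏ l, (X - C (δ (j.succAbove l)))

lemma natDegree_partialFractionNum_le (δ y : Fin (K + 1) → F) :
    (partialFractionNum δ y).natDegree ≤ K :=
  natDegree_sum_le_of_forall_le _ _ fun _ _ =>
    (natDegree_C_mul_prod_X_sub_C_le _ _ _).trans (Finset.card_fin K).le

lemma coeff_partialFractionNum (δ y : Fin (K + 1) → F) :
    (partialFractionNum δ y).coeff K = ∑ j, y j := by
  rw [partialFractionNum, finsetSum_coeff]
  exact Finset.sum_congr rfl fun j _ => by rw [coeff_C_mul, coeff_prod_X_sub_C_card, mul_one]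

lemma eval_partialFractionNum (δ y : Fin (K + 1) → F) (j : Fin (K + 1)) :
    (partialFractionNum δ y).eval (δ j) = y j * ∏ l, (δ j - δ (j.succAbove l)) := by
  rw [partialFractionNum, eval_finsetSum, Finset.sum_eq_single j]
  · simp [eval_prod]
  · intro k _ hk
    obtain ⟨l, hl⟩ := Fin.exists_succAbove_eq hk.symm
    rw [eval_mul, eval_prod, Finset.prod_eq_zero (Finset.mem_univ l) (by simp [hl]), mul_zero]
  · simp

lemma prod_sub_succAbove_ne_zero (hδ : Function.Injective δ) (j : Fin (K + 1)) :
    ∏ l, (δ j - δ (j.succAbove l)) ≠ 0 :=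
  Finset.prod_ne_zero_iff.2 fun l _ => sub_ne_zero.2 fun h => Fin.succAbove_ne j l (hδ h).symm

lemma residue_eq_inv_mul (δ x : Fin (K + 1) → F) (j : Fin (K + 1)) :
    residue δ x j =
      (∏ l, (δ j - δ (j.succAbove l)))⁻¹ * (x 0 * ∏ l, (δ j - Fin.tail x l)) := by
  simp only [residue, nodeRatio, Finset.prod_div_distrib]
  ring

lemma partialFractionNum_eq_iff (hδ : Function.Injective δ) (y x : Fin (K + 1) → F) :
    partialFractionNum δ y = C (x 0) * ∏ l, (X - C (Fin.tail x l)) ↔ y = residue δ x := by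
  have hnode : ∀ j, y j * ∏ l, (δ j - δ (j.succAbove l)) = x 0 * ∏ l, (δ j - Fin.tail x l) ↔
      y j = residue δ x j := fun j => by
    rw [residue_eq_inv_mul, eq_inv_mul_iff_mul_eq₀ (prod_sub_succAbove_ne_zero hδ j), mul_comm]
  constructor
  · intro h
    funext j
    rw [← hnode, ← eval_partialFractionNum, h]
    simp [eval_prod]
  · intro h
    have hlt : ∀ {p : F[X]}, p.natDegree ≤ K →
        p.degree < (Finset.univ : Finset (Fin (K + 1))).card := fun hp => by
      rw [Finset.card_fin]
      exact (natDegree_le_iff_degree_le.1 hp).trans_lt (Nat.cast_lt.2 K.lt_succ_self)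
    refine eq_of_degrees_lt_of_eval_index_eq (v := δ) Finset.univ hδ.injOn
      (hlt (natDegree_partialFractionNum_le δ y))
      (hlt ((natDegree_C_mul_prod_X_sub_C_le _ _ _).trans (Finset.card_fin K).le)) fun j _ => ?_
    rw [eval_partialFractionNum, (hnode j).2 (congrFun h j)]
    simp [eval_prod]

lemma sum_residue (hδ : Function.Injective δ) (x : Fin (K + 1) → F) :
    ∑ j, residue δ x j = x 0 := by
  rw [← coeff_partialFractionNum δ, (partialFractionNum_eq_iff hδ _ x).2 rfl, coeff_C_mul,
    coeff_prod_X_sub_C_card, mul_one]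

end Residues

section ResidueMap

open Polynomial

variable {K : ℕ} {δ : Fin (K + 1) → ℝ}

/-- The domain `{(T, b) : T > 0, b interlaces δ}` on which the residue map is a bijection onto the
open positive orthant. -/
def residueDomain (δ : Fin (K + 1) → ℝ) : Set (Fin (K + 1) → ℝ) :=
  {x | 0 < x 0 ∧ Fin.tail x ∈ interlacing δ}

lemma isOpen_residueDomain (δ : Fin (K + 1) → ℝ) : IsOpen (residueDomain δ) :=
  (isOpen_lt continuous_const (continuous_apply 0)).inter
    ((isOpen_interlacing δ).preimage (by unfold Fin.tail; fun_prop))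

lemma nodeRatio_pos (hδ : StrictAnti δ) {b : Fin K → ℝ} (hb : b ∈ interlacing δ)
    (j : Fin (K + 1)) (l : Fin K) : 0 < nodeRatio δ b j l := by
  rw [nodeRatio]
  rcases lt_or_ge l.castSucc j with h | h
  · rw [Fin.succAbove_of_castSucc_lt _ _ h]
    have hj : δ j ≤ δ l.succ := hδ.antitone (Fin.castSucc_lt_iff_succ_le.1 h)
    exact div_pos_of_neg_of_neg (sub_neg.2 (hj.trans_lt (hb l).1)) (sub_neg.2 (hδ h))
  · rw [Fin.succAbove_of_le_castSucc _ _ h]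
    have hj : δ l.castSucc ≤ δ j := hδ.antitone h
    exact div_pos (sub_pos.2 ((hb l).2.trans_le hj))
      (sub_pos.2 (hδ (h.trans_lt Fin.castSucc_lt_succ)))

lemma residue_pos (hδ : StrictAnti δ) {x : Fin (K + 1) → ℝ} (hx : x ∈ residueDomain δ)
    (j : Fin (K + 1)) : 0 < residue δ x j :=
  mul_pos hx.1 (Finset.prod_pos fun l _ => nodeRatio_pos hδ hx.2 j l)

lemma injOn_residue (hδ : StrictAnti δ) : Set.InjOn (residue δ) (residueDomain δ) := by
  intro x hx x' hx' h
  have h0 : x 0 = x' 0 := by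
    rw [← sum_residue hδ.injective x, h, sum_residue hδ.injective x']
  have hpoly : C (x 0) * ∏ l, (X - C (Fin.tail x l)) =
      C (x' 0) * ∏ l, (X - C (Fin.tail x' l)) := by
    rw [← (partialFractionNum_eq_iff hδ.injective (residue δ x) x).2 rfl,
      (partialFractionNum_eq_iff hδ.injective (residue δ x) x').2 h]
  have htail : ∀ l, Fin.tail x l = Fin.tail x' l := by
    intro l
    have heval := congrArg (eval (Fin.tail x l)) hpoly
    simp only [eval_mul, eval_C, eval_prod, eval_sub, eval_X] at heval
    rw [Finset.prod_eq_zero (Finset.mem_univ l) (sub_self _), mul_zero, eq_comm, mul_eq_zero,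
      or_iff_right hx'.1.ne', Finset.prod_eq_zero_iff] at heval
    obtain ⟨m, -, hm⟩ := heval
    rw [sub_eq_zero] at hm
    rwa [← index_eq_of_mem_interlacing hδ hx.2 hx'.2 hm] at hm
  exact funext (Fin.cases h0 htail)

lemma prod_sub_succAbove_mul_succ_neg (hδ : StrictAnti δ) (l : Fin K) :
    (∏ m, (δ l.castSucc - δ (l.castSucc.succAbove m))) *
      ∏ m, (δ l.succ - δ (l.succ.succAbove m)) < 0 := by
  rw [← Finset.prod_mul_distrib, ← Finset.mul_prod_erase _ _ (Finset.mem_univ l)]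
  refine mul_neg_of_neg_of_pos ?_ (Finset.prod_pos fun m hm => ?_)
  · have h : δ l.succ < δ l.castSucc := hδ Fin.castSucc_lt_succ
    rw [Fin.succAbove_castSucc_self, Fin.succAbove_succ_self]
    exact mul_neg_of_pos_of_neg (sub_pos.2 h) (sub_neg.2 h)
  · rcases lt_or_gt_of_ne (Finset.ne_of_mem_erase hm) with h | h
    · have h1 : m.castSucc < l.castSucc := h
      have h2 : m.castSucc < l.succ := h1.trans Fin.castSucc_lt_succ
      rw [Fin.succAbove_of_castSucc_lt _ _ h1, Fin.succAbove_of_castSucc_lt _ _ h2]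
      exact mul_pos_of_neg_of_neg (sub_neg.2 (hδ h1)) (sub_neg.2 (hδ h2))
    · have h1 : l.castSucc ≤ m.castSucc := h.le
      have h2 : l.succ ≤ m.castSucc := Fin.succ_le_castSucc_iff.2 h
      rw [Fin.succAbove_of_le_castSucc _ _ h1, Fin.succAbove_of_le_castSucc _ _ h2]
      exact mul_pos (sub_pos.2 (hδ (h1.trans_lt Fin.castSucc_lt_succ)))
        (sub_pos.2 (hδ (h2.trans_lt Fin.castSucc_lt_succ)))

lemma exists_root_partialFractionNum (hδ : StrictAnti δ) {y : Fin (K + 1) → ℝ}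
    (hy : ∀ j, 0 < y j) (l : Fin K) :
    ∃ t ∈ Set.Ioo (δ l.succ) (δ l.castSucc), (partialFractionNum δ y).eval t = 0 := by
  have hle : δ l.succ ≤ δ l.castSucc := (hδ Fin.castSucc_lt_succ).le
  have hcont := (partialFractionNum δ y).continuous.continuousOn
    (s := Set.Icc (δ l.succ) (δ l.castSucc))
  have hsign : (partialFractionNum δ y).eval (δ l.castSucc) *
      (partialFractionNum δ y).eval (δ l.succ) < 0 := by
    rw [eval_partialFractionNum, eval_partialFractionNum, mul_mul_mul_comm]
    exact mul_neg_of_pos_of_neg (mul_pos (hy _) (hy _)) (prod_sub_succAbove_mul_succ_neg hδ l)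
  rcases mul_neg_iff.1 hsign with h | h
  · exact intermediate_value_Ioo hle hcont h.symm
  · exact intermediate_value_Ioo' hle hcont h

lemma image_residue (hδ : StrictAnti δ) :
    residue δ '' residueDomain δ = {y | ∀ j, 0 < y j} := by
  refine Set.Subset.antisymm (Set.image_subset_iff.2 fun x hx j => residue_pos hδ hx j)
    fun y hy => ?_
  choose b hb hroot using exists_root_partialFractionNum hδ hy
  have hinj := (strictAnti_of_mem_interlacing hδ hb).injective
  refine ⟨Fin.cons (∑ j, y j) b, ⟨Finset.sum_pos (fun j _ => hy j) Finset.univ_nonempty, hb⟩, ?_⟩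
  refine ((partialFractionNum_eq_iff hδ.injective y _).1 ?_).symm
  rw [Fin.cons_zero, Fin.tail_cons, ← coeff_partialFractionNum δ]
  exact eq_C_coeff_mul_prod_X_sub_C (natDegree_partialFractionNum_le δ y) hinj hroot

end ResidueMap

section ResidueJacobian

open Polynomial

variable {K : ℕ}

/-- The partial derivatives of the polynomial `T ∏ (X - b_l)` with respect to the parameters
`T, b_1, …, b_K`. -/
def paramDeriv {R : Type*} [CommRing R] (T : R) (b : Fin K → R) : Fin (K + 1) → R[X] :=
  Fin.cons (∏ l, (X - C (b l))) fun l => C (-T) * ∏ m ∈ {l}ᶜ, (X - C (b m))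

lemma natDegree_paramDeriv_lt {R : Type*} [CommRing R] (T : R) (b : Fin K → R)
    (c : Fin (K + 1)) : (paramDeriv T b c).natDegree < K + 1 := by
  refine Nat.lt_succ_of_le ?_
  cases c using Fin.cases with
  | zero =>
    rw [paramDeriv, Fin.cons_zero]
    simpa only [C_1, one_mul, Finset.card_fin] using
      natDegree_C_mul_prod_X_sub_C_le Finset.univ 1 b
  | succ l =>
    rw [paramDeriv, Fin.cons_succ]
    exact (natDegree_C_mul_prod_X_sub_C_le _ _ _).trans
      ((Finset.card_le_univ _).trans (Fintype.card_fin K).le)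

lemma isUpperTriangular_eval_paramDeriv {R : Type*} [CommRing R] (T z : R) (b : Fin K → R) :
    (Matrix.of fun r c =>
      (paramDeriv T b c).eval ((Fin.cons z b : Fin (K + 1) → R) r)).IsUpperTriangular := by
  intro r c hcr
  obtain ⟨r, rfl⟩ := Fin.exists_succ_eq.2 (Fin.ne_zero_of_lt hcr)
  rw [Matrix.of_apply, Fin.cons_succ]
  cases c using Fin.cases with
  | zero =>
    rw [paramDeriv, Fin.cons_zero, eval_prod]
    exact Finset.prod_eq_zero (Finset.mem_univ r) (by simp)
  | succ l =>
    have hrl : r ≠ l := fun h => hcr.ne (congrArg Fin.succ h.symm)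
    rw [paramDeriv, Fin.cons_succ, eval_mul, eval_prod,
      Finset.prod_eq_zero (i := r) (by simpa using hrl) (by simp), mul_zero]

lemma abs_det_eval_paramDeriv (T z : ℝ) (b : Fin K → ℝ) :
    |(Matrix.of fun r c => (paramDeriv T b c).eval ((Fin.cons z b : Fin (K + 1) → ℝ) r)).det| =
      |∏ l, (z - b l)| * (|T| ^ K * |vandermondeProd b| ^ 2) := by
  rw [Matrix.det_of_isUpperTriangular (isUpperTriangular_eval_paramDeriv T z b),
    Fin.prod_univ_succ, abs_mul, ← prod_prod_compl_abs_sub]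
  simp only [Matrix.of_apply, Fin.cons_zero, Fin.cons_succ, paramDeriv, eval_prod, eval_mul,
    eval_sub, eval_X, eval_C, abs_mul, abs_pow, abs_neg, Finset.prod_mul_distrib, Finset.prod_const,
    Finset.card_fin, Finset.abs_prod]

lemma abs_det_coeff_paramDeriv (T : ℝ) {b : Fin K → ℝ} (hb : Function.Injective b) :
    |(Matrix.of fun r c : Fin (K + 1) => (paramDeriv T b c).coeff r).det| =
      |T| ^ K * |vandermondeProd b| := by
  obtain ⟨z, hz⟩ : ∃ z, z ∉ Set.range b := (Set.finite_range b).exists_notMem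
  have hzb : |∏ l, (z - b l)| ≠ 0 := abs_ne_zero.2 <|
    Finset.prod_ne_zero_iff.2 fun l _ => sub_ne_zero.2 fun h => hz ⟨l, h.symm⟩
  have hV : |vandermondeProd b| ≠ 0 := by
    rw [← abs_det_vandermonde]
    exact abs_ne_zero.2 (Matrix.det_vandermonde_ne_zero_iff.2 hb)
  have h := abs_det_eval_paramDeriv T z b
  rw [det_eval_eq_det_vandermonde_mul_det_coeff _ _ (natDegree_paramDeriv_lt T b), abs_mul,
    abs_det_vandermonde, vandermondeProd_cons, abs_mul] at h
  refine mul_left_cancel₀ (mul_ne_zero hzb hV) (h.trans ?_)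
  ring

/-- The Jacobian matrix of the residue map at `x`. -/
def residueJacobian (δ x : Fin (K + 1) → ℝ) : Matrix (Fin (K + 1)) (Fin (K + 1)) ℝ :=
  Matrix.of fun j c => (∏ l, (δ j - δ (j.succAbove l)))⁻¹ *
    (paramDeriv (x 0) (Fin.tail x) c).eval (δ j)

lemma abs_det_residueJacobian {δ x : Fin (K + 1) → ℝ} (hδ : StrictAnti δ)
    (hx : x ∈ residueDomain δ) :
    |(residueJacobian δ x).det| =
      x 0 ^ K * (vandermondeProd (Fin.tail x) / vandermondeProd δ) := by
  have hb := strictAnti_of_mem_interlacing hδ hx.2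
  have hVδ := vandermondeProd_pos hδ
  have hscale : ∏ j, |(∏ l, (δ j - δ (j.succAbove l)))⁻¹| = (vandermondeProd δ ^ 2)⁻¹ := by
    rw [← abs_of_pos hVδ, ← prod_prod_compl_abs_sub, ← Finset.prod_inv_distrib]
    refine Finset.prod_congr rfl fun j _ => ?_
    rw [abs_inv, Finset.abs_prod, prod_compl_singleton_eq_prod_succAbove fun k => |δ j - δ k|]
  calc |(residueJacobian δ x).det|
      = (vandermondeProd δ ^ 2)⁻¹ *
          |(Matrix.of fun j c => (paramDeriv (x 0) (Fin.tail x) c).eval (δ j)).det| := by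
        rw [← hscale, ← Finset.abs_prod, ← abs_mul, ← Matrix.det_mul_column]
        rfl
    _ = (vandermondeProd δ ^ 2)⁻¹ *
          (vandermondeProd δ * (x 0 ^ K * vandermondeProd (Fin.tail x))) := by
        rw [det_eval_eq_det_vandermonde_mul_det_coeff _ _ (natDegree_paramDeriv_lt _ _), abs_mul,
          abs_det_vandermonde, abs_det_coeff_paramDeriv _ hb.injective, abs_of_pos hVδ,
          abs_of_pos hx.1, abs_of_pos (vandermondeProd_pos hb)]
    _ = x 0 ^ K * (vandermondeProd (Fin.tail x) / vandermondeProd δ) := by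
        field_simp

lemma hasFDerivAt_residue (δ x : Fin (K + 1) → ℝ) :
    HasFDerivAt (residue δ) (Matrix.toLin' (residueJacobian δ x)).toContinuousLinearMap x := by
  refine hasFDerivAt_pi'.2 fun j => ?_
  have hfactor : ∀ l ∈ (Finset.univ : Finset (Fin K)), HasFDerivAt
      (fun x : Fin (K + 1) → ℝ => δ j - x l.succ)
      (-ContinuousLinearMap.proj (R := ℝ) (φ := fun _ : Fin (K + 1) => ℝ) l.succ) x :=
    fun l _ => (hasFDerivAt_apply l.succ x).const_sub (δ j)
  have hderiv := ((hasFDerivAt_apply (𝕜 := ℝ) 0 x).mul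
    (HasFDerivAt.finsetProd hfactor)).const_mul (∏ l, (δ j - δ (j.succAbove l)))⁻¹
  simp only [residue_eq_inv_mul, Fin.tail]
  refine hderiv.congr_fderiv (ContinuousLinearMap.ext fun v => ?_)
  simp only [← Finset.compl_singleton, smul_eq_mul, residueJacobian, paramDeriv,
    smul_apply, add_apply, sum_apply,
    neg_apply, ContinuousLinearMap.proj_apply, ContinuousLinearMap.comp_apply,
    LinearMap.coe_toContinuousLinearMap', Matrix.toLin'_apply, Matrix.mulVec, dotProduct,
    Matrix.of_apply, Fin.sum_univ_succ, Fin.cons_zero, Fin.cons_succ, eval_prod, eval_mul,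
    eval_sub, eval_X, eval_C, Finset.mul_sum, mul_add, Fin.tail]
  rw [add_comm]
  congr 1
  · ring
  · exact Finset.sum_congr rfl fun l _ => by ring

end ResidueJacobian

section ProductIntegrals

lemma lintegral_pi_fin_succ {N : ℕ} {E : Fin (N + 1) → Type*} [∀ j, MeasurableSpace (E j)]
    (μ : ∀ j, Measure (E j)) [∀ j, SigmaFinite (μ j)] (F : (∀ j, E j) → ENNReal) :
    ∫⁻ x, F x ∂Measure.pi μ =
      ∫⁻ p, F (Fin.cons p.1 p.2) ∂(μ 0).prod (Measure.pi fun j => μ j.succ) := by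
  rw [← (measurePreserving_piFinSuccAbove μ 0).symm.lintegral_comp_emb
    (MeasurableEquiv.measurableEmbedding _) F]
  refine lintegral_congr fun p => congrArg F ?_
  exact funext (Fin.cases rfl fun l => rfl)

lemma lintegral_pi_prod {N : ℕ} {E : Fin N → Type*} [∀ j, MeasurableSpace (E j)]
    (μ : ∀ j, Measure (E j)) [∀ j, SigmaFinite (μ j)] {f : ∀ j, E j → ENNReal}
    (hf : ∀ j, Measurable (f j)) :
    ∫⁻ x, ∏ j, f j (x j) ∂Measure.pi μ = ∏ j, ∫⁻ t, f j t ∂μ j := by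
  induction N with
  | zero => simp
  | succ N ih =>
    have htail : Measurable fun x : ∀ j : Fin N, E j.succ => ∏ j, f j.succ (x j) :=
      Finset.measurable_prod _ fun j _ => (hf _).comp (measurable_pi_apply j)
    rw [lintegral_pi_fin_succ]
    simp only [Fin.prod_univ_succ, Fin.cons_zero, Fin.cons_succ]
    rw [lintegral_prod_mul (hf 0).aemeasurable htail.aemeasurable, ih _ fun j => hf j.succ]

lemma pi_withDensity {N : ℕ} {E : Fin N → Type*} [∀ j, MeasurableSpace (E j)]
    (μ : ∀ j, Measure (E j)) [∀ j, SigmaFinite (μ j)] {f : ∀ j, E j → ENNReal}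
    (hf : ∀ j, Measurable (f j)) [∀ j, SigmaFinite ((μ j).withDensity (f j))] :
    Measure.pi (fun j => (μ j).withDensity (f j)) =
      (Measure.pi μ).withDensity fun x => ∏ j, f j (x j) := by
  refine Measure.pi_eq fun s hs => ?_
  have hind : ∀ x : ∀ j, E j, (Set.univ.pi s).indicator (fun x => ∏ j, f j (x j)) x =
      ∏ j, (s j).indicator (f j) (x j) := fun x => by
    by_cases hx : x ∈ Set.univ.pi s
    · rw [Set.indicator_of_mem hx]
      exact Finset.prod_congr rfl fun j _ => (Set.indicator_of_mem (hx j trivial) _).symm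
    · obtain ⟨j, hj⟩ : ∃ j, x j ∉ s j := by simpa [Set.mem_pi] using hx
      rw [Set.indicator_of_notMem hx]
      exact (Finset.prod_eq_zero (Finset.mem_univ j) (Set.indicator_of_notMem hj _)).symm
  rw [withDensity_apply _ (.univ_pi hs), ← lintegral_indicator (.univ_pi hs), funext hind,
    lintegral_pi_prod _ fun j => (hf j).indicator (hs j)]
  simp only [lintegral_indicator (hs _), withDensity_apply _ (hs _)]

lemma lintegral_rpow_mul_exp_neg {s : ℝ} (hs : 0 < s) :
    ∫⁻ t in Set.Ioi (0 : ℝ), ENNReal.ofReal (t ^ (s - 1) * Real.exp (-t)) =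
      ENNReal.ofReal (Real.Gamma s) := by
  rw [Real.Gamma_eq_integral hs,
    ofReal_integral_eq_lintegral_ofReal (Real.GammaIntegral_convergent hs)]
  · simp only [mul_comm]
  · filter_upwards [ae_restrict_mem measurableSet_Ioi] with t (ht : 0 < t)
    exact mul_nonneg (Real.exp_nonneg _) (Real.rpow_nonneg ht.le _)

end ProductIntegrals

section GammaWeights

open ProbabilityTheory

variable {K : ℕ} {δ s : Fin (K + 1) → ℝ}

/-- The Dixon–Anderson density at `b`, up to its normalizing constant: the law of the roots
interlacing `δ` of `∑_j y_j ∏_{k ≠ j} (X - δ_k)` for independent gamma distributed weights `y_j`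
of shape `s_j`. -/
def interlacingWeight (δ s : Fin (K + 1) → ℝ) (b : Fin K → ℝ) : ℝ :=
  vandermondeProd b / vandermondeProd δ * ∏ j, ∏ l, nodeRatio δ b j l ^ (s j - 1)

lemma measurable_interlacingWeight (s : Fin (K + 1) → ℝ) :
    Measurable fun z : (Fin (K + 1) → ℝ) × (Fin K → ℝ) => interlacingWeight z.1 s z.2 := by
  unfold interlacingWeight vandermondeProd nodeRatio
  fun_prop

lemma measurable_gammaPDF (a r : ℝ) : Measurable (gammaPDF a r) :=
  (measurable_gammaPDFReal a r).ennreal_ofReal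

lemma pi_gammaMeasure {N : ℕ} {s : Fin N → ℝ} (hs : ∀ j, 0 < s j) :
    Measure.pi (fun j => gammaMeasure (s j) 1) =
      volume.withDensity fun y : Fin N → ℝ => ∏ j, gammaPDF (s j) 1 (y j) := by
  have hsf : ∀ j, SigmaFinite (volume.withDensity (gammaPDF (s j) 1)) := fun j =>
    have : IsProbabilityMeasure (gammaMeasure (s j) 1) :=
      isProbabilityMeasure_gammaMeasure (hs j) one_pos
    inferInstanceAs (SigmaFinite (gammaMeasure (s j) 1))
  exact pi_withDensity (fun _ => volume) fun j => measurable_gammaPDF (s j) 1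

lemma lintegral_pi_gammaMeasure_eq_setLIntegral {N : ℕ} {s : Fin N → ℝ} (hs : ∀ j, 0 < s j)
    (F : (Fin N → ℝ) → ENNReal) :
    ∫⁻ y, F y ∂(Measure.pi fun j => gammaMeasure (s j) 1) =
      ∫⁻ y in {y | ∀ j, 0 < y j}, (∏ j, gammaPDF (s j) 1 (y j)) * F y := by
  have hdens : Measurable fun y : Fin N → ℝ => ∏ j, gammaPDF (s j) 1 (y j) :=
    Finset.measurable_prod _ fun j _ => (measurable_gammaPDF _ _).comp (measurable_pi_apply j)
  have hpos : MeasurableSet {y : Fin N → ℝ | ∀ j, 0 < y j} := by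
    simp only [Set.ofPred_forall]
    exact .iInter fun j => measurableSet_lt measurable_const (measurable_pi_apply j)
  have hne : ∀ᵐ y : Fin N → ℝ, ∀ j, y j ≠ 0 := ae_all_iff.2 fun j => by
    simpa [ae_iff, volume_pi] using
      Measure.pi_hyperplane (fun _ : Fin N => (volume : Measure ℝ)) j 0
  rw [pi_gammaMeasure hs, lintegral_withDensity_eq_lintegral_mul_non_measurable _ hdens
    (.of_forall fun y => ENNReal.prod_lt_top fun j _ => ENNReal.ofReal_lt_top),
    ← lintegral_indicator hpos]
  refine lintegral_congr_ae (hne.mono fun y hy => ?_)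
  by_cases h : y ∈ {y : Fin N → ℝ | ∀ j, 0 < y j}
  · rw [Set.indicator_of_mem h, Pi.mul_apply]
  · obtain ⟨j, hj⟩ : ∃ j, y j ≤ 0 := by simpa using h
    rw [Set.indicator_of_notMem h, Pi.mul_apply, Finset.prod_eq_zero (Finset.mem_univ j)
      (gammaPDF_of_neg (lt_of_le_of_ne hj (hy j))), zero_mul]

lemma prod_gammaPDF_residue (hδ : StrictAnti δ) (hs : ∀ j, 0 < s j) {x : Fin (K + 1) → ℝ}
    (hx : x ∈ residueDomain δ) :
    ∏ j, gammaPDF (s j) 1 (residue δ x j) =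
      ENNReal.ofReal (1 / (∏ j, Real.Gamma (s j)) * (∏ j, x 0 ^ (s j - 1)) *
        (∏ j, ∏ l, nodeRatio δ (Fin.tail x) j l ^ (s j - 1)) * Real.exp (-x 0)) := by
  have hr : ∀ j l, 0 ≤ nodeRatio δ (Fin.tail x) j l := fun j l => (nodeRatio_pos hδ hx.2 j l).le
  have hpdf : ∀ j, gammaPDF (s j) 1 (residue δ x j) = ENNReal.ofReal (1 / Real.Gamma (s j) *
      x 0 ^ (s j - 1) * (∏ l, nodeRatio δ (Fin.tail x) j l ^ (s j - 1)) *
        Real.exp (-residue δ x j)) := fun j => by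
    rw [gammaPDF_of_nonneg (residue_pos hδ hx j).le, Real.one_rpow, one_mul, residue,
      Real.mul_rpow hx.1.le (Finset.prod_nonneg fun l _ => hr j l),
      Real.finsetProd_rpow _ _ fun l _ => hr j l, ← mul_assoc]
  have hnonneg : ∀ j, 0 ≤ 1 / Real.Gamma (s j) * x 0 ^ (s j - 1) *
      (∏ l, nodeRatio δ (Fin.tail x) j l ^ (s j - 1)) * Real.exp (-residue δ x j) := fun j => by
    have hΓ := Real.Gamma_pos_of_pos (hs j)
    have hx0 : 0 < x 0 := hx.1
    have hprod : 0 ≤ ∏ l, nodeRatio δ (Fin.tail x) j l ^ (s j - 1) :=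
      Finset.prod_nonneg fun l _ => Real.rpow_nonneg (hr j l) _
    positivity
  simp only [hpdf]
  rw [← ENNReal.ofReal_prod_of_nonneg fun j _ => hnonneg j]
  simp only [Finset.prod_mul_distrib, Finset.prod_div_distrib, Finset.prod_const_one,
    ← Real.exp_sum, Finset.sum_neg_distrib, sum_residue hδ.injective]

lemma abs_det_mul_prod_gammaPDF_residue (hδ : StrictAnti δ) (hs : ∀ j, 0 < s j)
    {x : Fin (K + 1) → ℝ} (hx : x ∈ residueDomain δ) :
    ENNReal.ofReal |(Matrix.toLin' (residueJacobian δ x)).toContinuousLinearMap.det| *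
        ∏ j, gammaPDF (s j) 1 (residue δ x j) =
      ENNReal.ofReal (1 / ∏ j, Real.Gamma (s j)) *
        (ENNReal.ofReal (x 0 ^ (∑ j, s j - 1) * Real.exp (-x 0)) *
          ENNReal.ofReal (interlacingWeight δ s (Fin.tail x))) := by
  have hx0 : 0 < x 0 := hx.1
  have hΓ : 0 < ∏ j, Real.Gamma (s j) :=
    Finset.prod_pos fun j _ => Real.Gamma_pos_of_pos (hs j)
  have hpow : x 0 ^ K * ∏ j, x 0 ^ (s j - 1) = x 0 ^ (∑ j, s j - 1) := by
    rw [← Real.rpow_sum_of_pos hx0, ← Real.rpow_natCast, ← Real.rpow_add hx0]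
    congr 1
    simp only [Finset.sum_sub_distrib, Finset.sum_const, Finset.card_univ, Fintype.card_fin,
      nsmul_eq_mul, mul_one, Nat.cast_add, Nat.cast_one]
    ring
  rw [LinearMap.det_toContinuousLinearMap, LinearMap.det_toLin', prod_gammaPDF_residue hδ hs hx,
    ← ENNReal.ofReal_mul (abs_nonneg _), ← ENNReal.ofReal_mul (by positivity),
    ← ENNReal.ofReal_mul (by positivity), abs_det_residueJacobian hδ hx, ← hpow,
    interlacingWeight]
  congr 1
  ring

lemma setLIntegral_residueDomain (δ : Fin (K + 1) → ℝ) {g : ℝ → ENNReal} (hg : Measurable g)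
    {w : (Fin K → ℝ) → ENNReal} (hw : Measurable w) :
    ∫⁻ x in residueDomain δ, g (x 0) * w (Fin.tail x) =
      (∫⁻ t in Set.Ioi 0, g t) * ∫⁻ b in interlacing δ, w b := by
  have hI : MeasurableSet (interlacing δ) := (isOpen_interlacing δ).measurableSet
  rw [← lintegral_indicator (isOpen_residueDomain δ).measurableSet, volume_pi,
    lintegral_pi_fin_succ, ← volume_pi, ← lintegral_indicator measurableSet_Ioi,
    ← lintegral_indicator hI, ← lintegral_prod_mul (hg.indicator measurableSet_Ioi).aemeasurable
      (hw.indicator hI).aemeasurable]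
  refine lintegral_congr fun ⟨t, b⟩ => ?_
  by_cases ht : 0 < t <;> by_cases hb : b ∈ interlacing δ <;>
    simp [Set.indicator, residueDomain, ht, hb]

lemma lintegral_pi_gammaMeasure (hδ : StrictAnti δ) (hs : ∀ j, 0 < s j)
    {F : (Fin (K + 1) → ℝ) → ENNReal} {φ : (Fin K → ℝ) → ENNReal} (hφ : Measurable φ)
    (hF : ∀ x ∈ residueDomain δ, F (residue δ x) = φ (Fin.tail x)) :
    ∫⁻ y, F y ∂(Measure.pi fun j => gammaMeasure (s j) 1) =
      ENNReal.ofReal (Real.Gamma (∑ j, s j) / ∏ j, Real.Gamma (s j)) *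
        ∫⁻ b in interlacing δ, φ b * ENNReal.ofReal (interlacingWeight δ s b) := by
  have hS : 0 < ∑ j, s j := Finset.sum_pos (fun j _ => hs j) Finset.univ_nonempty
  have hD := (isOpen_residueDomain δ).measurableSet
  have hw : Measurable fun b => φ b * ENNReal.ofReal (interlacingWeight δ s b) :=
    hφ.mul ((measurable_interlacingWeight s).comp measurable_prodMk_left).ennreal_ofReal
  have hpull : ∀ x ∈ residueDomain δ,
      ENNReal.ofReal |(Matrix.toLin' (residueJacobian δ x)).toContinuousLinearMap.det| *
        ((∏ j, gammaPDF (s j) 1 (residue δ x j)) * F (residue δ x)) =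
      ENNReal.ofReal (1 / ∏ j, Real.Gamma (s j)) *
        (ENNReal.ofReal (x 0 ^ (∑ j, s j - 1) * Real.exp (-x 0)) *
          (φ (Fin.tail x) * ENNReal.ofReal (interlacingWeight δ s (Fin.tail x)))) :=
    fun x hx => by
      rw [← mul_assoc, abs_det_mul_prod_gammaPDF_residue hδ hs hx, hF x hx]
      ring
  rw [lintegral_pi_gammaMeasure_eq_setLIntegral hs, ← image_residue hδ,
    lintegral_image_eq_lintegral_abs_det_fderiv_mul volume hD
      (fun x _ => (hasFDerivAt_residue δ x).hasFDerivWithinAt) (injOn_residue hδ),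
    setLIntegral_congr_fun hD hpull, lintegral_const_mul' _ _ ENNReal.ofReal_ne_top,
    setLIntegral_residueDomain δ
      (g := fun t => ENNReal.ofReal (t ^ (∑ j, s j - 1) * Real.exp (-t))) (by fun_prop) hw,
    lintegral_rpow_mul_exp_neg hS, ← mul_assoc,
    ← ENNReal.ofReal_mul (one_div_nonneg.2 (Finset.prod_nonneg fun j _ =>
      (Real.Gamma_pos_of_pos (hs j)).le)), one_div_mul_eq_div]

end GammaWeights

section CompactGroups

variable {G : Type*} [Group G] [TopologicalSpace G] [IsTopologicalGroup G] [CompactSpace G]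
  [MeasurableSpace G] [BorelSpace G] (μ : Measure G) [μ.IsHaarMeasure] [IsProbabilityMeasure μ]

lemma isMulRightInvariant_of_compactSpace : μ.IsMulRightInvariant where
  map_mul_right_eq_self g :=
    have : IsProbabilityMeasure (μ.map (· * g)) :=
      Measure.isProbabilityMeasure_map (measurable_mul_const g).aemeasurable
    Measure.isHaarMeasure_eq_of_isProbabilityMeasure _ _

lemma isInvInvariant_of_compactSpace : μ.IsInvInvariant where
  inv_eq_self := by
    have := isMulRightInvariant_of_compactSpace μ
    have : IsProbabilityMeasure μ.inv :=
      Measure.isProbabilityMeasure_map measurable_inv.aemeasurable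
    have hscalar := Measure.isMulInvariant_eq_smul_of_compactSpace μ.inv μ
    have hmass := congrArg (fun ν : Measure G => ν Set.univ) hscalar
    simp only [measure_univ, Measure.smul_apply, ENNReal.smul_def, smul_eq_mul, mul_one] at hmass
    rw [hscalar, ENNReal.coe_eq_one.1 hmass.symm, one_smul]

end CompactGroups

section HaarOrthogonal

instance (n : ℕ) : (haarOn n).IsHaarMeasure := by
  unfold haarOn; infer_instance

instance (n : ℕ) : (haarOn n).IsMulRightInvariant :=
  isMulRightInvariant_of_compactSpace _

instance (n : ℕ) : (haarOn n).IsInvInvariant :=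
  isInvInvariant_of_compactSpace _

instance (n : ℕ) : SecondCountableTopology (On n) :=
  have : SecondCountableTopology (Matrix (Fin n) (Fin n) ℝ) :=
    inferInstanceAs (SecondCountableTopology (Fin n → Fin n → ℝ))
  TopologicalSpace.Subtype.secondCountableTopology _

lemma coe_mul_transpose {n : ℕ} (h : On n) :
    (h : Matrix (Fin n) (Fin n) ℝ) * (h : Matrix (Fin n) (Fin n) ℝ)ᵀ = 1 :=
  (Matrix.mem_orthogonalGroup_iff (Fin n) ℝ).1 h.2

lemma transpose_mul_coe {n : ℕ} (h : On n) :
    (h : Matrix (Fin n) (Fin n) ℝ)ᵀ * (h : Matrix (Fin n) (Fin n) ℝ) = 1 :=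
  (Matrix.mem_orthogonalGroup_iff' (Fin n) ℝ).1 h.2

@[fun_prop]
lemma measurable_entry {n : ℕ} (a b : Fin n) :
    Measurable fun h : On n => (h : Matrix (Fin n) (Fin n) ℝ) a b :=
  have hcoe : Continuous fun h : On n => (h : Matrix (Fin n) (Fin n) ℝ) := continuous_subtype_val
  (hcoe.matrix_elem a b).measurable

end HaarOrthogonal

section GaussianSquares

open ProbabilityTheory

lemma lintegral_fun_norm {E : Type*} [NormedAddCommGroup E] [NormedSpace ℝ E]
    [MeasurableSpace E] [BorelSpace E] [FiniteDimensional ℝ E] [Nontrivial E] (μ : Measure E)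
    [μ.IsAddHaarMeasure] {f : ℝ → ENNReal} (hf : Measurable f) :
    ∫⁻ x, f ‖x‖ ∂μ = μ.toSphere Set.univ *
      ∫⁻ r in Set.Ioi (0 : ℝ), ENNReal.ofReal (r ^ (Module.finrank ℝ E - 1)) * f r := by
  calc ∫⁻ x, f ‖x‖ ∂μ = ∫⁻ x : ({(0)}ᶜ : Set E), f ‖x.1‖ ∂(μ.comap (↑)) := by
        rw [lintegral_subtype_comap (measurableSet_singleton _).compl fun x ↦ f ‖x‖,
          restrict_compl_singleton]
    _ = ∫⁻ x, f x.2 ∂μ.toSphere.prod (.volumeIoiPow (Module.finrank ℝ E - 1)) := by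
        simpa using μ.measurePreserving_homeomorphUnitSphereProd.lintegral_comp_emb
          (Homeomorph.measurableEmbedding _) (f ∘ Subtype.val ∘ Prod.snd)
    _ = μ.toSphere Set.univ * ∫⁻ x : Set.Ioi (0 : ℝ), f x
          ∂.volumeIoiPow (Module.finrank ℝ E - 1) := by
        rw [lintegral_prod _ (by fun_prop)]
        simp [mul_comm]
    _ = μ.toSphere Set.univ *
          ∫⁻ r in Set.Ioi (0 : ℝ), ENNReal.ofReal (r ^ (Module.finrank ℝ E - 1)) * f r := by
        rw [Measure.volumeIoiPow, lintegral_withDensity_eq_lintegral_mul _ (by fun_prop)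
          (by fun_prop)]
        exact congrArg _ (lintegral_subtype_comap measurableSet_Ioi
          fun r : ℝ => ENNReal.ofReal (r ^ (Module.finrank ℝ E - 1)) * f r)

lemma pi_gaussianReal_eq_withDensity (m : ℕ) :
    (Measure.pi fun _ : Fin m => gaussianReal 0 1) =
      (volume : Measure (Fin m → ℝ)).withDensity fun x =>
        ENNReal.ofReal ((√(2 * Real.pi))⁻¹ ^ m * Real.exp (-(∑ j, x j ^ 2) / 2)) := by
  have hdens : gaussianReal 0 1 = volume.withDensity (gaussianPDF 0 1) :=
    gaussianReal_of_var_ne_zero 0 one_ne_zero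
  have : SigmaFinite (volume.withDensity (gaussianPDF 0 1)) := by
    rw [← hdens]; infer_instance
  rw [hdens, pi_withDensity (fun _ => volume) fun _ => measurable_gaussianPDF 0 1, ← volume_pi]
  congr 1
  funext x
  simp only [gaussianPDF]
  rw [← ENNReal.ofReal_prod_of_nonneg fun j _ => gaussianPDFReal_nonneg _ _ _]
  simp only [gaussianPDFReal, Finset.prod_mul_distrib, Finset.prod_const, Finset.card_fin,
    ← Real.exp_sum, NNReal.coe_one, mul_one, sub_zero, ← Finset.sum_div, Finset.sum_neg_distrib]

lemma image_half_sq_Ioi : (fun r : ℝ => r ^ 2 / 2) '' Set.Ioi 0 = Set.Ioi 0 := by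
  refine Set.Subset.antisymm (Set.image_subset_iff.2 fun r (hr : 0 < r) => ?_)
    fun y (hy : 0 < y) => ⟨√(2 * y), Real.sqrt_pos.2 (by positivity), ?_⟩
  · exact (by positivity : 0 < r ^ 2 / 2)
  · change √(2 * y) ^ 2 / 2 = y
    rw [Real.sq_sqrt (by positivity)]
    ring

lemma setLIntegral_Ioi_eq_setLIntegral_half_sq (f : ℝ → ENNReal) :
    ∫⁻ y in Set.Ioi (0 : ℝ), f y = ∫⁻ r in Set.Ioi (0 : ℝ), ENNReal.ofReal r * f (r ^ 2 / 2) := by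
  have hinj : Set.InjOn (fun r : ℝ => r ^ 2 / 2) (Set.Ioi 0) :=
    fun r (hr : 0 < r) s (hs : 0 < s) h =>
      (sq_eq_sq₀ hr.le hs.le).1 ((div_left_inj' two_ne_zero).1 h)
  have hderiv : ∀ r ∈ Set.Ioi (0 : ℝ),
      HasDerivWithinAt (fun r : ℝ => r ^ 2 / 2) r (Set.Ioi 0) r := fun r _ => by
    simpa using ((hasDerivAt_pow 2 r).div_const 2).hasDerivWithinAt (s := Set.Ioi 0)
  conv_lhs => rw [← image_half_sq_Ioi]
  rw [lintegral_image_eq_lintegral_abs_deriv_mul measurableSet_Ioi hderiv hinj]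
  exact setLIntegral_congr_fun measurableSet_Ioi fun r hr => by
    simp only [abs_of_pos (Set.mem_Ioi.1 hr)]

lemma lintegral_gammaMeasure (a r : ℝ) {f : ℝ → ENNReal} (hf : Measurable f) :
    ∫⁻ t, f t ∂gammaMeasure a r = ∫⁻ t in Set.Ioi 0, gammaPDF a r t * f t := by
  rw [gammaMeasure, lintegral_withDensity_eq_lintegral_mul _ (measurable_gammaPDF a r) hf,
    ← lintegral_add_compl _ (measurableSet_Ioi (a := (0 : ℝ))), Set.compl_Ioi,
    ← setLIntegral_congr Iio_ae_eq_Iic,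
    setLIntegral_congr_fun (g := fun _ => 0) measurableSet_Iio fun t ht => by
      simp only [Pi.mul_apply, gammaPDF_of_neg ht, zero_mul], lintegral_zero, add_zero]
  rfl

lemma lintegral_pi_gaussianReal_half_sum_sq {m : ℕ} (hm : 0 < m) {f : ℝ → ENNReal}
    (hf : Measurable f) :
    ∫⁻ x, f ((∑ j, x j ^ 2) / 2) ∂(Measure.pi fun _ : Fin m => gaussianReal 0 1) =
      (volume : Measure (EuclideanSpace ℝ (Fin m))).toSphere Set.univ *
        ∫⁻ r in Set.Ioi (0 : ℝ), ENNReal.ofReal (r ^ (m - 1)) *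
          (ENNReal.ofReal ((√(2 * Real.pi))⁻¹ ^ m * Real.exp (-r ^ 2 / 2)) *
            f (r ^ 2 / 2)) := by
  have : Nonempty (Fin m) := ⟨⟨0, hm⟩⟩
  have hradial := lintegral_fun_norm (volume : Measure (EuclideanSpace ℝ (Fin m)))
    (f := fun r => ENNReal.ofReal ((√(2 * Real.pi))⁻¹ ^ m * Real.exp (-r ^ 2 / 2)) *
      f (r ^ 2 / 2)) (by fun_prop)
  rw [finrank_euclideanSpace, Fintype.card_fin] at hradial
  rw [← hradial, pi_gaussianReal_eq_withDensity,
    lintegral_withDensity_eq_lintegral_mul _ (by fun_prop) (by fun_prop),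
    ← (PiLp.volume_preserving_ofLp (Fin m)).lintegral_comp (by fun_prop)]
  simp only [Pi.mul_apply, EuclideanSpace.real_norm_sq_eq]

lemma ofReal_pow_mul_exp_eq_gammaPDF {m : ℕ} (hm : 0 < m) {r : ℝ} (hr : 0 < r) :
    ENNReal.ofReal (r ^ (m - 1)) *
        ENNReal.ofReal ((√(2 * Real.pi))⁻¹ ^ m * Real.exp (-r ^ 2 / 2)) =
      ENNReal.ofReal ((√(2 * Real.pi))⁻¹ ^ m * 2 ^ ((m : ℝ) / 2 - 1) *
        Real.Gamma ((m : ℝ) / 2)) *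
        (ENNReal.ofReal r * gammaPDF ((m : ℝ) / 2) 1 (r ^ 2 / 2)) := by
  have hpow : r ^ (m - 1) = r * (2 ^ ((m : ℝ) / 2 - 1) * (r ^ 2 / 2) ^ ((m : ℝ) / 2 - 1)) := by
    rw [← Real.mul_rpow (by positivity) (by positivity), mul_div_cancel₀ _ two_ne_zero,
      ← Real.rpow_natCast r 2, ← Real.rpow_mul hr.le, ← Real.rpow_natCast]
    nth_rewrite 2 [← Real.rpow_one r]
    rw [← Real.rpow_add hr, Nat.cast_sub hm]
    congr 1
    push_cast
    ring
  rw [gammaPDF_of_nonneg (by positivity), ← ENNReal.ofReal_mul (by positivity),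
    ← ENNReal.ofReal_mul hr.le, ← ENNReal.ofReal_mul (by positivity), hpow, Real.one_rpow,
    one_mul]
  congr 1
  field_simp

lemma map_half_sum_sq_pi_gaussianReal {m : ℕ} (hm : 0 < m) :
    (Measure.pi fun _ : Fin m => gaussianReal 0 1).map (fun x => (∑ j, x j ^ 2) / 2) =
      gammaMeasure ((m : ℝ) / 2) 1 := by
  have hmeas : Measurable fun x : Fin m → ℝ => (∑ j, x j ^ 2) / 2 := by fun_prop
  have := isProbabilityMeasure_gammaMeasure (a := (m : ℝ) / 2) (by positivity) one_pos
  set γ := gammaMeasure ((m : ℝ) / 2) 1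
  obtain ⟨c, hc⟩ : ∃ c : ENNReal, ∀ f : ℝ → ENNReal, Measurable f →
      ∫⁻ x, f ((∑ j, x j ^ 2) / 2) ∂(Measure.pi fun _ : Fin m => gaussianReal 0 1) =
        c * ∫⁻ t, f t ∂γ := by
    refine ⟨(volume : Measure (EuclideanSpace ℝ (Fin m))).toSphere Set.univ *
      ENNReal.ofReal ((√(2 * Real.pi))⁻¹ ^ m * 2 ^ ((m : ℝ) / 2 - 1) *
        Real.Gamma ((m : ℝ) / 2)), fun f hf => ?_⟩
    rw [lintegral_pi_gaussianReal_half_sum_sq hm hf, lintegral_gammaMeasure _ _ hf,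
      setLIntegral_Ioi_eq_setLIntegral_half_sq fun t => gammaPDF _ _ t * f t, mul_assoc,
      ← lintegral_const_mul' _ _ ENNReal.ofReal_ne_top]
    refine congrArg _ (setLIntegral_congr_fun measurableSet_Ioi fun r hr => ?_)
    rw [← mul_assoc, ofReal_pow_mul_exp_eq_gammaPDF hm hr, mul_assoc, mul_assoc, mul_assoc]
  have hc1 : c = 1 := by simpa using (hc (fun _ => 1) measurable_const).symm
  refine Measure.ext_of_lintegral _ fun f hf => ?_
  rw [lintegral_map hf hmeas, hc f hf, hc1, one_mul]

lemma measurePreserving_sigmaUncurry {J : Type*} [Fintype J] {ι : J → Type*}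
    [∀ j, Fintype (ι j)] {α : Type*} [MeasurableSpace α] (μ : Measure α) [SigmaFinite μ] :
    MeasurePreserving (fun (x : ∀ j, ι j → α) (p : Σ j, ι j) => x p.1 p.2)
      (Measure.pi fun j => Measure.pi fun _ : ι j => μ) (Measure.pi fun _ => μ) := by
  have hmeas : Measurable fun (x : ∀ j, ι j → α) (p : Σ j, ι j) => x p.1 p.2 := by fun_prop
  refine ⟨hmeas, (Measure.pi_eq fun s hs => ?_).symm⟩
  have hpre : (fun (x : ∀ j, ι j → α) (p : Σ j, ι j) => x p.1 p.2) ⁻¹' Set.univ.pi s =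
      Set.univ.pi fun j => Set.univ.pi fun t => s ⟨j, t⟩ := by
    ext x
    simp only [Set.mem_preimage, Set.mem_pi, Set.mem_univ, true_imp_iff]
    exact ⟨fun h j t => h ⟨j, t⟩, fun h p => h p.1 p.2⟩
  rw [Measure.map_apply hmeas (.univ_pi hs), hpre]
  simp only [Measure.pi_pi]
  rw [← Finset.univ_sigma_univ, Finset.prod_sigma]

lemma lintegral_grouped_half_sum_sq {ι J : Type*} [Fintype ι] [Fintype J] {m : J → ℕ}
    (hm : ∀ j, 0 < m j) (σ : ι ≃ Σ j, Fin (m j)) {G : (J → ℝ) → ENNReal} (hG : Measurable G) :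
    ∫⁻ x : ι → ℝ, G (fun j => (∑ t, x (σ.symm ⟨j, t⟩) ^ 2) / 2)
        ∂(Measure.pi fun _ => gaussianReal 0 1) =
      ∫⁻ y, G y ∂(Measure.pi fun j => gammaMeasure ((m j : ℝ) / 2) 1) := by
  have hpi : (Measure.pi fun j => gammaMeasure ((m j : ℝ) / 2) 1) =
      (Measure.pi fun j => Measure.pi fun _ : Fin (m j) => gaussianReal 0 1).map
        fun x j => (∑ t, x j t ^ 2) / 2 := by
    have : ∀ j, IsProbabilityMeasure ((Measure.pi fun _ : Fin (m j) => gaussianReal 0 1).map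
        fun x => (∑ t, x t ^ 2) / 2) := fun j => by
      rw [map_half_sum_sq_pi_gaussianReal (hm j)]
      exact isProbabilityMeasure_gammaMeasure (by simpa using hm j) one_pos
    simp only [← map_half_sum_sq_pi_gaussianReal (hm _)]
    exact (Measure.pi_map_pi (f := fun j (x : Fin (m j) → ℝ) => (∑ t, x t ^ 2) / 2)
      fun j => Measurable.aemeasurable (by fun_prop)).symm
  rw [hpi, lintegral_map hG (by fun_prop),
    ← (measurePreserving_piCongrLeft (fun _ : ι => gaussianReal 0 1) σ.symm).lintegral_comp
      (by fun_prop),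
    ← (measurePreserving_sigmaUncurry (ι := fun j => Fin (m j)) (gaussianReal 0 1)).lintegral_comp
      (by fun_prop)]
  simp only [MeasurableEquiv.coe_piCongrLeft, Equiv.piCongrLeft_apply_apply]

end GaussianSquares

section HaarRow

open ProbabilityTheory

variable {N : ℕ}

lemma measurePreserving_vecMul_pi_gaussianReal (h : On N) :
    MeasurePreserving (fun x : Fin N → ℝ => x ᵥ* (h : Matrix (Fin N) (Fin N) ℝ))
      (Measure.pi fun _ => gaussianReal 0 1) (Measure.pi fun _ => gaussianReal 0 1) := by
  let L : EuclideanSpace ℝ (Fin N) ≃ₗᵢ[ℝ] EuclideanSpace ℝ (Fin N) :=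
    Unitary.linearIsometryEquiv
      (Unitary.mapEquiv (.ofClass (Matrix.toEuclideanCLM (n := Fin N) (𝕜 := ℝ))) h⁻¹)
  have hL : (fun x : Fin N → ℝ => x ᵥ* (h : Matrix (Fin N) (Fin N) ℝ)) =
      WithLp.ofLp ∘ L ∘ WithLp.toLp 2 := funext fun x => (Matrix.mulVec_transpose _ x).symm
  have hofLp : Measurable (WithLp.ofLp : EuclideanSpace ℝ (Fin N) → Fin N → ℝ) := by fun_prop
  have htoLp : Measurable (WithLp.toLp 2 : (Fin N → ℝ) → EuclideanSpace ℝ (Fin N)) := by fun_prop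
  have hLm : Measurable L := L.continuous.measurable
  refine ⟨hL ▸ hofLp.comp (hLm.comp htoLp), ?_⟩
  rw [hL, ← Measure.map_map hofLp (hLm.comp htoLp), ← Measure.map_map hLm htoLp,
    map_pi_eq_stdGaussian, stdGaussian_map, ← map_pi_eq_stdGaussian, Measure.map_map hofLp htoLp]
  exact Measure.map_id

lemma exists_row_eq (e : Fin N) {x : Fin N → ℝ} (hx : ∑ j, x j ^ 2 = 1) :
    ∃ u : On N, (u : Matrix (Fin N) (Fin N) ℝ).row e = x := by
  have hnorm : ‖(WithLp.toLp 2 x : EuclideanSpace ℝ (Fin N))‖ = 1 := by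
    rw [← sq_eq_sq₀ (norm_nonneg _) zero_le_one, EuclideanSpace.real_norm_sq_eq]
    simpa using hx
  have hon : Orthonormal ℝ (({e} : Set (Fin N)).domRestrict
      fun _ => (WithLp.toLp 2 x : EuclideanSpace ℝ (Fin N))) :=
    ⟨fun _ => hnorm, fun i j hij => absurd (Subsingleton.elim i j) hij⟩
  obtain ⟨b, hb⟩ := hon.exists_orthonormalBasis_extension_of_card_eq (by simp)
  refine ⟨⟨Matrix.of fun j k => b j k, ?_⟩, funext fun k => by simp [Matrix.row, hb e rfl]⟩
  rw [Matrix.mem_orthogonalGroup_iff]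
  ext j k
  have h := orthonormal_iff_ite.1 b.orthonormal k j
  simp only [EuclideanSpace.inner_eq_star_dotProduct, dotProduct] at h
  simpa [Matrix.mul_apply, Matrix.one_apply, eq_comm] using h

lemma lintegral_vecMul_haarOn (e : Fin N) {Φ : (Fin N → ℝ) → ENNReal}
    (hhom : ∀ (c : ℝ) (x : Fin N → ℝ), 0 < c → Φ (c • x) = Φ x) {x : Fin N → ℝ} (hx : x ≠ 0) :
    ∫⁻ h : On N, Φ (x ᵥ* (h : Matrix (Fin N) (Fin N) ℝ)) ∂haarOn N =
      ∫⁻ h : On N, Φ ((h : Matrix (Fin N) (Fin N) ℝ).row e) ∂haarOn N := by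
  obtain ⟨j, hj⟩ := Function.ne_iff.1 hx
  have hpos : 0 < ∑ j, x j ^ 2 :=
    Finset.sum_pos' (fun j _ => sq_nonneg _) ⟨j, Finset.mem_univ j, sq_pos_of_ne_zero hj⟩
  set c := √(∑ j, x j ^ 2) with hc
  have hc0 : 0 < c := Real.sqrt_pos.2 hpos
  obtain ⟨u, hu⟩ := exists_row_eq e (x := c⁻¹ • x) (by
    simp only [Pi.smul_apply, smul_eq_mul, mul_pow, ← Finset.mul_sum]
    rw [hc, inv_pow, Real.sq_sqrt hpos.le, inv_mul_cancel₀ hpos.ne'])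
  have hxu : x = c • (u : Matrix (Fin N) (Fin N) ℝ).row e := by rw [hu, smul_inv_smul₀ hc0.ne']
  have htranslate : ∀ h : On N, Φ (x ᵥ* (h : Matrix (Fin N) (Fin N) ℝ)) =
      Φ (((u * h : On N) : Matrix (Fin N) (Fin N) ℝ).row e) := fun h => by
    rw [hxu, Matrix.smul_vecMul, hhom _ _ hc0]
    rfl
  simp only [htranslate]
  exact lintegral_mul_left_eq_self (fun h : On N => Φ ((h : Matrix (Fin N) (Fin N) ℝ).row e)) u

lemma lintegral_row_haarOn (e : Fin N) {Φ : (Fin N → ℝ) → ENNReal} (hΦ : Measurable Φ)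
    (hhom : ∀ (c : ℝ) (x : Fin N → ℝ), 0 < c → Φ (c • x) = Φ x) :
    ∫⁻ h : On N, Φ ((h : Matrix (Fin N) (Fin N) ℝ).row e) ∂haarOn N =
      ∫⁻ x, Φ x ∂(Measure.pi fun _ => gaussianReal 0 1) := by
  have hjoint : Measurable fun p : (Fin N → ℝ) × On N =>
      Φ (p.1 ᵥ* (p.2 : Matrix (Fin N) (Fin N) ℝ)) := by
    refine hΦ.comp (measurable_pi_iff.2 fun k => ?_)
    simp only [Matrix.vecMul, dotProduct]
    exact Finset.measurable_sum _ fun j _ => ((measurable_pi_apply j).comp measurable_fst).mul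
      ((measurable_entry j k).comp measurable_snd)
  have hne : ∀ᵐ x ∂(Measure.pi fun _ : Fin N => gaussianReal 0 1), x ≠ 0 := by
    have : NullSingletonClass (gaussianReal 0 1) := nullSingletonClass_gaussianReal one_ne_zero
    have he : ∀ᵐ x ∂(Measure.pi fun _ : Fin N => gaussianReal 0 1), x e ≠ 0 := by
      simpa [ae_iff] using Measure.pi_hyperplane (fun _ : Fin N => gaussianReal 0 1) e 0
    exact he.mono fun x hx h => hx (congrFun h e)
  have hswap : ∫⁻ x, ∫⁻ h, Φ (x ᵥ* (h : Matrix (Fin N) (Fin N) ℝ)) ∂haarOn N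
      ∂(Measure.pi fun _ => gaussianReal 0 1) =
      ∫⁻ x, Φ x ∂(Measure.pi fun _ => gaussianReal 0 1) := by
    rw [lintegral_lintegral_swap hjoint.aemeasurable]
    simp only [(measurePreserving_vecMul_pi_gaussianReal _).lintegral_comp hΦ, lintegral_const,
      measure_univ, mul_one]
  rw [← hswap, lintegral_congr_ae (hne.mono fun x hx => lintegral_vecMul_haarOn e hhom hx),
    lintegral_const, measure_univ, mul_one]

end HaarRow

section SymmetricMatrices

open Polynomial

lemma roots_prod_X_sub_C_univ {R ι : Type*} [CommRing R] [IsDomain R] [Fintype ι] (a : ι → R) :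
    (∏ l, (X - C (a l))).roots = Finset.univ.val.map a := by
  simpa using roots_multiset_prod_X_sub_C (Finset.univ.val.map a)

lemma eq_of_prod_X_sub_C_eq {R : Type*} [CommRing R] [IsDomain R] [LinearOrder R] {K : ℕ}
    {a b : Fin K → R} (ha : Antitone a) (hb : Antitone b)
    (h : ∏ l, (X - C (a l)) = ∏ l, (X - C (b l))) : a = b := by
  have hroots := congrArg Polynomial.roots h
  simp only [roots_prod_X_sub_C_univ, Fin.univ_val_map, Multiset.coe_eq_coe] at hroots
  exact List.ofFn_injective (hroots.eq_of_sortedGE ha.sortedGE_ofFn hb.sortedGE_ofFn)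

lemma exists_equiv_of_map_univ_eq {α β γ : Type*} [Fintype α] [Fintype β] {f : α → γ} {g : β → γ}
    (h : Finset.univ.val.map f = Finset.univ.val.map g) : ∃ e : α ≃ β, ∀ a, g (e a) = f a := by
  classical
  have hfiber (c : γ) : Nonempty ({a // f a = c} ≃ {b // g b = c}) := by
    have hcount := congrArg (Multiset.count c) h
    rw [Multiset.count_map, Multiset.count_map] at hcount
    refine ⟨Fintype.equivOfCardEq ?_⟩
    rw [Fintype.card_subtype, Fintype.card_subtype]
    simpa [Finset.card, eq_comm, Finset.filter] using hcount
  exact ⟨Equiv.ofFiberEquiv fun c => (hfiber c).some, fun a => Equiv.ofFiberEquiv_map _ a⟩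

lemma exists_orthogonal_mul_diagonal_eigenvalues_mul {N : ℕ} {A : Matrix (Fin N) (Fin N) ℝ}
    (hA : A.IsHermitian) : ∃ U : On N, A = (U : Matrix (Fin N) (Fin N) ℝ) *
      Matrix.diagonal hA.eigenvalues * (U : Matrix (Fin N) (Fin N) ℝ)ᵀ := by
  have hspec := hA.spectral_theorem
  rw [Unitary.conjStarAlgAut_apply] at hspec
  exact ⟨hA.eigenvectorUnitary, hspec⟩

lemma exists_orthogonal_diagonalization {N : ℕ} {ι : Type*} [Fintype ι]
    {A : Matrix (Fin N) (Fin N) ℝ} (hA : A.IsHermitian) {δ : ι → ℝ}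
    (hχ : A.charpoly = ∏ p, (X - C (δ p))) :
    ∃ (σ : Fin N ≃ ι) (U : On N), A = (U : Matrix (Fin N) (Fin N) ℝ) *
      Matrix.diagonal (fun q => δ (σ q)) * (U : Matrix (Fin N) (Fin N) ℝ)ᵀ := by
  have hroots := hA.roots_charpoly_eq_eigenvalues
  rw [hχ, roots_prod_X_sub_C_univ] at hroots
  obtain ⟨σ, hσ⟩ := exists_equiv_of_map_univ_eq hroots.symm
  obtain ⟨U, hU⟩ := exists_orthogonal_mul_diagonal_eigenvalues_mul hA
  rw [show hA.eigenvalues = fun q => δ (σ q) from funext fun q => (hσ q).symm] at hU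
  exact ⟨σ, U, hU⟩

variable {R n : Type*} [CommRing R] [Fintype n] [DecidableEq n]

lemma adjugate_mul_mul_of_mul_eq_one {V W : Matrix n n R} (hVW : V * W = 1) (Y : Matrix n n R) :
    (V * Y * W).adjugate = V * Y.adjugate * W := by
  have hdet : V.det * W.det = 1 := by rw [← Matrix.det_mul, hVW, Matrix.det_one]
  have hV : V.adjugate = V.det • W := by
    calc V.adjugate = V.adjugate * (V * W) := by rw [hVW, mul_one]
      _ = V.det • W := by rw [← mul_assoc, Matrix.adjugate_mul, smul_mul_assoc, one_mul]
  have hW : W.adjugate = W.det • V := by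
    calc W.adjugate = V * W * W.adjugate := by rw [hVW, one_mul]
      _ = W.det • V := by rw [mul_assoc, Matrix.mul_adjugate, mul_smul_comm, mul_one]
  rw [Matrix.adjugate_mul_distrib, Matrix.adjugate_mul_distrib, hV, hW]
  simp only [smul_mul_assoc, mul_smul_comm, smul_smul, hdet, one_smul, mul_assoc]

lemma charmatrix_mul_mul_of_mul_eq_one {V W : Matrix n n R} (hVW : V * W = 1)
    (Y : Matrix n n R) :
    (V * Y * W).charmatrix = V.map C * Y.charmatrix * W.map C := by
  have hmap : V.map C * W.map (C : R →+* R[X]) = 1 := by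
    rw [← Matrix.map_mul, hVW, Matrix.map_one _ C_0 C_1]
  simp only [Matrix.charmatrix, RingHom.mapMatrix_apply, Matrix.map_mul, mul_sub, sub_mul]
  rw [← (Matrix.scalar_commute (X : R[X]) (fun r => Commute.all _ _) (V.map C)).eq,
    mul_assoc (Matrix.scalar n X), hmap, mul_one]

lemma charmatrix_submatrix {l : Type*} [Fintype l] [DecidableEq l] (A : Matrix n n R)
    {f : l → n} (hf : Function.Injective f) :
    (A.submatrix f f).charmatrix = A.charmatrix.submatrix f f := by
  ext a b : 1
  by_cases hab : a = b
  · subst hab; simp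
  · simp [hab, hf.ne hab]

lemma charpoly_submatrix_castSucc_mul_diagonal_mul {M : ℕ}
    {V W : Matrix (Fin (M + 1)) (Fin (M + 1)) R} (hVW : V * W = 1) (α : Fin (M + 1) → R) :
    ((V * Matrix.diagonal α * W).submatrix Fin.castSucc Fin.castSucc).charpoly =
      ∑ q, C (V (Fin.last M) q * W q (Fin.last M)) * ∏ l ∈ Finset.univ.erase q, (X - C (α l)) := by
  have hmap : V.map C * W.map (C : R →+* R[X]) = 1 := by
    rw [← Matrix.map_mul, hVW, Matrix.map_one _ C_0 C_1]
  have hcofactor := Matrix.adjugate_fin_succ_eq_det_submatrix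
    (V * Matrix.diagonal α * W).charmatrix (Fin.last M) (Fin.last M)
  rw [Fin.succAbove_last, ← charmatrix_submatrix _ (Fin.castSucc_injective M),
    Even.neg_one_pow ⟨_, rfl⟩, one_mul] at hcofactor
  rw [Matrix.charpoly, ← hcofactor, charmatrix_mul_mul_of_mul_eq_one hVW,
    Matrix.charmatrix_diagonal, adjugate_mul_mul_of_mul_eq_one hmap, Matrix.adjugate_diagonal,
    Matrix.mul_apply]
  refine Finset.sum_congr rfl fun q _ => ?_
  rw [Matrix.mul_diagonal, Matrix.map_apply, Matrix.map_apply, C_mul]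
  ring

end SymmetricMatrices

section Multiplicities

open Polynomial

variable {F : Type*} [Field F] {K : ℕ} {m : Fin (K + 1) → ℕ}

lemma prod_sigma_X_sub_C (δ : Fin (K + 1) → F) :
    ∏ p : Σ j, Fin (m j), (X - C (δ p.1)) = ∏ j, (X - C (δ j)) ^ m j := by
  rw [← Finset.univ_sigma_univ, Finset.prod_sigma]
  simp only [Finset.prod_const, Finset.card_univ, Fintype.card_fin]

lemma prod_erase_sigma_X_sub_C (hm : ∀ j, 0 < m j) (δ : Fin (K + 1) → F) (p : Σ j, Fin (m j)) :
    ∏ q ∈ Finset.univ.erase p, (X - C (δ q.1)) =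
      (∏ j, (X - C (δ j)) ^ (m j - 1)) * ∏ l, (X - C (δ (p.1.succAbove l))) := by
  refine mul_left_cancel₀ (X_sub_C_ne_zero (δ p.1)) ?_
  rw [Finset.mul_prod_erase Finset.univ (fun q : Σ j, Fin (m j) => X - C (δ q.1))
      (Finset.mem_univ p), prod_sigma_X_sub_C, mul_left_comm,
    ← Fin.prod_univ_succAbove (fun k => X - C (δ k)) p.1, ← Finset.prod_mul_distrib]
  exact Finset.prod_congr rfl fun j _ => by rw [← pow_succ, Nat.sub_add_cancel (hm j)]

lemma sum_mul_prod_erase_eq_mul_partialFractionNum {ι : Type*} [Fintype ι] [DecidableEq ι]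
    (hm : ∀ j, 0 < m j) (δ : Fin (K + 1) → F) (σ : ι ≃ Σ j, Fin (m j)) (w : ι → F) :
    ∑ q, C (w q) * ∏ l ∈ Finset.univ.erase q, (X - C (δ (σ l).1)) =
      (∏ j, (X - C (δ j)) ^ (m j - 1)) *
        partialFractionNum δ (fun j => ∑ t, w (σ.symm ⟨j, t⟩)) := by
  have herase (p : Σ j, Fin (m j)) : ∏ l ∈ Finset.univ.erase (σ.symm p), (X - C (δ (σ l).1)) =
      ∏ q ∈ Finset.univ.erase p, (X - C (δ q.1)) :=
    Finset.prod_equiv σ (by simp [← Equiv.eq_symm_apply]) fun _ _ => rfl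
  rw [← Equiv.sum_comp σ.symm]
  simp only [herase, prod_erase_sigma_X_sub_C hm]
  rw [← Finset.univ_sigma_univ, Finset.sum_sigma, partialFractionNum, Finset.mul_sum]
  refine Finset.sum_congr rfl fun j _ => ?_
  rw [map_sum, Finset.sum_mul, Finset.mul_sum]
  exact Finset.sum_congr rfl fun t _ => mul_left_comm _ _ _

end Multiplicities

section InterlacingRoots

open Polynomial

variable {K : ℕ} {δ : Fin (K + 1) → ℝ}

lemma measurableEmbedding_residue (hδ : StrictAnti δ) :
    MeasurableEmbedding ((residueDomain δ).domRestrict (residue δ)) :=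
  measurableEmbedding_of_fderivWithin (isOpen_residueDomain δ).measurableSet
    (fun x _ => (hasFDerivAt_residue δ x).hasFDerivWithinAt) (injOn_residue hδ)

/-- The value of `φ` at the interlacing roots of `∑_j y_j ∏_{k ≠ j} (X - δ_k)`, as a function of
the weights `y`; it is `0` unless all weights are positive. -/
def interlacingRootFun (δ : Fin (K + 1) → ℝ) (φ : (Fin K → ℝ) → ENNReal) :
    (Fin (K + 1) → ℝ) → ENNReal :=
  Function.extend ((residueDomain δ).domRestrict (residue δ)) (fun x => φ (Fin.tail x.1)) 0

lemma interlacingRootFun_residue (hδ : StrictAnti δ) (φ : (Fin K → ℝ) → ENNReal)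
    {x : Fin (K + 1) → ℝ} (hx : x ∈ residueDomain δ) :
    interlacingRootFun δ φ (residue δ x) = φ (Fin.tail x) :=
  (measurableEmbedding_residue hδ).injective.extend_apply _ _ (⟨x, hx⟩ : residueDomain δ)

lemma interlacingRootFun_of_not_pos (hδ : StrictAnti δ) (φ : (Fin K → ℝ) → ENNReal)
    {y : Fin (K + 1) → ℝ} (hy : ¬ ∀ j, 0 < y j) : interlacingRootFun δ φ y = 0 := by
  refine Function.extend_apply' _ _ _ fun ⟨x, hx⟩ => hy ?_
  rw [← hx]
  exact residue_pos hδ x.2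

lemma measurable_interlacingRootFun (hδ : StrictAnti δ) {φ : (Fin K → ℝ) → ENNReal}
    (hφ : Measurable φ) : Measurable (interlacingRootFun δ φ) :=
  (measurableEmbedding_residue hδ).measurable_extend
    (hφ.comp (measurable_pi_iff.2 fun l =>
      (measurable_pi_apply l.succ).comp measurable_subtype_coe)) measurable_const

lemma smul_residue (δ x : Fin (K + 1) → ℝ) (c : ℝ) :
    c • residue δ x = residue δ (Fin.cons (c * x 0) (Fin.tail x) : Fin (K + 1) → ℝ) := by
  funext j
  simp [residue, mul_assoc]

lemma interlacingRootFun_smul (hδ : StrictAnti δ) (φ : (Fin K → ℝ) → ENNReal) {c : ℝ}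
    (hc : 0 < c) (y : Fin (K + 1) → ℝ) :
    interlacingRootFun δ φ (c • y) = interlacingRootFun δ φ y := by
  by_cases hy : ∀ j, 0 < y j
  · obtain ⟨x, hx, rfl⟩ := (image_residue hδ).ge hy
    have hcx : (Fin.cons (c * x 0) (Fin.tail x) : Fin (K + 1) → ℝ) ∈ residueDomain δ :=
      ⟨by simpa using mul_pos hc hx.1, by simpa using hx.2⟩
    rw [smul_residue, interlacingRootFun_residue hδ φ hcx, interlacingRootFun_residue hδ φ hx,
      Fin.tail_cons]
  · have hcy : ¬ ∀ j, 0 < (c • y) j := fun h => hy fun j => pos_of_mul_pos_right (h j) hc.le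
    rw [interlacingRootFun_of_not_pos hδ φ hy, interlacingRootFun_of_not_pos hδ φ hcy]

lemma interlacingRootFun_eq (hδ : StrictAnti δ) (φ : (Fin K → ℝ) → ENNReal)
    {y : Fin (K + 1) → ℝ} (hy : ∀ j, 0 < y j) {e : Fin K → ℝ} (he : Antitone e)
    (h : partialFractionNum δ y = ∏ l, (X - C (e l))) : interlacingRootFun δ φ y = φ e := by
  obtain ⟨x, hx, rfl⟩ := (image_residue hδ).ge hy
  rw [(partialFractionNum_eq_iff hδ.injective _ x).2 rfl] at h
  have hlead := congrArg (fun p => p.coeff K) h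
  simp only [coeff_C_mul, coeff_prod_X_sub_C_card, mul_one] at hlead
  rw [hlead, map_one, one_mul] at h
  rw [interlacingRootFun_residue hδ φ hx,
    eq_of_prod_X_sub_C_eq (strictAnti_of_mem_interlacing hδ hx.2).antitone he h]

end InterlacingRoots

section Corner

open ProbabilityTheory Polynomial

lemma ae_row_ne_zero {N : ℕ} (e : Fin N) :
    ∀ᵐ h : On N ∂haarOn N, ∀ q, (h : Matrix (Fin N) (Fin N) ℝ) e q ≠ 0 := by
  refine ae_all_iff.2 fun q => ?_
  have hs : MeasurableSet {x : Fin N → ℝ | x q = 0} :=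
    measurableSet_eq_fun (measurable_pi_apply q) measurable_const
  have hlint := lintegral_row_haarOn e (Φ := Set.indicator {x : Fin N → ℝ | x q = 0} 1)
    (measurable_one.indicator hs) fun c x hc => by simp [Set.indicator, hc.ne']
  have : NullSingletonClass (gaussianReal 0 1) := nullSingletonClass_gaussianReal one_ne_zero
  rw [lintegral_indicator_one hs, Measure.pi_hyperplane (fun _ : Fin N => gaussianReal 0 1) q 0]
    at hlint
  have hzero := (lintegral_eq_zero_iff ((measurable_one.indicator hs).comp
    (measurable_pi_iff.2 fun k => measurable_entry e k))).1 hlint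
  exact hzero.mono fun h hh h0 => by simp [Set.indicator, h0] at hh

variable {K M : ℕ} {δ : Fin (K + 1) → ℝ} {m : Fin (K + 1) → ℕ}

lemma interlacingRootFun_row (hδ : StrictAnti δ) (hm : ∀ j, 0 < m j)
    (σ : Fin (M + 1) ≃ Σ j, Fin (m j)) {W : Matrix (Fin (M + 1)) (Fin (M + 1)) ℝ}
    (hWW : W * Wᵀ = 1) (hW0 : ∀ q, W (Fin.last M) q ≠ 0) {e : Fin K → ℝ} (he : Antitone e)
    (heχ : ((W * Matrix.diagonal (fun q => δ (σ q).1) * Wᵀ).submatrix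
      Fin.castSucc Fin.castSucc).charpoly =
        (∏ j, (X - C (δ j)) ^ (m j - 1)) * ∏ l, (X - C (e l)))
    (φ : (Fin K → ℝ) → ENNReal) :
    interlacingRootFun δ φ (fun j => (∑ t, W (Fin.last M) (σ.symm ⟨j, t⟩) ^ 2) / 2) = φ e := by
  rw [charpoly_submatrix_castSucc_mul_diagonal_mul hWW] at heχ
  simp only [Matrix.transpose_apply, ← sq] at heχ
  rw [sum_mul_prod_erase_eq_mul_partialFractionNum hm] at heχ
  have hroots := mul_left_cancel₀ (Finset.prod_ne_zero_iff.2 fun j _ =>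
    pow_ne_zero _ (X_sub_C_ne_zero _)) heχ
  have hpos : ∀ j, 0 < ∑ t, W (Fin.last M) (σ.symm ⟨j, t⟩) ^ 2 := fun j =>
    Finset.sum_pos (fun t _ => sq_pos_of_ne_zero (hW0 _)) ⟨⟨0, hm j⟩, Finset.mem_univ _⟩
  rw [← interlacingRootFun_eq hδ φ hpos he hroots,
    ← interlacingRootFun_smul hδ φ (by norm_num : (0 : ℝ) < 2⁻¹)
      fun j => ∑ t, W (Fin.last M) (σ.symm ⟨j, t⟩) ^ 2]
  congr 1
  funext j
  exact div_eq_inv_mul _ _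

lemma interlacingRootFun_half_sum_sq_smul (hδ : StrictAnti δ) (φ : (Fin K → ℝ) → ENNReal)
    {ι : Type*} (σ : ι ≃ Σ j, Fin (m j)) {c : ℝ} (hc : 0 < c) (x : ι → ℝ) :
    interlacingRootFun δ φ (fun j => (∑ t, (c • x) (σ.symm ⟨j, t⟩) ^ 2) / 2) =
      interlacingRootFun δ φ (fun j => (∑ t, x (σ.symm ⟨j, t⟩) ^ 2) / 2) := by
  rw [← interlacingRootFun_smul hδ φ (pow_pos hc 2)
    fun j => (∑ t, x (σ.symm ⟨j, t⟩) ^ 2) / 2]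
  congr 1
  funext j
  simp only [Pi.smul_apply, smul_eq_mul, mul_pow, ← Finset.mul_sum, mul_div_assoc]

lemma lintegral_corner_eigenvalues (hδ : StrictAnti δ) (hm : ∀ j, 0 < m j)
    {A : Matrix (Fin (M + 1)) (Fin (M + 1)) ℝ} (hA : A.IsHermitian)
    (hχ : A.charpoly = ∏ j, (X - C (δ j)) ^ m j)
    {e : On (M + 1) → Fin K → ℝ} (he : ∀ h, Antitone (e h))
    (heχ : ∀ h : On (M + 1), (((h : Matrix (Fin (M + 1)) (Fin (M + 1)) ℝ) * A *
      (h : Matrix (Fin (M + 1)) (Fin (M + 1)) ℝ)ᵀ).submatrix Fin.castSucc Fin.castSucc).charpoly =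
        (∏ j, (X - C (δ j)) ^ (m j - 1)) * ∏ l, (X - C (e h l)))
    {φ : (Fin K → ℝ) → ENNReal} (hφ : Measurable φ) :
    ∫⁻ h, φ (e h) ∂haarOn (M + 1) =
      ENNReal.ofReal (Real.Gamma (∑ j, (m j : ℝ) / 2) / ∏ j, Real.Gamma ((m j : ℝ) / 2)) *
        ∫⁻ b in interlacing δ,
          φ b * ENNReal.ofReal (interlacingWeight δ (fun j => (m j : ℝ) / 2) b) := by
  obtain ⟨σ, U, hU⟩ := exists_orthogonal_diagonalization (ι := Σ j, Fin (m j))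
    (δ := fun p => δ p.1) hA (hχ.trans (prod_sigma_X_sub_C δ).symm)
  let Φ : (Fin (M + 1) → ℝ) → ENNReal := fun x =>
    interlacingRootFun δ φ fun j => (∑ t, x (σ.symm ⟨j, t⟩) ^ 2) / 2
  have hΦ : Measurable Φ := (measurable_interlacingRootFun hδ hφ).comp (by fun_prop)
  have hne : ∀ᵐ h : On (M + 1) ∂haarOn (M + 1), ∀ q,
      ((h * U : On (M + 1)) : Matrix (Fin (M + 1)) (Fin (M + 1)) ℝ) (Fin.last M) q ≠ 0 :=
    (measurePreserving_mul_right (haarOn (M + 1)) U).quasiMeasurePreserving.ae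
      (p := fun h => ∀ q, (h : Matrix (Fin (M + 1)) (Fin (M + 1)) ℝ) (Fin.last M) q ≠ 0)
      (ae_row_ne_zero (Fin.last M))
  have hΦ_eq : ∀ᵐ h : On (M + 1) ∂haarOn (M + 1), φ (e h) =
      Φ (((h * U : On (M + 1)) : Matrix (Fin (M + 1)) (Fin (M + 1)) ℝ).row (Fin.last M)) := by
    filter_upwards [hne] with h hh
    have hconj : ((h * U : On (M + 1)) : Matrix (Fin (M + 1)) (Fin (M + 1)) ℝ) *
        Matrix.diagonal (fun q => δ (σ q).1) *
        ((h * U : On (M + 1)) : Matrix (Fin (M + 1)) (Fin (M + 1)) ℝ)ᵀ =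
        (h : Matrix (Fin (M + 1)) (Fin (M + 1)) ℝ) * A *
        (h : Matrix (Fin (M + 1)) (Fin (M + 1)) ℝ)ᵀ := by
      rw [hU, Submonoid.coe_mul, Matrix.transpose_mul]
      simp only [mul_assoc]
    exact (interlacingRootFun_row hδ hm σ (coe_mul_transpose (h * U)) hh (he h)
      (hconj ▸ heχ h) φ).symm
  rw [lintegral_congr_ae hΦ_eq, lintegral_mul_right_eq_self
      (fun h : On (M + 1) => Φ ((h : Matrix _ _ ℝ).row (Fin.last M))) U,
    lintegral_row_haarOn _ hΦ fun c x hc => interlacingRootFun_half_sum_sq_smul hδ φ σ hc x,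
    lintegral_grouped_half_sum_sq hm σ (measurable_interlacingRootFun hδ hφ)]
  exact lintegral_pi_gammaMeasure hδ (fun j => by simpa using hm j) hφ
    fun x hx => interlacingRootFun_residue hδ φ hx

end Corner

section Projections

open Polynomial

variable {n k : ℕ} {U : Submodule ℝ (EuclideanSpace ℝ (Fin n))}

lemma frameMatrix_transpose_mul (b : OrthonormalBasis (Fin k) ℝ U) :
    (frameMatrix b)ᵀ * frameMatrix b = 1 := by
  ext s t
  have h := orthonormal_iff_ite.1 b.orthonormal t s
  rw [Submodule.coe_inner, EuclideanSpace.inner_eq_star_dotProduct] at h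
  simpa [Matrix.mul_apply, Matrix.one_apply, frameMatrix, dotProduct, eq_comm (a := s)] using h

lemma frameMatrix_mul_transpose (b : OrthonormalBasis (Fin k) ℝ U) :
    frameMatrix b * (frameMatrix b)ᵀ = projMatrix U := by
  ext r c
  simp only [projMatrix, Matrix.of_apply, Matrix.mul_apply, Matrix.transpose_apply, frameMatrix,
    b.starProjection_eq_sum_rankOne]
  simp [mul_comm, EuclideanSpace.inner_single_right]

lemma isIdempotentElem_projMatrix (U : Submodule ℝ (EuclideanSpace ℝ (Fin n))) :
    IsIdempotentElem (projMatrix U) := by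
  have b := stdOrthonormalBasis ℝ U
  rw [IsIdempotentElem, ← frameMatrix_mul_transpose b, Matrix.mul_assoc,
    ← Matrix.mul_assoc (frameMatrix b)ᵀ, frameMatrix_transpose_mul, Matrix.one_mul]

lemma projMatrix_transpose (U : Submodule ℝ (EuclideanSpace ℝ (Fin n))) :
    (projMatrix U)ᵀ = projMatrix U :=
  (Matrix.conjTranspose_eq_transpose_of_trivial _).symm.trans (projMatrix_isHermitian U)

lemma projMatrix_orthogonal (U : Submodule ℝ (EuclideanSpace ℝ (Fin n))) :
    projMatrix Uᗮ = 1 - projMatrix U := by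
  ext a b
  simp [projMatrix, Submodule.starProjection_orthogonal', Matrix.one_apply]

lemma X_pow_mul_charpoly_projMatrix_mul (b : OrthonormalBasis (Fin k) ℝ U)
    (V : Submodule ℝ (EuclideanSpace ℝ (Fin n))) :
    X ^ k * (projMatrix U * projMatrix V).charpoly = X ^ n * (compress b V).charpoly := by
  have h := Matrix.charpoly_mul_comm' (frameMatrix b) ((frameMatrix b)ᵀ * projMatrix V)
  rw [← Matrix.mul_assoc, frameMatrix_mul_transpose] at h
  simpa only [Fintype.card_fin, compress] using h

lemma charpoly_projMatrix (U : Submodule ℝ (EuclideanSpace ℝ (Fin n))) :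
    (projMatrix U).charpoly =
      X ^ (n - Module.finrank ℝ U) * (X - 1) ^ Module.finrank ℝ U := by
  have hU : Module.finrank ℝ U ≤ n := by simpa using U.finrank_le
  have b := stdOrthonormalBasis ℝ U
  have h := Matrix.charpoly_mul_comm' (frameMatrix b) (frameMatrix b)ᵀ
  rw [frameMatrix_mul_transpose, frameMatrix_transpose_mul, Matrix.charpoly_one,
    Fintype.card_fin, Fintype.card_fin] at h
  refine mul_left_cancel₀ (pow_ne_zero (Module.finrank ℝ U) X_ne_zero) (h.trans ?_)
  rw [← mul_assoc, ← pow_add, Nat.add_sub_cancel' hU]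

lemma compress_eq_transpose_mul_self (b : OrthonormalBasis (Fin k) ℝ U)
    (V : Submodule ℝ (EuclideanSpace ℝ (Fin n))) :
    compress b V = (projMatrix V * frameMatrix b)ᵀ * (projMatrix V * frameMatrix b) := by
  rw [Matrix.transpose_mul, projMatrix_transpose, compress, Matrix.mul_assoc _ (projMatrix V)
    (projMatrix V * _), ← Matrix.mul_assoc (projMatrix V), (isIdempotentElem_projMatrix V).eq,
    Matrix.mul_assoc]

lemma compress_orthogonal (b : OrthonormalBasis (Fin k) ℝ U)
    (V : Submodule ℝ (EuclideanSpace ℝ (Fin n))) : compress b Vᗮ = 1 - compress b V := by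
  rw [compress, projMatrix_orthogonal, Matrix.mul_sub, Matrix.sub_mul, Matrix.mul_one,
    frameMatrix_transpose_mul, compress]

lemma posSemidef_compress (b : OrthonormalBasis (Fin k) ℝ U)
    (V : Submodule ℝ (EuclideanSpace ℝ (Fin n))) : (compress b V).PosSemidef := by
  rw [compress_eq_transpose_mul_self, ← Matrix.conjTranspose_eq_transpose_of_trivial]
  exact Matrix.posSemidef_conjTranspose_mul_self (projMatrix V * frameMatrix b)

end Projections

section Eigs

open Polynomial

variable {k : ℕ} {A : Matrix (Fin k) (Fin k) ℝ}

lemma antitone_eigs (hA : A.IsHermitian) : Antitone (eigs hA) :=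
  fun _ _ h => hA.eigenvalues₀_antitone h

lemma exists_equiv_eigs_eq (hA : A.IsHermitian) :
    ∃ σ : Equiv.Perm (Fin k), ∀ j, eigs hA j = hA.eigenvalues (σ j) :=
  ⟨(finCongr (Fintype.card_fin k).symm).trans
      (Fintype.equivOfCardEq (Fintype.card_fin (Fintype.card (Fin k)))),
    fun j => by simp [Matrix.IsHermitian.eigenvalues, eigs]⟩

lemma charpoly_eq_prod_eigs (hA : A.IsHermitian) :
    A.charpoly = ∏ j, (X - C (eigs hA j)) := by
  obtain ⟨σ, hσ⟩ := exists_equiv_eigs_eq hA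
  simp only [hA.charpoly_eq, hσ, RCLike.ofReal_real_eq_id, id]
  exact (Equiv.prod_comp σ fun q => X - C (hA.eigenvalues q)).symm

lemma eigs_mem_simplex (hA : A.PosSemidef) (hA' : (1 - A).PosSemidef) :
    eigs hA.1 ∈ simplex k := by
  obtain ⟨σ, hσ⟩ := exists_equiv_eigs_eq hA.1
  refine ⟨antitone_eigs _, fun j => ?_⟩
  rw [hσ]
  refine ⟨hA.eigenvalues_nonneg _, sub_nonneg.1 ?_⟩
  refine (Matrix.posSemidef_iff_isHermitian_and_spectrum_nonneg.1 hA').2 ?_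
  rw [← map_one (algebraMap ℝ (Matrix (Fin k) (Fin k) ℝ)), ← spectrum.singleton_sub_eq]
  exact Set.sub_mem_sub rfl (hA.1.eigenvalues_mem_spectrum_real _)

lemma compress_eigs_mem_simplex {n : ℕ} {U : Submodule ℝ (EuclideanSpace ℝ (Fin n))}
    (b : OrthonormalBasis (Fin k) ℝ U) (V : Submodule ℝ (EuclideanSpace ℝ (Fin n))) :
    eigs (compress_isHermitian b V) ∈ simplex k :=
  eigs_mem_simplex (posSemidef_compress b V) (compress_orthogonal b V ▸ posSemidef_compress b Vᗮ)

variable {n : ℕ} {U V : Submodule ℝ (EuclideanSpace ℝ (Fin n))} {x y : Fin k → ℝ}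

/-- `x` lists, in decreasing order, the squared cosines of the canonical angles between `U` and
`V`, which are the eigenvalues of `Pr_U Pr_V` up to zeros: the powers of `X` account for the number
of these. -/
def IsAngleSpectrum (U V : Submodule ℝ (EuclideanSpace ℝ (Fin n))) (x : Fin k → ℝ) : Prop :=
  x ∈ simplex k ∧
    X ^ k * (projMatrix U * projMatrix V).charpoly = X ^ n * ∏ j, (X - C (x j))

lemma isAngleSpectrum_eigs (b : OrthonormalBasis (Fin k) ℝ U)
    (V : Submodule ℝ (EuclideanSpace ℝ (Fin n))) :
    IsAngleSpectrum U V (eigs (compress_isHermitian b V)) :=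
  ⟨compress_eigs_mem_simplex b V, by
    rw [X_pow_mul_charpoly_projMatrix_mul b V, charpoly_eq_prod_eigs (compress_isHermitian b V)]⟩

lemma IsAngleSpectrum.symm (h : IsAngleSpectrum U V x) : IsAngleSpectrum V U x :=
  ⟨h.1, by rw [Matrix.charpoly_mul_comm, h.2]⟩

lemma IsAngleSpectrum.comp_cast {m : ℕ} (h : IsAngleSpectrum U V x) (hm : m = k) :
    IsAngleSpectrum U V (x ∘ Fin.cast hm) := by
  subst hm
  exact h

end Eigs

section Blocks

open Polynomial

lemma charmatrix_fromBlocks_mul_of_isIdempotentElem {R m n : Type*} [CommRing R] [Fintype m]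
    [Fintype n] [DecidableEq m] [DecidableEq n] {A : Matrix m m R} {B : Matrix m n R}
    {D : Matrix n m R} {E : Matrix n n R} (h : IsIdempotentElem (Matrix.fromBlocks A B D E)) :
    (Matrix.fromBlocks A B D E).charmatrix *
        Matrix.fromBlocks 1 (B.map C) 0 (1 - E).charmatrix =
      Matrix.fromBlocks A.charmatrix 0 (-(D.map C)) (Matrix.scalar n (X * (X - 1) : R[X])) := by
  rw [IsIdempotentElem, Matrix.fromBlocks_multiply, Matrix.fromBlocks_inj] at h
  obtain ⟨-, h₁₂, -, h₂₂⟩ := h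
  replace h₁₂ := congrArg (fun N => N.map (C : R →+* R[X])) h₁₂
  replace h₂₂ := congrArg (fun N => N.map (C : R →+* R[X])) h₂₂
  simp only [Matrix.map_add _ (map_add C), Matrix.map_mul] at h₁₂ h₂₂
  rw [Matrix.charmatrix_fromBlocks, Matrix.fromBlocks_multiply]
  simp only [Matrix.charmatrix, RingHom.mapMatrix_apply, Matrix.mul_one, Matrix.mul_zero,
    add_zero, Matrix.scalar_apply, ← Matrix.smul_one_eq_diagonal, Matrix.map_sub _ (map_sub C),
    Matrix.map_one _ (map_zero C) (map_one C), Matrix.sub_mul, Matrix.mul_sub, Matrix.neg_mul,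
    Matrix.smul_mul, Matrix.mul_smul, Matrix.one_mul, smul_neg]
  congr 1
  · rw [eq_sub_of_add_eq h₁₂]
    abel
  · rw [eq_sub_of_add_eq h₂₂]
    simp only [smul_smul, smul_sub, mul_sub, mul_one, sub_smul]
    abel

lemma charpoly_mul_pow_of_isIdempotentElem {R m n : Type*} [CommRing R] [Fintype m] [Fintype n]
    [DecidableEq m] [DecidableEq n] {M : Matrix (m ⊕ n) (m ⊕ n) R} (hM : IsIdempotentElem M) :
    M.toBlocks₁₁.charpoly * (X * (X - 1)) ^ Fintype.card n =
      M.charpoly * (1 - M.toBlocks₂₂).charpoly := by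
  rw [← Matrix.fromBlocks_toBlocks M] at hM
  have hdet := congrArg Matrix.det (charmatrix_fromBlocks_mul_of_isIdempotentElem hM)
  rw [Matrix.fromBlocks_toBlocks, Matrix.det_mul, Matrix.det_fromBlocks_zero₂₁,
    Matrix.det_fromBlocks_zero₁₂, Matrix.det_one, one_mul, Matrix.scalar_apply,
    Matrix.det_diagonal, Finset.prod_const, Finset.card_univ] at hdet
  exact hdet.symm

variable {n k : ℕ}

lemma splitEquiv_inl (h : k ≤ n) (a : Fin (n - k)) :
    splitEquiv h (Sum.inl a) = Fin.castLE (Nat.sub_le n k) a := rfl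

lemma toBlocks₁₁_submatrix_splitEquiv {R : Type*} (h : k ≤ n) (N : Matrix (Fin n) (Fin n) R) :
    (N.submatrix (splitEquiv h) (splitEquiv h)).toBlocks₁₁ =
      N.submatrix (Fin.castLE (Nat.sub_le n k)) (Fin.castLE (Nat.sub_le n k)) := rfl

lemma coe_splitEquiv_inr (h : k ≤ n) (t : Fin k) :
    (splitEquiv h (Sum.inr t) : ℕ) = n - k + t := by
  simp [splitEquiv]

lemma single_mem_coordSubspace_orthogonal {j : Fin n} (hj : ¬ n ≤ (j : ℕ) + k) :
    EuclideanSpace.single j (1 : ℝ) ∈ (coordSubspace n k)ᗮ := by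
  refine Submodule.isOrtho_span.2 ?_ (Submodule.mem_span_singleton_self _)
  rintro _ rfl _ ⟨l, hl, rfl⟩
  have hjl : j ≠ l := fun h => hj (h ▸ hl)
  simp [EuclideanSpace.inner_single_left, hjl]

lemma projMatrix_coordSubspace (n k : ℕ) :
    projMatrix (coordSubspace n k) =
      Matrix.diagonal fun j : Fin n => if n ≤ (j : ℕ) + k then (1 : ℝ) else 0 := by
  ext a c
  rw [projMatrix, Matrix.of_apply, Matrix.diagonal_apply]
  by_cases hc : n ≤ (c : ℕ) + k
  · have hmem : EuclideanSpace.single c (1 : ℝ) ∈ coordSubspace n k :=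
      Submodule.subset_span ⟨c, hc, rfl⟩
    rw [Submodule.starProjection_eq_self_iff.2 hmem]
    by_cases hac : a = c
    · simp [hac, hc]
    · simp [hac]
  · rw [(Submodule.starProjection_apply_eq_zero_iff _).2 (single_mem_coordSubspace_orthogonal hc)]
    by_cases hac : a = c
    · simp [hac, hc]
    · simp [hac]

lemma projMatrix_coordSubspace_submatrix (h : k ≤ n) :
    (projMatrix (coordSubspace n k)).submatrix (splitEquiv h) (splitEquiv h) =
      Matrix.fromBlocks 0 0 0 1 := by
  rw [projMatrix_coordSubspace, Matrix.submatrix_diagonal_equiv, ← Matrix.diagonal_zero,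
    ← Matrix.diagonal_one, Matrix.fromBlocks_diagonal]
  congr 1
  funext a
  rcases a with a | t
  · simp [splitEquiv_inl, show ¬ n ≤ (a : ℕ) + k by omega]
  · simp [coe_splitEquiv_inr, show n ≤ n - k + (t : ℕ) + k by omega]

lemma charpoly_projMatrix_coordSubspace_mul (h : k ≤ n) (P : Matrix (Fin n) (Fin n) ℝ) :
    (projMatrix (coordSubspace n k) * P).charpoly =
      X ^ (n - k) * (P.submatrix (splitEquiv h) (splitEquiv h)).toBlocks₂₂.charpoly := by
  set e := splitEquiv h
  rw [← Matrix.charpoly_reindex e.symm, Matrix.reindex_apply, Equiv.symm_symm,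
    ← Matrix.submatrix_mul_equiv _ _ e e e, projMatrix_coordSubspace_submatrix]
  conv_lhs => rw [← Matrix.fromBlocks_toBlocks (P.submatrix e e)]
  simp only [Matrix.fromBlocks_multiply, Matrix.zero_mul, Matrix.one_mul, zero_add, add_zero,
    Matrix.charpoly_fromBlocks_zero₁₂, Matrix.charpoly_zero, Fintype.card_fin]

lemma charpoly_toBlocks₂₂_of_isAngleSpectrum (h : k ≤ n)
    {V : Submodule ℝ (EuclideanSpace ℝ (Fin n))} {x : Fin k → ℝ}
    (hx : IsAngleSpectrum (coordSubspace n k) V x) :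
    ((projMatrix V).submatrix (splitEquiv h) (splitEquiv h)).toBlocks₂₂.charpoly =
      ∏ j, (X - C (x j)) := by
  have hx2 := hx.2
  rw [charpoly_projMatrix_coordSubspace_mul h, ← mul_assoc, ← pow_add, Nat.add_sub_cancel' h]
    at hx2
  exact mul_left_cancel₀ (pow_ne_zero n X_ne_zero) hx2

lemma charpoly_projMatrix_orthogonal_corner {V : Submodule ℝ (EuclideanSpace ℝ (Fin n))}
    {i : ℕ} (hV : Module.finrank ℝ V = i) (hki : k ≤ i) (hkn : k + i ≤ n) {x : Fin k → ℝ}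
    (hx : IsAngleSpectrum (coordSubspace n k) V x) :
    ((projMatrix Vᗮ).submatrix (Fin.castLE (Nat.sub_le n k))
      (Fin.castLE (Nat.sub_le n k))).charpoly =
      X ^ (i - k) * (X - 1) ^ (n - i - k) * ∏ j, (X - C (x j)) := by
  have hkn' : k ≤ n := by omega
  set e := splitEquiv hkn'
  have hidem : IsIdempotentElem ((projMatrix Vᗮ).submatrix e e) := by
    rw [IsIdempotentElem, Matrix.submatrix_mul_equiv, (isIdempotentElem_projMatrix Vᗮ).eq]
  have hblock : 1 - ((projMatrix Vᗮ).submatrix e e).toBlocks₂₂ =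
      ((projMatrix V).submatrix e e).toBlocks₂₂ := by
    ext a b
    simp [projMatrix_orthogonal, Matrix.toBlocks₂₂, Matrix.one_apply]
  have hcharpoly : ((projMatrix Vᗮ).submatrix e e).charpoly = (projMatrix Vᗮ).charpoly :=
    Matrix.charpoly_reindex e.symm (projMatrix Vᗮ)
  have hdim : Module.finrank ℝ Vᗮ = n - i := by
    have := V.finrank_add_finrank_orthogonal
    rw [hV, finrank_euclideanSpace, Fintype.card_fin] at this
    omega
  have key := charpoly_mul_pow_of_isIdempotentElem hidem
  rw [toBlocks₁₁_submatrix_splitEquiv, hblock, charpoly_toBlocks₂₂_of_isAngleSpectrum hkn' hx,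
    hcharpoly, charpoly_projMatrix, hdim, Fintype.card_fin] at key
  refine mul_right_cancel₀ (pow_ne_zero k (mul_ne_zero X_ne_zero (X_sub_C_ne_zero 1)))
    (key.trans ?_)
  obtain ⟨p, rfl⟩ := Nat.exists_eq_add_of_le hki
  obtain ⟨q, rfl⟩ := Nat.exists_eq_add_of_le hkn
  rw [show k + (k + p) + q - (k + p) = k + q by omega,
    show k + (k + p) + q - (k + q) = k + p by omega, Nat.add_sub_cancel_left,
    Nat.add_sub_cancel_left, map_one, mul_pow]
  ring

/-- The element of `K_k` with diagonal blocks `a ∈ O(n - k)` and `b ∈ O(k)`. -/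
def blockDiagOn (h : k ≤ n) (a : On (n - k)) (b : On k) : On n :=
  ⟨Matrix.reindex (splitEquiv h) (splitEquiv h)
    (Matrix.fromBlocks (a : Matrix (Fin (n - k)) (Fin (n - k)) ℝ) 0 0
      (b : Matrix (Fin k) (Fin k) ℝ)), by
    rw [Matrix.mem_orthogonalGroup_iff, Matrix.transpose_reindex, Matrix.reindex_apply,
      Matrix.reindex_apply, Matrix.submatrix_mul_equiv, Matrix.fromBlocks_transpose,
      Matrix.fromBlocks_multiply]
    simp [coe_mul_transpose]⟩

lemma memK_iff_exists_blockDiagOn {h : k ≤ n} {γ : On n} :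
    MemK h γ ↔ ∃ a b, γ = blockDiagOn h a b :=
  exists₂_congr fun a b => (Subtype.ext_iff (a1 := γ) (a2 := blockDiagOn h a b)).symm

lemma continuous_blockDiagOn (h : k ≤ n) :
    Continuous fun p : On (n - k) × On k => blockDiagOn h p.1 p.2 :=
  Continuous.subtype_mk (Continuous.matrix_submatrix
    (Continuous.matrix_fromBlocks (continuous_subtype_val.comp continuous_fst) continuous_const
      continuous_const (continuous_subtype_val.comp continuous_snd)) _ _) _

lemma blockDiagOn_mul (h : k ≤ n) (a a' : On (n - k)) (b b' : On k) :
    blockDiagOn h (a * a') (b * b') = blockDiagOn h a b * blockDiagOn h a' b' := by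
  apply Subtype.ext
  simp only [blockDiagOn, Submonoid.coe_mul, Matrix.reindex_apply, Matrix.submatrix_mul_equiv,
    Matrix.fromBlocks_multiply, Matrix.mul_zero, Matrix.zero_mul, add_zero, zero_add]

lemma blockDiagOn_submatrix (h : k ≤ n) (a : On (n - k)) (b : On k) :
    (blockDiagOn h a b : Matrix (Fin n) (Fin n) ℝ).submatrix (splitEquiv h) (splitEquiv h) =
      Matrix.fromBlocks (a : Matrix (Fin (n - k)) (Fin (n - k)) ℝ) 0 0
        (b : Matrix (Fin k) (Fin k) ℝ) := by
  simp [blockDiagOn]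

lemma blockDiagOn_conj_corner (h : k ≤ n) (a : On (n - k)) (b : On k)
    (Q : Matrix (Fin n) (Fin n) ℝ) :
    ((blockDiagOn h a b : Matrix (Fin n) (Fin n) ℝ) * Q *
      (blockDiagOn h a b : Matrix (Fin n) (Fin n) ℝ)ᵀ).submatrix
      (Fin.castLE (Nat.sub_le n k)) (Fin.castLE (Nat.sub_le n k)) =
    (a : Matrix (Fin (n - k)) (Fin (n - k)) ℝ) *
      Q.submatrix (Fin.castLE (Nat.sub_le n k)) (Fin.castLE (Nat.sub_le n k)) *
      (a : Matrix (Fin (n - k)) (Fin (n - k)) ℝ)ᵀ := by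
  set e := splitEquiv h with he
  rw [← toBlocks₁₁_submatrix_splitEquiv h, ← toBlocks₁₁_submatrix_splitEquiv h, ← he,
    ← Matrix.submatrix_mul_equiv _ _ e e e, ← Matrix.submatrix_mul_equiv _ _ e e e,
    ← Matrix.transpose_submatrix, blockDiagOn_submatrix]
  conv_lhs => rw [← Matrix.fromBlocks_toBlocks (Q.submatrix e e)]
  rw [Matrix.fromBlocks_transpose, Matrix.fromBlocks_multiply, Matrix.fromBlocks_multiply,
    Matrix.toBlocks_fromBlocks₁₁]
  simp

end Blocks

section Simplex

open Polynomial

variable {k : ℕ}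

lemma isCompact_simplex (k : ℕ) : IsCompact (simplex k) := by
  have hcube : IsCompact (Set.univ.pi fun _ : Fin k => Set.Icc (0 : ℝ) 1) :=
    isCompact_univ_pi fun _ => isCompact_Icc
  refine hcube.of_isClosed_subset ?_ fun x hx j _ => hx.2 j
  simp only [simplex, Antitone, Set.ofPred_and, Set.ofPred_forall]
  exact (isClosed_iInter fun a => isClosed_iInter fun b => isClosed_iInter fun _ =>
      isClosed_le (continuous_apply b) (continuous_apply a)).inter
    (isClosed_iInter fun j => (isClosed_le continuous_const (continuous_apply j)).inter
      (isClosed_le (continuous_apply j) continuous_const))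

-- `t = 0` is excluded because the relation between roots and charpoly below loses it.
lemma isEmbedding_eval_prod_X_sub_C (k : ℕ) :
    Topology.IsEmbedding fun (x : simplex k) (t : {t : ℝ // t ≠ 0}) => ∏ j, (t.1 - x.1 j) := by
  have : CompactSpace (simplex k) := isCompact_iff_compactSpace.1 (isCompact_simplex k)
  refine (Continuous.isClosedEmbedding (continuous_pi fun t => continuous_finsetProd _ fun j _ =>
    continuous_const.sub ((continuous_apply j).comp continuous_subtype_val))
    fun x y h => ?_).isEmbedding
  refine Subtype.ext (eq_of_prod_X_sub_C_eq x.2.1 y.2.1 ?_)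
  refine Polynomial.eq_of_infinite_eval_eq _ _
    ((Set.finite_singleton (0 : ℝ)).infinite_compl.mono fun t ht => ?_)
  simpa [Polynomial.eval_prod] using congrFun h ⟨t, ht⟩

lemma continuous_of_isAngleSpectrum {Y : Type*} [TopologicalSpace Y] {n : ℕ}
    {U : Submodule ℝ (EuclideanSpace ℝ (Fin n))} {V : Y → Submodule ℝ (EuclideanSpace ℝ (Fin n))}
    (hV : Continuous fun y => projMatrix (V y)) {x : Y → Fin k → ℝ}
    (hx : ∀ y, IsAngleSpectrum U (V y) (x y)) : Continuous x := by
  have heval : ∀ (y : Y) (t : {t : ℝ // t ≠ 0}), ∏ j, (t.1 - x y j) = (t.1 ^ n)⁻¹ *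
      (t.1 ^ k * (Matrix.scalar (Fin n) t.1 - projMatrix U * projMatrix (V y)).det) := by
    intro y t
    have h := congrArg (Polynomial.eval t.1) (hx y).2
    simp only [eval_mul, eval_pow, eval_X, Matrix.eval_charpoly, eval_prod, eval_sub,
      eval_C] at h
    rw [h, inv_mul_cancel_left₀ (pow_ne_zero n t.2)]
  suffices h : Continuous fun y => (⟨x y, (hx y).1⟩ : simplex k) from
    continuous_subtype_val.comp h
  refine (isEmbedding_eval_prod_X_sub_C k).continuous_iff.2 (continuous_pi fun t => ?_)
  simp only [Function.comp_apply, heval]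
  fun_prop

/-- The interior of `simplex k`. -/
def openSimplex (k : ℕ) : Set (Fin k → ℝ) := {x | StrictAnti x ∧ ∀ j, 0 < x j ∧ x j < 1}

lemma isOpen_openSimplex (k : ℕ) : IsOpen (openSimplex k) := by
  simp only [openSimplex, StrictAnti, Set.ofPred_and, Set.ofPred_forall]
  exact (isOpen_iInter_of_finite fun a => isOpen_iInter_of_finite fun b =>
      isOpen_iInter_of_finite fun _ => isOpen_lt (continuous_apply b) (continuous_apply a)).inter
    (isOpen_iInter_of_finite fun j => (isOpen_lt continuous_const (continuous_apply j)).inter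
      (isOpen_lt (continuous_apply j) continuous_const))

lemma openSimplex_subset_simplex (k : ℕ) : openSimplex k ⊆ simplex k :=
  fun _ hx => ⟨hx.1.antitone, fun j => ⟨(hx.2 j).1.le, (hx.2 j).2.le⟩⟩

lemma volume_setOf_apply_eq_apply {ι : Type*} [Fintype ι] {a b : ι} (hab : a ≠ b) :
    volume {x : ι → ℝ | x a = x b} = 0 := by
  classical
  let L : (ι → ℝ) →ₗ[ℝ] ℝ :=
    LinearMap.proj (R := ℝ) (φ := fun _ : ι => ℝ) a - LinearMap.proj (R := ℝ) b
  have hker : {x : ι → ℝ | x a = x b} = (LinearMap.ker L : Set (ι → ℝ)) := by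
    ext x
    simp [L, sub_eq_zero]
  rw [hker]
  refine Measure.addHaar_submodule _ _ fun htop => ?_
  have : (Pi.single a (1 : ℝ) : ι → ℝ) ∈ LinearMap.ker L := htop ▸ Submodule.mem_top
  simp [L, hab.symm] at this

lemma volume_setOf_apply_eq_const {ι : Type*} [Fintype ι] (a : ι) (c : ℝ) :
    volume {x : ι → ℝ | x a = c} = 0 :=
  Measure.pi_hyperplane (fun _ : ι => (volume : Measure ℝ)) a c

lemma openSimplex_ae_eq_simplex (k : ℕ) : openSimplex k =ᵐ[volume] simplex k := by
  have hne : ∀ᵐ x : Fin k → ℝ, ∀ a b, a ≠ b → x a ≠ x b := by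
    simp only [ae_all_iff]
    intro a b hab
    simpa only [ae_iff, ne_eq, not_not] using volume_setOf_apply_eq_apply hab
  have hconst : ∀ c : ℝ, ∀ᵐ x : Fin k → ℝ, ∀ a, x a ≠ c := fun c =>
    ae_all_iff.2 fun a => by
      simpa only [ae_iff, ne_eq, not_not] using volume_setOf_apply_eq_const a c
  filter_upwards [hne, hconst 0, hconst 1] with x hx h0 h1
  refine propext ⟨fun h => openSimplex_subset_simplex k h, fun h =>
    ⟨fun a b hab => (h.1 hab.le).lt_of_ne (hx b a hab.ne'), fun j =>
      ⟨(h.2 j).1.lt_of_ne (h0 j).symm, (h.2 j).2.lt_of_ne (h1 j)⟩⟩⟩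

/-- The weight `∏_{j<k} (x_j - x_k) ∏_j x_j^α (1 - x_j)^β` of the Jacobi ensemble, which is the
density of `nu k α β`. -/
def jacobiWeight (α β : ℝ) (x : Fin k → ℝ) : ℝ :=
  vandermondeProd x * ∏ j, x j ^ α * (1 - x j) ^ β

lemma measurable_jacobiWeight (α β : ℝ) : Measurable (jacobiWeight (k := k) α β) := by
  unfold jacobiWeight vandermondeProd
  fun_prop

lemma lintegral_nu (α β : ℝ) {φ : (Fin k → ℝ) → ENNReal} (hφ : Measurable φ) :
    ∫⁻ x, φ x ∂nu k α β = ∫⁻ x in openSimplex k, φ x * ENNReal.ofReal (jacobiWeight α β x) := by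
  have hnu : nu k α β = (volume.restrict (openSimplex k)).withDensity
      fun x => ENNReal.ofReal (jacobiWeight α β x) := by
    rw [Measure.restrict_congr_set (openSimplex_ae_eq_simplex k)]
    rfl
  rw [hnu, lintegral_withDensity_eq_lintegral_mul _ (measurable_jacobiWeight α β).ennreal_ofReal
    hφ]
  simp only [Pi.mul_apply, mul_comm]

/-- The sequence `1, x_1, …, x_k, 0`. -/
def withEndpoints (x : Fin k → ℝ) : Fin (k + 2) → ℝ :=
  Fin.cons 1 (Fin.snoc x 0 : Fin (k + 1) → ℝ)

@[simp]
lemma withEndpoints_zero (x : Fin k → ℝ) : withEndpoints x 0 = 1 := rfl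

@[simp]
lemma withEndpoints_castSucc_succ (x : Fin k → ℝ) (j : Fin k) :
    withEndpoints x j.castSucc.succ = x j := by
  simp [withEndpoints]

lemma withEndpoints_succ_castSucc (x : Fin k → ℝ) (j : Fin k) :
    withEndpoints x j.succ.castSucc = x j := by
  rw [← Fin.succ_castSucc, withEndpoints_castSucc_succ]

lemma withEndpoints_last (x : Fin k → ℝ) : withEndpoints x (Fin.last k).succ = 0 := by
  rw [withEndpoints, Fin.cons_succ, Fin.snoc_last]

lemma mem_interlacing_withEndpoints_iff {x : Fin k → ℝ} {b : Fin (k + 1) → ℝ} :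
    b ∈ interlacing (withEndpoints x) ↔
      (b 0 < 1 ∧ 0 < b (Fin.last k)) ∧ x ∈ interlacing b := by
  constructor
  · intro h
    refine ⟨⟨by simpa using (h 0).2, withEndpoints_last x ▸ (h (Fin.last k)).1⟩,
      fun l => ⟨?_, ?_⟩⟩
    · exact withEndpoints_succ_castSucc x l ▸ (h l.succ).2
    · exact withEndpoints_castSucc_succ x l ▸ (h l.castSucc).1
  · rintro ⟨⟨h1, h0⟩, h⟩ l
    constructor
    · cases l using Fin.lastCases with
      | last => rwa [withEndpoints_last]
      | cast j => simpa using (h j).2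
    · cases l using Fin.cases with
      | zero => simpa using h1
      | succ j => exact (withEndpoints_succ_castSucc x j).symm ▸ (h j).1

lemma strictAnti_withEndpoints {x : Fin k → ℝ} (hx : x ∈ openSimplex k) :
    StrictAnti (withEndpoints x) := by
  rw [Fin.strictAnti_iff_succ_lt]
  intro l
  have hpos : 0 < withEndpoints x (Fin.last k).castSucc := by
    rcases k with _ | k
    · exact one_pos
    · rw [← Fin.succ_last, withEndpoints_succ_castSucc]
      exact (hx.2 _).1
  cases l using Fin.lastCases with
  | last => rwa [withEndpoints_last]
  | cast j =>
    rw [withEndpoints_castSucc_succ]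
    rcases k with _ | k
    · exact j.elim0
    · cases j using Fin.cases with
      | zero => simpa using (hx.2 0).2
      | succ t =>
        rw [← Fin.succ_castSucc, withEndpoints_succ_castSucc]
        exact hx.1 Fin.castSucc_lt_succ

lemma mem_openSimplex_and_mem_interlacing_iff {x : Fin k → ℝ} {b : Fin (k + 1) → ℝ} :
    x ∈ openSimplex k ∧ b ∈ interlacing (withEndpoints x) ↔
      b ∈ openSimplex (k + 1) ∧ x ∈ interlacing b := by
  constructor
  · rintro ⟨hx, hb⟩
    have hanti := strictAnti_of_mem_interlacing (strictAnti_withEndpoints hx) hb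
    obtain ⟨⟨h1, h0⟩, hxb⟩ := mem_interlacing_withEndpoints_iff.1 hb
    exact ⟨⟨hanti, fun j => ⟨h0.trans_le (hanti.antitone (Fin.le_last j)),
      (hanti.antitone (Fin.zero_le j)).trans_lt h1⟩⟩, hxb⟩
  · rintro ⟨hb, hx⟩
    exact ⟨⟨strictAnti_of_mem_interlacing hb.1 hx, fun j => ⟨(hb.2 _).1.trans (hx j).1,
      (hx j).2.trans (hb.2 _).2⟩⟩,
      mem_interlacing_withEndpoints_iff.2 ⟨⟨(hb.2 _).2, (hb.2 _).1⟩, hx⟩⟩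

end Simplex

section JacobiTransition

variable {K k : ℕ}

lemma prod_nodeRatio {δ : Fin (K + 1) → ℝ} (hδ : StrictAnti δ) {b : Fin K → ℝ}
    (hb : b ∈ interlacing δ) (j : Fin (K + 1)) :
    ∏ l, nodeRatio δ b j l = (∏ l, |δ j - b l|) / ∏ l, |δ j - δ (j.succAbove l)| := by
  rw [← Finset.prod_div_distrib]
  refine Finset.prod_congr rfl fun l _ => ?_
  rw [← abs_div, ← abs_of_pos (nodeRatio_pos hδ hb j l), nodeRatio]

lemma prod_prod_nodeRatio {δ : Fin (K + 1) → ℝ} (hδ : StrictAnti δ) {b : Fin K → ℝ}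
    (hb : b ∈ interlacing δ) :
    ∏ j, ∏ l, nodeRatio δ b j l = (∏ j, ∏ l, |δ j - b l|) / vandermondeProd δ ^ 2 := by
  have hvdm : ∏ j, ∏ l, |δ j - δ (j.succAbove l)| = vandermondeProd δ ^ 2 := by
    rw [← sq_abs, ← prod_prod_compl_abs_sub]
    exact Finset.prod_congr rfl fun j _ =>
      (prod_compl_singleton_eq_prod_succAbove (fun k => |δ j - δ k|) j).symm
  simp only [prod_nodeRatio hδ hb, Finset.prod_div_distrib, hvdm]

lemma prod_prod_nodeRatio_rpow {δ : Fin (K + 1) → ℝ} (hδ : StrictAnti δ) {b : Fin K → ℝ}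
    (hb : b ∈ interlacing δ) (s : Fin (K + 1) → ℝ) :
    ∏ j, ∏ l, nodeRatio δ b j l ^ s j = ∏ j, (∏ l, nodeRatio δ b j l) ^ s j :=
  Finset.prod_congr rfl fun j _ =>
    Real.finsetProd_rpow _ _ (fun l _ => (nodeRatio_pos hδ hb j l).le) _

lemma interlacingWeight_const {b : Fin (K + 1) → ℝ} (hb : StrictAnti b) {x : Fin K → ℝ}
    (hx : x ∈ interlacing b) (s : ℝ) :
    interlacingWeight b (fun _ => s) x = vandermondeProd x / vandermondeProd b *
      ((∏ j, ∏ l, |x j - b l|) / vandermondeProd b ^ 2) ^ (s - 1) := by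
  rw [interlacingWeight, prod_prod_nodeRatio_rpow hb hx (fun _ => s - 1),
    Real.finsetProd_rpow _ _ (fun j _ =>
      Finset.prod_nonneg fun l _ => (nodeRatio_pos hb hx j l).le), prod_prod_nodeRatio hb hx,
    Finset.prod_comm]
  simp only [abs_sub_comm]

lemma vandermondeProd_withEndpoints (x : Fin k → ℝ) :
    vandermondeProd (withEndpoints x) =
      (∏ j, (1 - x j)) * (vandermondeProd x * ∏ j, x j) := by
  rw [withEndpoints, vandermondeProd_cons, vandermondeProd_snoc, Fin.prod_univ_castSucc]
  simp

lemma prod_withEndpoints {M : Type*} [CommMonoid M] (x : Fin k → ℝ) (f : ℝ → M) :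
    ∏ j, f (withEndpoints x j) = f 1 * ((∏ j, f (x j)) * f 0) := by
  rw [Fin.prod_univ_succ, Fin.prod_univ_castSucc]
  simp only [withEndpoints_zero, withEndpoints_castSucc_succ, withEndpoints_last]

lemma abs_prod_sub_openSimplex {x : Fin k → ℝ} (hx : x ∈ openSimplex k) :
    ∏ j, |1 - x j| = ∏ j, (1 - x j) ∧ ∏ j, |0 - x j| = ∏ j, x j :=
  ⟨Finset.prod_congr rfl fun j _ => abs_of_pos (sub_pos.2 (hx.2 j).2),
    Finset.prod_congr rfl fun j _ => by rw [zero_sub, abs_neg, abs_of_pos (hx.2 j).1]⟩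

variable {x : Fin k → ℝ} {b : Fin (k + 1) → ℝ}

lemma prod_nodeRatio_withEndpoints_zero (hx : x ∈ openSimplex k)
    (hb : b ∈ interlacing (withEndpoints x)) :
    ∏ l, nodeRatio (withEndpoints x) b 0 l = (∏ l, (1 - b l)) / ∏ j, (1 - x j) := by
  have hb' := (mem_openSimplex_and_mem_interlacing_iff.1 ⟨hx, hb⟩).1
  rw [prod_nodeRatio (strictAnti_withEndpoints hx) hb, ← (abs_prod_sub_openSimplex hx).1,
    ← (abs_prod_sub_openSimplex hb').1]
  congr 1
  rw [Fin.prod_univ_castSucc]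
  simp only [Fin.zero_succAbove, withEndpoints_zero, withEndpoints_castSucc_succ,
    withEndpoints_last, sub_zero, abs_one, mul_one]

lemma prod_nodeRatio_withEndpoints_last (hx : x ∈ openSimplex k)
    (hb : b ∈ interlacing (withEndpoints x)) :
    ∏ l, nodeRatio (withEndpoints x) b (Fin.last k).succ l = (∏ l, b l) / ∏ j, x j := by
  have hb' := (mem_openSimplex_and_mem_interlacing_iff.1 ⟨hx, hb⟩).1
  rw [prod_nodeRatio (strictAnti_withEndpoints hx) hb, ← (abs_prod_sub_openSimplex hx).2,
    ← (abs_prod_sub_openSimplex hb').2, withEndpoints_last]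
  congr 1
  rw [Fin.prod_univ_succ]
  simp only [Fin.succ_last, Fin.succAbove_last, Fin.castSucc_zero, withEndpoints_zero,
    withEndpoints_succ_castSucc, zero_sub, abs_neg, abs_one, one_mul]

lemma prod_prod_nodeRatio_withEndpoints_mid (hx : x ∈ openSimplex k)
    (hb : b ∈ interlacing (withEndpoints x)) :
    ∏ j : Fin k, ∏ l, nodeRatio (withEndpoints x) b j.castSucc.succ l =
      (∏ j, ∏ l, |x j - b l|) /
        (vandermondeProd x ^ 2 * (∏ j, x j) * ∏ j, (1 - x j)) := by
  have hb' := (mem_openSimplex_and_mem_interlacing_iff.1 ⟨hx, hb⟩).1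
  have hall := prod_prod_nodeRatio (strictAnti_withEndpoints hx) hb
  rw [Fin.prod_univ_succ (n := k + 1), Fin.prod_univ_castSucc (n := k) (fun j => ∏ l, _),
    prod_nodeRatio_withEndpoints_zero hx hb, prod_nodeRatio_withEndpoints_last hx hb,
    prod_withEndpoints x fun t => ∏ l, |t - b l|,
    (abs_prod_sub_openSimplex hb').1, (abs_prod_sub_openSimplex hb').2,
    vandermondeProd_withEndpoints] at hall
  have := vandermondeProd_pos hx.1
  have : 0 < ∏ j, x j := Finset.prod_pos fun j _ => (hx.2 j).1
  have : 0 < ∏ j, (1 - x j) := Finset.prod_pos fun j _ => sub_pos.2 (hx.2 j).2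
  have : 0 < ∏ l, b l := Finset.prod_pos fun l _ => (hb'.2 l).1
  have : 0 < ∏ l, (1 - b l) := Finset.prod_pos fun l _ => sub_pos.2 (hb'.2 l).2
  rw [eq_div_iff (by positivity)]
  field_simp at hall
  linear_combination hall

lemma interlacingWeight_withEndpoints (hx : x ∈ openSimplex k)
    (hb : b ∈ interlacing (withEndpoints x)) {s : Fin (k + 2) → ℝ} {r : ℝ}
    (hs : ∀ j : Fin k, s j.castSucc.succ = r) :
    interlacingWeight (withEndpoints x) s b =
      vandermondeProd b / ((∏ j, (1 - x j)) * (vandermondeProd x * ∏ j, x j)) *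
        (((∏ l, (1 - b l)) / ∏ j, (1 - x j)) ^ (s 0 - 1) *
          (((∏ j, ∏ l, |x j - b l|) /
            (vandermondeProd x ^ 2 * (∏ j, x j) * ∏ j, (1 - x j))) ^ (r - 1) *
          ((∏ l, b l) / ∏ j, x j) ^ (s (Fin.last k).succ - 1))) := by
  have hδ := strictAnti_withEndpoints hx
  rw [interlacingWeight, prod_prod_nodeRatio_rpow hδ hb (fun j => s j - 1),
    Fin.prod_univ_succ (n := k + 1), Fin.prod_univ_castSucc (n := k) (fun j => (∏ l, _) ^ _),
    vandermondeProd_withEndpoints]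
  simp only [hs]
  rw [Real.finsetProd_rpow _ _ (fun j _ =>
      Finset.prod_nonneg fun l _ => (nodeRatio_pos hδ hb _ l).le),
    prod_nodeRatio_withEndpoints_zero hx hb, prod_prod_nodeRatio_withEndpoints_mid hx hb,
    prod_nodeRatio_withEndpoints_last hx hb]

lemma jacobiWeight_eq_of_mem_openSimplex (α β : ℝ) (hx : x ∈ openSimplex k) :
    jacobiWeight α β x = vandermondeProd x * ((∏ j, x j) ^ α * (∏ j, (1 - x j)) ^ β) := by
  rw [jacobiWeight, Finset.prod_mul_distrib,
    Real.finsetProd_rpow _ _ (fun j _ => (hx.2 j).1.le),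
    Real.finsetProd_rpow _ _ (fun j _ => (sub_pos.2 (hx.2 j).2).le)]

lemma jacobiWeight_nonneg (α β : ℝ) (hx : x ∈ openSimplex k) : 0 ≤ jacobiWeight α β x :=
  mul_nonneg (vandermondeProd_pos hx.1).le (Finset.prod_nonneg fun j _ =>
    mul_nonneg (Real.rpow_nonneg (hx.2 j).1.le _) (Real.rpow_nonneg (sub_pos.2 (hx.2 j).2).le _))

-- Bayes' rule: `x` followed by `b` given `x` has the same joint density as `b` followed by `x`
-- given `b`.
lemma jacobiWeight_mul_interlacingWeight (hx : x ∈ openSimplex k)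
    (hb : b ∈ interlacing (withEndpoints x)) {p q : ℝ} {s : Fin (k + 2) → ℝ} (hs0 : s 0 = p)
    (hs : ∀ j : Fin k, s j.castSucc.succ = 1 / 2) (hsl : s (Fin.last k).succ = q) :
    jacobiWeight (q - 1 / 2) (p - 1 / 2) x * interlacingWeight (withEndpoints x) s b =
      jacobiWeight (q - 1) (p - 1) b * interlacingWeight b (fun _ => 1 / 2) x := by
  obtain ⟨hb', hx'⟩ := mem_openSimplex_and_mem_interlacing_iff.1 ⟨hx, hb⟩
  rw [interlacingWeight_withEndpoints hx hb hs, interlacingWeight_const hb'.1 hx', hs0, hsl,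
    jacobiWeight_eq_of_mem_openSimplex _ _ hx, jacobiWeight_eq_of_mem_openSimplex _ _ hb']
  have hexp : ∀ {t : ℝ}, 0 < t → ∃ v, t = Real.exp v := fun ht => ⟨_, (Real.exp_log ht).symm⟩
  obtain ⟨v, hv⟩ := hexp (vandermondeProd_pos hx.1)
  obtain ⟨w, hw⟩ := hexp (vandermondeProd_pos hb'.1)
  obtain ⟨a, ha⟩ := hexp (Finset.prod_pos (s := .univ) fun j _ => (hx.2 j).1)
  obtain ⟨a', ha'⟩ := hexp (Finset.prod_pos (s := .univ) fun j _ => (hb'.2 j).1)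
  obtain ⟨c, hc⟩ := hexp (Finset.prod_pos (s := .univ) fun j _ => sub_pos.2 (hx.2 j).2)
  obtain ⟨c', hc'⟩ := hexp (Finset.prod_pos (s := .univ) fun j _ => sub_pos.2 (hb'.2 j).2)
  obtain ⟨d, hd⟩ : ∃ d, ∏ j, ∏ l, |x j - b l| = Real.exp d :=
    hexp (Finset.prod_pos fun j _ => Finset.prod_pos fun l _ => abs_pos.2 fun h => by
      have := (nodeRatio_pos hb'.1 hx' l j).ne'
      rw [nodeRatio, ← neg_sub, h, neg_zero, zero_div] at this
      exact this rfl)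
  simp only [hv, hw, ha, ha', hc, hc', hd, ← Real.exp_add, ← Real.exp_sub, ← Real.exp_mul,
    ← Real.exp_nat_mul]
  congr 1
  push_cast
  ring

lemma lintegral_interlacingWeight_half (hb : StrictAnti b) :
    ∫⁻ x in interlacing b, ENNReal.ofReal (interlacingWeight b (fun _ => 1 / 2) x) =
      ENNReal.ofReal (Real.Gamma (1 / 2) ^ (k + 1) / Real.Gamma ((k + 1) / 2)) := by
  have h := lintegral_pi_gammaMeasure (s := fun _ => (1 : ℝ) / 2) hb (fun _ => by norm_num)
    (F := fun _ => 1) (φ := fun _ => 1) measurable_const (fun _ _ => rfl)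
  have : IsProbabilityMeasure (ProbabilityTheory.gammaMeasure ((1 : ℝ) / 2) 1) :=
    ProbabilityTheory.isProbabilityMeasure_gammaMeasure (by norm_num) one_pos
  simp only [lintegral_const, measure_univ, one_mul, Finset.sum_const, Finset.prod_const,
    Finset.card_univ, Fintype.card_fin, nsmul_eq_mul, Nat.cast_add, Nat.cast_one,
    mul_one_div] at h
  have hG : 0 < Real.Gamma (((k : ℝ) + 1) / 2) := Real.Gamma_pos_of_pos (by positivity)
  have : 0 < Real.Gamma ((1 : ℝ) / 2) := Real.Gamma_pos_of_pos (by positivity)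
  rw [← mul_one (ENNReal.ofReal (_ / _)), h, ← mul_assoc, ← ENNReal.ofReal_mul (by positivity),
    div_mul_div_cancel₀ hG.ne', div_self (by positivity), ENNReal.ofReal_one, one_mul]

lemma setLIntegral_setLIntegral_eq_lintegral_indicator {X Y : Type*} [MeasurableSpace X]
    [MeasurableSpace Y] {μ : Measure X} {ν : Measure Y} {A : Set X} (hA : MeasurableSet A)
    {B : X → Set Y} (hB : ∀ x, MeasurableSet (B x)) (G : X × Y → ENNReal) :
    ∫⁻ x in A, ∫⁻ y in B x, G (x, y) ∂ν ∂μ =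
      ∫⁻ x, ∫⁻ y, {z : X × Y | z.1 ∈ A ∧ z.2 ∈ B z.1}.indicator G (x, y) ∂ν ∂μ := by
  classical
  simp only [← lintegral_indicator hA, ← lintegral_indicator (hB _)]
  refine lintegral_congr fun x => ?_
  by_cases hx : x ∈ A <;> simp [Set.indicator_apply, hx]

lemma setLIntegral_setLIntegral_swap {X Y : Type*} [MeasurableSpace X] [MeasurableSpace Y]
    {μ : Measure X} {ν : Measure Y} [SFinite μ] [SFinite ν] {A : Set X} (hA : MeasurableSet A)
    {B : X → Set Y} (hB : ∀ x, MeasurableSet (B x)) {A' : Set Y} (hA' : MeasurableSet A')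
    {B' : Y → Set X} (hB' : ∀ y, MeasurableSet (B' y))
    (hD : MeasurableSet {z : X × Y | z.1 ∈ A ∧ z.2 ∈ B z.1})
    (h : ∀ x y, x ∈ A ∧ y ∈ B x ↔ y ∈ A' ∧ x ∈ B' y) {G : X × Y → ENNReal} (hG : Measurable G) :
    ∫⁻ x in A, ∫⁻ y in B x, G (x, y) ∂ν ∂μ = ∫⁻ y in A', ∫⁻ x in B' y, G (x, y) ∂μ ∂ν := by
  have hleft := setLIntegral_setLIntegral_eq_lintegral_indicator (μ := μ) (ν := ν) hA hB G
  have hright :=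
    setLIntegral_setLIntegral_eq_lintegral_indicator (μ := ν) (ν := μ) hA' hB' (G ∘ Prod.swap)
  simp only [Function.comp_apply, Prod.swap_prod_mk] at hright
  rw [hleft, hright, lintegral_lintegral_swap (f := fun x y => Set.indicator _ G (x, y))
    (hG.indicator hD).aemeasurable]
  classical
  simp only [Set.indicator_apply, Set.mem_ofPred_eq, Function.comp_apply, Prod.swap_prod_mk, h]

lemma isOpen_setOf_mem_openSimplex_and_mem_interlacing (k : ℕ) :
    IsOpen {z : (Fin k → ℝ) × (Fin (k + 1) → ℝ) |
      z.1 ∈ openSimplex k ∧ z.2 ∈ interlacing (withEndpoints z.1)} := by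
  simp only [mem_openSimplex_and_mem_interlacing_iff]
  exact ((isOpen_openSimplex _).preimage continuous_snd).inter
    ((isOpen_setOf_mem_interlacing ℝ k).preimage continuous_swap)

lemma lintegral_jacobiWeight_transition {p q : ℝ} {s : Fin (k + 2) → ℝ} (hs0 : s 0 = p)
    (hs : ∀ j : Fin k, s j.castSucc.succ = 1 / 2) (hsl : s (Fin.last k).succ = q)
    {φ : (Fin (k + 1) → ℝ) → ENNReal} (hφ : Measurable φ) :
    ∫⁻ x in openSimplex k, (∫⁻ b in interlacing (withEndpoints x),
        φ b * ENNReal.ofReal (interlacingWeight (withEndpoints x) s b)) *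
          ENNReal.ofReal (jacobiWeight (q - 1 / 2) (p - 1 / 2) x) =
      ENNReal.ofReal (Real.Gamma (1 / 2) ^ (k + 1) / Real.Gamma ((k + 1) / 2)) *
        ∫⁻ b in openSimplex (k + 1), φ b * ENNReal.ofReal (jacobiWeight (q - 1) (p - 1) b) := by
  have hS := fun k => (isOpen_openSimplex k).measurableSet
  have hI := fun k (δ : Fin (k + 1) → ℝ) => (isOpen_interlacing δ).measurableSet
  have hw : Measurable fun z : (Fin k → ℝ) × (Fin (k + 1) → ℝ) =>
      ENNReal.ofReal (interlacingWeight z.2 (fun _ => 1 / 2) z.1) :=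
    ((measurable_interlacingWeight _).comp measurable_swap).ennreal_ofReal
  have hwb (b : Fin (k + 1) → ℝ) : Measurable fun x : Fin k → ℝ =>
      ENNReal.ofReal (interlacingWeight b (fun _ => 1 / 2) x) :=
    ((measurable_interlacingWeight (fun _ => 1 / 2)).comp
      (measurable_prodMk_left (x := b))).ennreal_ofReal
  let g : (Fin (k + 1) → ℝ) → ENNReal := fun b =>
    φ b * ENNReal.ofReal (jacobiWeight (q - 1) (p - 1) b)
  have hg : Measurable g := hφ.mul (measurable_jacobiWeight _ _).ennreal_ofReal
  calc
    _ = ∫⁻ x in openSimplex k, ∫⁻ b in interlacing (withEndpoints x),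
          g b * ENNReal.ofReal (interlacingWeight b (fun _ => 1 / 2) x) := by
      refine setLIntegral_congr_fun (hS k) fun x hx => ?_
      rw [← lintegral_mul_const' _ _ ENNReal.ofReal_ne_top]
      refine setLIntegral_congr_fun (hI _ _) fun b hb => ?_
      have hb' := (mem_openSimplex_and_mem_interlacing_iff.1 ⟨hx, hb⟩).1
      simp only [g]
      rw [mul_assoc, mul_assoc, ← ENNReal.ofReal_mul (jacobiWeight_nonneg _ _ hb'),
        ← jacobiWeight_mul_interlacingWeight hx hb hs0 hs hsl,
        ENNReal.ofReal_mul (jacobiWeight_nonneg _ _ hx)]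
      ring
    _ = ∫⁻ b in openSimplex (k + 1), ∫⁻ x in interlacing b,
          g b * ENNReal.ofReal (interlacingWeight b (fun _ => 1 / 2) x) :=
      setLIntegral_setLIntegral_swap (A := openSimplex k) (A' := openSimplex (k + 1))
        (B := fun x => interlacing (withEndpoints x)) (B' := interlacing)
        (G := fun z => g z.2 * ENNReal.ofReal (interlacingWeight z.2 (fun _ => 1 / 2) z.1))
        (hS k) (fun _ => hI _ _) (hS _) (fun _ => hI _ _)
        (isOpen_setOf_mem_openSimplex_and_mem_interlacing k).measurableSet
        (fun _ _ => mem_openSimplex_and_mem_interlacing_iff) ((hg.comp measurable_snd).mul hw)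
    _ = ∫⁻ b in openSimplex (k + 1), ENNReal.ofReal (Real.Gamma (1 / 2) ^ (k + 1) /
          Real.Gamma ((k + 1) / 2)) * g b := by
      refine setLIntegral_congr_fun (hS _) fun b hb => ?_
      rw [lintegral_const_mul _ (hwb b), lintegral_interlacingWeight_half hb.1, mul_comm]
    _ = _ := lintegral_const_mul' _ _ ENNReal.ofReal_ne_top

end JacobiTransition

section CornerTransition

open Polynomial

/-- The multiplicities `p, 1, …, 1, q` with which the numbers `withEndpoints x` occur as
eigenvalues of the corner of a projection. -/
def endpointMultiplicity (p q : ℕ) {k : ℕ} : Fin (k + 2) → ℕ :=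
  Fin.cons p (Fin.snoc (fun _ => 1) q : Fin (k + 1) → ℕ)

variable {n i k p q : ℕ}

@[to_additive]
lemma prod_endpointMultiplicity {M : Type*} [CommMonoid M] (f : Fin (k + 2) → ℕ → M) :
    ∏ j, f j (endpointMultiplicity p q j) =
      f 0 p * ((∏ j : Fin k, f j.castSucc.succ 1) * f (Fin.last k).succ q) := by
  simp [endpointMultiplicity, Fin.prod_univ_succ (n := k + 1),
    Fin.prod_univ_castSucc (n := k)]

lemma endpointMultiplicity_pos (hp : 0 < p) (hq : 0 < q) (j : Fin (k + 2)) :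
    0 < endpointMultiplicity p q j := by
  cases j using Fin.cases with
  | zero => exact hp
  | succ j => cases j using Fin.lastCases with
    | last => simpa [endpointMultiplicity] using hq
    | cast j => simp [endpointMultiplicity]

lemma prod_X_sub_C_withEndpoints_pow (x : Fin k → ℝ) (g : ℕ → ℕ) :
    ∏ j, (X - C (withEndpoints x j)) ^ g (endpointMultiplicity p q j) =
      (X - 1) ^ g p * ((∏ j, (X - C (x j)) ^ g 1) * X ^ g q) := by
  rw [prod_endpointMultiplicity fun j t => (X - C (withEndpoints x j)) ^ g t]
  simp only [withEndpoints_zero, withEndpoints_castSucc_succ, withEndpoints_last, C_1, C_0,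
    sub_zero]

lemma projMatrix_orthogonal_smul (γ : On n) (ξ : Gr n i) :
    projMatrix (γ • ξ).1ᗮ = (γ : Matrix (Fin n) (Fin n) ℝ) * projMatrix ξ.1ᗮ *
      (γ : Matrix (Fin n) (Fin n) ℝ)ᵀ := by
  rw [projMatrix_orthogonal, projMatrix_orthogonal, projMatrix_smul, Matrix.mul_sub,
    Matrix.sub_mul, Matrix.mul_one, coe_mul_transpose]

lemma lintegral_corner_eigenvalues_castLE {K N N' : ℕ} (hN : N' + 1 = N) {δ : Fin (K + 1) → ℝ}
    (hδ : StrictAnti δ) {m : Fin (K + 1) → ℕ} (hm : ∀ j, 0 < m j)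
    {A : Matrix (Fin N) (Fin N) ℝ} (hA : A.IsHermitian)
    (hχ : A.charpoly = ∏ j, (X - C (δ j)) ^ m j)
    {e : On N → Fin K → ℝ} (he : ∀ h, Antitone (e h))
    (heχ : ∀ h : On N, (((h : Matrix (Fin N) (Fin N) ℝ) * A *
      (h : Matrix (Fin N) (Fin N) ℝ)ᵀ).submatrix (Fin.castLE (by omega : N' ≤ N))
        (Fin.castLE (by omega : N' ≤ N))).charpoly =
        (∏ j, (X - C (δ j)) ^ (m j - 1)) * ∏ l, (X - C (e h l)))
    {φ : (Fin K → ℝ) → ENNReal} (hφ : Measurable φ) :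
    ∫⁻ h, φ (e h) ∂haarOn N =
      ENNReal.ofReal (Real.Gamma (∑ j, (m j : ℝ) / 2) / ∏ j, Real.Gamma ((m j : ℝ) / 2)) *
        ∫⁻ b in interlacing δ,
          φ b * ENNReal.ofReal (interlacingWeight δ (fun j => (m j : ℝ) / 2) b) := by
  subst hN
  exact lintegral_corner_eigenvalues hδ hm hA hχ he heχ hφ

/-- The normalizing constant of the law of the canonical angles between a subspace of dimension `i`
and `ℝ^(k + 1)`, given those with `ℝ^k`. -/
def transitionConst (n i k : ℕ) : ℝ :=
  Real.Gamma (((n : ℝ) - k) / 2) / (Real.Gamma (((n : ℝ) - i - k) / 2) *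
    (Real.Gamma (1 / 2) ^ k * Real.Gamma (((i : ℝ) - k) / 2)))

lemma Gamma_sum_endpointMultiplicity (hk : k ≤ i) (hkn : k + i ≤ n) :
    Real.Gamma (∑ j : Fin (k + 2), (endpointMultiplicity (n - i - k) (i - k) j : ℝ) / 2) /
      ∏ j : Fin (k + 2), Real.Gamma ((endpointMultiplicity (n - i - k) (i - k) j : ℝ) / 2) =
        transitionConst n i k := by
  rw [sum_endpointMultiplicity fun _ t => (t : ℝ) / 2,
    prod_endpointMultiplicity fun _ t => Real.Gamma ((t : ℝ) / 2), transitionConst,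
    Nat.cast_sub (by omega : k ≤ n - i), Nat.cast_sub (by omega : i ≤ n), Nat.cast_sub hk]
  simp only [Finset.sum_const, Finset.prod_const, Finset.card_univ, Fintype.card_fin,
    nsmul_eq_mul, Nat.cast_one]
  congr 2
  ring

/-- The projection onto `(h ξ)ᗮ`, restricted to the first `n - k` coordinates, is a conjugate of
that onto `ξᗮ` by a Haar-distributed matrix; omitting one more coordinate takes a corner of it. -/
lemma lintegral_angles_blockDiagOn_smul (hk : k ≤ n) (hki : k + 1 ≤ i) (hkn : k + 1 + i ≤ n)
    (ξ : Gr n i) {x : Fin k → ℝ} (hx : IsAngleSpectrum (coordSubspace n k) ξ.1 x)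
    (hxo : x ∈ openSimplex k) {e : On (n - k) → Fin (k + 1) → ℝ}
    (he : ∀ h, IsAngleSpectrum (coordSubspace n (k + 1)) (blockDiagOn hk h 1 • ξ).1 (e h))
    {φ : (Fin (k + 1) → ℝ) → ENNReal} (hφ : Measurable φ) :
    ∫⁻ h, φ (e h) ∂haarOn (n - k) = ENNReal.ofReal (transitionConst n i k) *
      ∫⁻ b in interlacing (withEndpoints x), φ b * ENNReal.ofReal (interlacingWeight
        (withEndpoints x) (fun j => (endpointMultiplicity (n - i - k) (i - k) j : ℝ) / 2) b) := by
  rw [← Gamma_sum_endpointMultiplicity (by omega) (by omega)]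
  refine lintegral_corner_eigenvalues_castLE (N' := n - (k + 1)) (by omega)
    (strictAnti_withEndpoints hxo) (endpointMultiplicity_pos (by omega) (by omega))
    ((projMatrix_isHermitian ξ.1ᗮ).submatrix (Fin.castLE (Nat.sub_le n k))) ?_
    (fun h => (he h).1.1) (fun h => ?_) hφ
  · refine Eq.trans ?_ (prod_X_sub_C_withEndpoints_pow x id).symm
    rw [charpoly_projMatrix_orthogonal_corner ξ.2 (by omega) (by omega) hx]
    simp only [id_eq, pow_one]
    ring
  · rw [← blockDiagOn_conj_corner hk h 1, ← projMatrix_orthogonal_smul,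
      prod_X_sub_C_withEndpoints_pow x (· - 1)]
    refine (charpoly_projMatrix_orthogonal_corner (blockDiagOn hk h 1 • ξ).2 hki hkn
      (he h)).trans ?_
    simp only [Nat.sub_self, pow_zero, Finset.prod_const_one, one_mul, Nat.sub_sub]
    rw [add_assoc]
    ring

end CornerTransition

section AngleLaw

variable {n i k : ℕ}

lemma exists_isAngleSpectrum (hk : k ≤ n) (V : Submodule ℝ (EuclideanSpace ℝ (Fin n))) :
    ∃ x : Fin k → ℝ, IsAngleSpectrum (coordSubspace n k) V x :=
  ⟨_, isAngleSpectrum_eigs ((stdOrthonormalBasis ℝ (coordSubspace n k)).reindex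
    (finCongr (finrank_coordSubspace hk))) V⟩

lemma continuous_projMatrix : Continuous fun ξ : Gr n i => projMatrix ξ.1 :=
  continuous_induced_dom

lemma siegelGamma_succ (m : ℕ) (a : ℝ) :
    siegelGamma (m + 1) a =
      siegelGamma m a * (Real.pi ^ ((m : ℝ) / 2) * Real.Gamma (a - (m : ℝ) / 2)) := by
  have h : ((m + 1 : ℕ) : ℝ) * (((m + 1 : ℕ) : ℝ) - 1) / 4 =
      (m : ℝ) * ((m : ℝ) - 1) / 4 + (m : ℝ) / 2 := by push_cast; ring
  rw [siegelGamma, siegelGamma, Finset.prod_range_succ, h, Real.rpow_add Real.pi_pos]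
  ring

lemma siegelGamma_pos {m : ℕ} {a : ℝ} (h : (m : ℝ) < 2 * a + 1) : 0 < siegelGamma m a := by
  refine mul_pos (Real.rpow_pos_of_pos Real.pi_pos _) (Finset.prod_pos fun j hj => ?_)
  have : (j : ℝ) + 1 ≤ m := by exact_mod_cast Finset.mem_range.1 hj
  exact Real.Gamma_pos_of_pos (by linarith)

lemma cOrd_succ (m : ℕ) : cOrd (m + 1) = cOrd m *
    (Real.pi ^ ((m : ℝ) / 2) * Real.Gamma (1 / 2) / Real.Gamma (((m : ℝ) + 1) / 2)) := by
  have h : (((m + 1 : ℕ) : ℝ) ^ 2 + ((m + 1 : ℕ) : ℝ)) / 4 =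
      ((m : ℝ) ^ 2 + m) / 4 + ((m : ℝ) / 2 + 1 / 2) := by push_cast; ring
  rw [cOrd, cOrd, Finset.prod_Icc_succ_top (by omega), h, Real.rpow_add Real.pi_pos,
    Real.rpow_add Real.pi_pos, Real.Gamma_one_half_eq, Real.sqrt_eq_rpow]
  push_cast
  rw [mul_div_mul_comm]

lemma cOrd_pos (m : ℕ) : 0 < cOrd m :=
  div_pos (Real.rpow_pos_of_pos Real.pi_pos _) <| Finset.prod_pos fun _ hj =>
    Real.Gamma_pos_of_pos <| half_pos <| Nat.cast_pos.2 (Finset.mem_Icc.1 hj).1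

/-- The normalizing constant of the law of the canonical angles between a random subspace of
dimension `i` and `ℝ^k`. -/
def angleLawConst (n i k : ℕ) : ℝ :=
  cOrd k * (siegelGamma k (n / 2) / (siegelGamma k (i / 2) * siegelGamma k (((n : ℝ) - i) / 2)))

lemma angleLawConst_zero (n i : ℕ) : angleLawConst n i 0 = 1 := by
  simp [angleLawConst, cOrd, siegelGamma]

lemma angleLawConst_pos (hki : k ≤ i) (hkn : k + i ≤ n) : 0 < angleLawConst n i k := by
  have h1 : (k : ℝ) ≤ i := by exact_mod_cast hki
  have h2 : (k : ℝ) + i ≤ n := by exact_mod_cast hkn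
  exact mul_pos (cOrd_pos k) (div_pos (siegelGamma_pos (by linarith)) (mul_pos
    (siegelGamma_pos (by linarith)) (siegelGamma_pos (by linarith))))

lemma angleLawConst_succ (n i k : ℕ) :
    angleLawConst n i (k + 1) = angleLawConst n i k * (transitionConst n i k *
      (Real.Gamma (1 / 2) ^ (k + 1) / Real.Gamma (((k : ℝ) + 1) / 2))) := by
  have hpi : Real.pi ^ ((k : ℝ) / 2) ≠ 0 := (Real.rpow_pos_of_pos Real.pi_pos _).ne'
  have hhalf : Real.Gamma (1 / 2) ^ k ≠ 0 := pow_ne_zero _ (Real.Gamma_pos_of_pos (by norm_num)).ne'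
  rw [angleLawConst, angleLawConst, transitionConst, siegelGamma_succ, siegelGamma_succ,
    siegelGamma_succ, cOrd_succ, ← sub_div, ← sub_div, ← sub_div, pow_succ]
  field_simp

lemma transitionConst_nonneg (hki : k ≤ i) (hkn : k + i ≤ n) : 0 ≤ transitionConst n i k := by
  have h1 : (k : ℝ) ≤ i := by exact_mod_cast hki
  have h2 : (k : ℝ) + i ≤ n := by exact_mod_cast hkn
  have hΓ {a : ℝ} (ha : 0 ≤ a) : 0 ≤ Real.Gamma (a / 2) := Real.Gamma_nonneg_of_nonneg (by linarith)
  exact div_nonneg (hΓ (by linarith)) (mul_nonneg (hΓ (by linarith))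
    (mul_nonneg (pow_nonneg (hΓ zero_le_one) _) (hΓ (by linarith))))

lemma continuous_withEndpoints (k : ℕ) : Continuous (withEndpoints (k := k)) :=
  continuous_const.finCons ((continuous_id (X := Fin k → ℝ)).finSnoc continuous_const)

lemma measurable_lintegral_interlacing_withEndpoints {φ : (Fin (k + 1) → ℝ) → ENNReal}
    (hφ : Measurable φ) (s : Fin (k + 2) → ℝ) :
    Measurable fun x : Fin k → ℝ => ∫⁻ b in interlacing (withEndpoints x),
      φ b * ENNReal.ofReal (interlacingWeight (withEndpoints x) s b) := by
  have hc : Continuous fun z : (Fin k → ℝ) × (Fin (k + 1) → ℝ) => (withEndpoints z.1, z.2) :=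
    ((continuous_withEndpoints k).comp continuous_fst).prodMk continuous_snd
  have hF : Measurable fun z : (Fin k → ℝ) × (Fin (k + 1) → ℝ) =>
      φ z.2 * ENNReal.ofReal (interlacingWeight (withEndpoints z.1) s z.2) :=
    (hφ.comp measurable_snd).mul
      ((measurable_interlacingWeight s).comp hc.measurable).ennreal_ofReal
  simp_rw [← lintegral_indicator (isOpen_interlacing _).measurableSet]
  exact (hF.indicator ((isOpen_setOf_mem_interlacing ℝ (k + 1)).preimage
    hc).measurableSet).lintegral_prod_right'

lemma ae_nu_mem_openSimplex (k : ℕ) (α β : ℝ) : ∀ᵐ x ∂nu k α β, x ∈ openSimplex k := by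
  refine (withDensity_absolutelyContinuous _ _).ae_le ?_
  rw [← Measure.restrict_congr_set (openSimplex_ae_eq_simplex k)]
  exact ae_restrict_mem (isOpen_openSimplex k).measurableSet

lemma nu_zero_eq_dirac (α β : ℝ) : nu 0 α β = Measure.dirac 0 := by
  refine Measure.ext_of_lintegral _ fun φ hφ => ?_
  have ho : openSimplex 0 = Set.univ :=
    Set.eq_univ_of_forall fun x => ⟨fun a => a.elim0, fun a => a.elim0⟩
  rw [lintegral_nu _ _ hφ, ho, Measure.restrict_univ,
    Measure.volume_pi_eq_dirac (0 : Fin 0 → ℝ), lintegral_dirac, lintegral_dirac]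
  simp [jacobiWeight, vandermondeProd]

lemma lintegral_eq_lintegral_lintegral_mul {G H : Type*} [Group G] [MeasurableSpace G]
    [MeasurableMul₂ G] [MeasurableSpace H] (μ : Measure G) [SFinite μ] [μ.IsMulLeftInvariant]
    (ν : Measure H) [IsProbabilityMeasure ν] {ι : H → G} (hι : Measurable ι)
    {F : G → ENNReal} (hF : Measurable F) :
    ∫⁻ g, F g ∂μ = ∫⁻ g, ∫⁻ h, F (ι h * g) ∂ν ∂μ := by
  have hmeas : Measurable fun z : H × G => F (ι z.1 * z.2) :=
    hF.comp ((hι.comp measurable_fst).mul measurable_snd)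
  rw [← lintegral_lintegral_swap hmeas.aemeasurable]
  simp [lintegral_mul_left_eq_self (μ := μ) F]

lemma lintegral_nu_interlacing_withEndpoints (hki : k ≤ i) (hkn : k + i ≤ n)
    {φ : (Fin (k + 1) → ℝ) → ENNReal} (hφ : Measurable φ) :
    ∫⁻ x, (∫⁻ b in interlacing (withEndpoints x), φ b * ENNReal.ofReal (interlacingWeight
        (withEndpoints x) (fun j => (endpointMultiplicity (n - i - k) (i - k) j : ℝ) / 2) b))
        ∂nu k (((i : ℝ) - k - 1) / 2) (((n : ℝ) - i - k - 1) / 2) =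
      ENNReal.ofReal (Real.Gamma (1 / 2) ^ (k + 1) / Real.Gamma (((k : ℝ) + 1) / 2)) *
        ∫⁻ b, φ b ∂nu (k + 1) (((i : ℝ) - (k + 1 : ℕ) - 1) / 2)
          (((n : ℝ) - i - (k + 1 : ℕ) - 1) / 2) := by
  have hp : ((n - i - k : ℕ) : ℝ) = n - i - k := by
    rw [Nat.cast_sub (by omega), Nat.cast_sub (by omega)]
  have hq : ((i - k : ℕ) : ℝ) = i - k := Nat.cast_sub hki
  rw [lintegral_nu _ _ (measurable_lintegral_interlacing_withEndpoints hφ _), lintegral_nu _ _ hφ]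
  convert lintegral_jacobiWeight_transition (p := ((n : ℝ) - i - k) / 2)
    (q := ((i : ℝ) - k) / 2) ?_ ?_ ?_ hφ using 5
  · congr 2 <;> ring
  · push_cast
    congr 2 <;> ring
  · rw [← hp]
    rfl
  · simp [endpointMultiplicity]
  · simp [endpointMultiplicity, hq]

theorem map_angles_haarOn (hin : i ≤ n) (hki : k ≤ i) (hkn : k + i ≤ n) {d : On n → Fin k → ℝ}
    (hd : ∀ γ, IsAngleSpectrum (coordSubspace n k) (γ • basePoint hin).1 (d γ)) :
    (haarOn n).map d = ENNReal.ofReal (angleLawConst n i k) •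
      nu k (((i : ℝ) - k - 1) / 2) (((n : ℝ) - i - k - 1) / 2) := by
  induction k with
  | zero =>
    have hd0 : d = fun _ => 0 := Subsingleton.elim _ _
    simp [hd0, nu_zero_eq_dirac, angleLawConst_zero, Measure.map_const]
  | succ k ih =>
    have hk : k ≤ n := by omega
    have hP : Continuous fun γ : On n => projMatrix (γ • basePoint hin).1 :=
      continuous_projMatrix.comp (continuous_orbit _)
    choose d' hd' using fun γ : On n => exists_isAngleSpectrum hk (γ • basePoint hin).1
    have hdm := (continuous_of_isAngleSpectrum hP hd).measurable
    have hdm' := (continuous_of_isAngleSpectrum hP hd').measurable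
    have law := ih (by omega) (by omega) hd'
    have hopen : ∀ᵐ γ ∂haarOn n, d' γ ∈ openSimplex k := by
      refine ae_of_ae_map hdm'.aemeasurable ?_
      rw [law]
      exact Measure.ae_smul_measure (ae_nu_mem_openSimplex k _ _) _
    refine Measure.ext_of_lintegral _ fun φ hφ => ?_
    let s : Fin (k + 2) → ℝ := fun j => (endpointMultiplicity (n - i - k) (i - k) j : ℝ) / 2
    let Φ : (Fin k → ℝ) → ENNReal := fun x => ∫⁻ b in interlacing (withEndpoints x),
      φ b * ENNReal.ofReal (interlacingWeight (withEndpoints x) s b)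
    have hΦ : Measurable Φ := measurable_lintegral_interlacing_withEndpoints hφ s
    have hι : Measurable fun h : On (n - k) => blockDiagOn hk h 1 :=
      ((continuous_blockDiagOn hk).comp (Continuous.prodMk_left 1)).measurable
    calc ∫⁻ x, φ x ∂(haarOn n).map d = ∫⁻ γ, φ (d γ) ∂haarOn n := lintegral_map hφ hdm
      _ = ∫⁻ γ, ∫⁻ h, φ (d (blockDiagOn hk h 1 * γ)) ∂haarOn (n - k) ∂haarOn n :=
        lintegral_eq_lintegral_lintegral_mul _ _ hι (hφ.comp hdm)
      _ = ∫⁻ γ, ENNReal.ofReal (transitionConst n i k) * Φ (d' γ) ∂haarOn n := by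
        refine lintegral_congr_ae ?_
        filter_upwards [hopen] with γ hγ
        exact lintegral_angles_blockDiagOn_smul hk hki hkn (γ • basePoint hin) (hd' γ) hγ
          (fun h => mul_smul (blockDiagOn hk h 1) γ (basePoint hin) ▸ hd _) hφ
      _ = ENNReal.ofReal (transitionConst n i k) * (ENNReal.ofReal (angleLawConst n i k) *
            ∫⁻ x, Φ x ∂nu k (((i : ℝ) - k - 1) / 2) (((n : ℝ) - i - k - 1) / 2)) := by
        rw [lintegral_const_mul' _ _ ENNReal.ofReal_ne_top, ← lintegral_map hΦ hdm', law,
          lintegral_smul_measure, smul_eq_mul]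
      _ = ∫⁻ x, φ x ∂(ENNReal.ofReal (angleLawConst n i (k + 1)) • nu (k + 1) _ _) := by
        rw [lintegral_nu_interlacing_withEndpoints (by omega) (by omega) hφ,
          lintegral_smul_measure, angleLawConst_succ,
          ENNReal.ofReal_mul (angleLawConst_pos (by omega) (by omega)).le,
          ENNReal.ofReal_mul (transitionConst_nonneg (by omega) (by omega)), smul_eq_mul]
        ring

end AngleLaw

section OrthogonalEquivalence

lemma exists_linearIsometry_apply_eq_of_norm_eq {𝕜 E F : Type*} [RCLike 𝕜] [AddCommGroup E]
    [Module 𝕜 E] [NormedAddCommGroup F] [InnerProductSpace 𝕜 F] [FiniteDimensional 𝕜 F]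
    {L L' : E →ₗ[𝕜] F} (h : ∀ v, ‖L' v‖ = ‖L v‖) : ∃ T : F →ₗᵢ[𝕜] F, ∀ v, T (L v) = L' v := by
  have hker : L.ker ≤ L'.ker := fun v hv => by
    rw [LinearMap.mem_ker] at hv ⊢
    rw [← norm_eq_zero, h, hv, norm_zero]
  let S : L.range →ₗ[𝕜] F := L.ker.liftQ L' hker ∘ₗ L.quotKerEquivRange.symm.toLinearMap
  have hS (v : E) : S ⟨L v, L.mem_range_self v⟩ = L' v := by
    simp only [S, LinearMap.comp_apply, LinearEquiv.coe_coe,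
      L.quotKerEquivRange_symm_apply_image v (L.mem_range_self v), Submodule.mkQ_apply,
      Submodule.liftQ_apply]
  let T : L.range →ₗᵢ[𝕜] F := ⟨S, by
    rintro ⟨_, v, rfl⟩
    exact (congrArg norm (hS v)).trans (h v)⟩
  exact ⟨T.extend, fun v => (T.extend_apply ⟨L v, L.mem_range_self v⟩).trans (hS v)⟩

lemma inner_toEuclideanLin_toEuclideanLin {m n p : Type*} [Fintype m] [Fintype n] [Fintype p]
    [DecidableEq m] [DecidableEq n] (Y : Matrix p m ℝ) (Z : Matrix p n ℝ)
    (v : EuclideanSpace ℝ m) (w : EuclideanSpace ℝ n) :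
    inner ℝ (Matrix.toEuclideanLin Y v) (Matrix.toEuclideanLin Z w) =
      v.ofLp ⬝ᵥ (Yᵀ * Z) *ᵥ w.ofLp := by
  rw [EuclideanSpace.inner_eq_star_dotProduct, star_trivial, Matrix.toLpLin_apply,
    Matrix.toLpLin_apply, ← Matrix.mulVec_mulVec, Matrix.dotProduct_mulVec,
    ← Matrix.mulVec_transpose, dotProduct_comm]

variable {p k : ℕ}

lemma exists_orthogonal_toEuclideanLin_eq
    (T : EuclideanSpace ℝ (Fin p) →ₗᵢ[ℝ] EuclideanSpace ℝ (Fin p)) :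
    ∃ b : On p, Matrix.toEuclideanLin (b : Matrix (Fin p) (Fin p) ℝ) = T.toLinearMap := by
  set B : Matrix (Fin p) (Fin p) ℝ := Matrix.toEuclideanLin.symm T.toLinearMap
  have hB : Matrix.toEuclideanLin B = T.toLinearMap := Matrix.toEuclideanLin.apply_symm_apply _
  refine ⟨⟨B, (Matrix.mem_orthogonalGroup_iff' (Fin p) ℝ).2 ?_⟩, hB⟩
  ext c d
  have h := inner_toEuclideanLin_toEuclideanLin B B (EuclideanSpace.single c 1)
    (EuclideanSpace.single d 1)
  rw [hB, LinearIsometry.coe_toLinearMap, T.inner_map_map] at h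
  simpa [Matrix.one_apply, Pi.single_apply, EuclideanSpace.inner_single_left] using h.symm

lemma exists_orthogonal_mul_eq_of_gram_eq {Y Z : Matrix (Fin p) (Fin k) ℝ}
    (h : Yᵀ * Y = Zᵀ * Z) : ∃ b : On p, Z = (b : Matrix (Fin p) (Fin p) ℝ) * Y := by
  have hnorm (v : EuclideanSpace ℝ (Fin k)) :
      ‖Matrix.toEuclideanLin Z v‖ = ‖Matrix.toEuclideanLin Y v‖ := by
    rw [← sq_eq_sq₀ (norm_nonneg _) (norm_nonneg _), ← real_inner_self_eq_norm_sq,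
      ← real_inner_self_eq_norm_sq, inner_toEuclideanLin_toEuclideanLin,
      inner_toEuclideanLin_toEuclideanLin, h]
  obtain ⟨T, hT⟩ := exists_linearIsometry_apply_eq_of_norm_eq hnorm
  obtain ⟨b, hb⟩ := exists_orthogonal_toEuclideanLin_eq T
  refine ⟨b, Matrix.toEuclideanLin.injective (LinearMap.ext fun v => ?_)⟩
  rw [← hT, ← LinearIsometry.coe_toLinearMap, ← hb]
  simp [Matrix.toLpLin_apply, Matrix.mulVec_mulVec]

lemma exists_orthogonal_conj_of_charpoly_eq {A B : Matrix (Fin p) (Fin p) ℝ} (hA : A.IsHermitian)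
    (hB : B.IsHermitian) (h : A.charpoly = B.charpoly) :
    ∃ U : On p, A = (U : Matrix (Fin p) (Fin p) ℝ)ᵀ * B * (U : Matrix (Fin p) (Fin p) ℝ) := by
  obtain ⟨W, hW⟩ := exists_orthogonal_mul_diagonal_eigenvalues_mul hA
  obtain ⟨W', hW'⟩ := exists_orthogonal_mul_diagonal_eigenvalues_mul hB
  rw [← (hA.eigenvalues_eq_eigenvalues_iff hB).2 h] at hW'
  set D := Matrix.diagonal hA.eigenvalues
  refine ⟨W' * W⁻¹, ?_⟩
  have hU : ((W' * W⁻¹ : On p) : Matrix (Fin p) (Fin p) ℝ) =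
      (W' : Matrix (Fin p) (Fin p) ℝ) * (W : Matrix (Fin p) (Fin p) ℝ)ᵀ := rfl
  rw [hU, Matrix.transpose_mul, Matrix.transpose_transpose]
  calc A = (W : Matrix (Fin p) (Fin p) ℝ) * ((W'.1ᵀ * W'.1) * D * (W'.1ᵀ * W'.1)) * W.1ᵀ := by
        rw [transpose_mul_coe W', one_mul, mul_one, hW]
    _ = W.1 * W'.1ᵀ * (W'.1 * D * W'.1ᵀ) * (W'.1 * W.1ᵀ) := by simp only [Matrix.mul_assoc]
    _ = W.1 * W'.1ᵀ * B * (W'.1 * W.1ᵀ) := by rw [← hW']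

end OrthogonalEquivalence

section Orbits

open Polynomial

variable {n i ℓ : ℕ}

lemma projMatrix_injective :
    Function.Injective (projMatrix : Submodule ℝ (EuclideanSpace ℝ (Fin n)) → _) := by
  intro U V h
  refine Submodule.starProjection_inj.1 (ContinuousLinearMap.coe_injective
    ((EuclideanSpace.basisFun (Fin n) ℝ).toBasis.ext fun b => ?_))
  ext a
  simpa [projMatrix] using congrFun₂ h a b

lemma transpose_mul_projMatrix_coordSubspace_mul (h : ℓ ≤ n) (W : Matrix (Fin n) (Fin i) ℝ) :
    Wᵀ * projMatrix (coordSubspace n ℓ) * W =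
      (W.submatrix (splitEquiv h) id).toRows₂ᵀ * (W.submatrix (splitEquiv h) id).toRows₂ := by
  set e := splitEquiv h
  calc Wᵀ * projMatrix (coordSubspace n ℓ) * W =
        (W.submatrix e id)ᵀ * (projMatrix (coordSubspace n ℓ)).submatrix e e *
          W.submatrix e id := by
        rw [Matrix.transpose_submatrix, Matrix.submatrix_mul_equiv, Matrix.submatrix_mul_equiv,
          Matrix.submatrix_id_id]
    _ = _ := by
        rw [projMatrix_coordSubspace_submatrix, Matrix.mul_assoc,
          ← Matrix.fromRows_toRows (W.submatrix e id), Matrix.fromBlocks_mul_fromRows,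
          Matrix.transpose_fromRows, Matrix.fromCols_mul_fromRows]
        simp

lemma transpose_mul_self_eq_add (h : ℓ ≤ n) (W : Matrix (Fin n) (Fin i) ℝ) :
    Wᵀ * W =
      (W.submatrix (splitEquiv h) id).toRows₁ᵀ * (W.submatrix (splitEquiv h) id).toRows₁ +
        (W.submatrix (splitEquiv h) id).toRows₂ᵀ * (W.submatrix (splitEquiv h) id).toRows₂ := by
  set e := splitEquiv h
  rw [← Matrix.fromCols_mul_fromRows, ← Matrix.transpose_fromRows, Matrix.fromRows_toRows,
    Matrix.transpose_submatrix, Matrix.submatrix_mul_equiv, Matrix.submatrix_id_id]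

lemma exists_blockDiagOn_mul_eq (h : ℓ ≤ n) {Θ Θ' : Matrix (Fin n) (Fin i) ℝ}
    (hgram : Θᵀ * Θ = Θ'ᵀ * Θ')
    (hcompress : Θᵀ * projMatrix (coordSubspace n ℓ) * Θ =
      Θ'ᵀ * projMatrix (coordSubspace n ℓ) * Θ') :
    ∃ a b, Θ' = (blockDiagOn h a b : Matrix (Fin n) (Fin n) ℝ) * Θ := by
  rw [transpose_mul_projMatrix_coordSubspace_mul h,
    transpose_mul_projMatrix_coordSubspace_mul h] at hcompress
  rw [transpose_mul_self_eq_add h Θ, transpose_mul_self_eq_add h Θ', hcompress] at hgram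
  obtain ⟨a, ha⟩ := exists_orthogonal_mul_eq_of_gram_eq (add_right_cancel hgram)
  obtain ⟨b, hb⟩ := exists_orthogonal_mul_eq_of_gram_eq hcompress
  refine ⟨a, b, ?_⟩
  set e := splitEquiv h
  have hrows : Θ'.submatrix e id =
      ((blockDiagOn h a b : Matrix (Fin n) (Fin n) ℝ) * Θ).submatrix e id := by
    rw [← Matrix.submatrix_mul_equiv _ _ _ e, blockDiagOn_submatrix,
      ← Matrix.fromRows_toRows (Θ'.submatrix e id), ha, hb]
    conv_rhs => rw [← Matrix.fromRows_toRows (Θ.submatrix e id), Matrix.fromBlocks_mul_fromRows]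
    simp only [Matrix.zero_mul, add_zero, zero_add]
  simpa using congrArg (fun W => Matrix.submatrix W e.symm id) hrows

lemma exists_memK_smul_eq (h : ℓ ≤ n) {ξ ξ' : Gr n i}
    (hχ : (projMatrix (coordSubspace n ℓ) * projMatrix ξ.1).charpoly =
      (projMatrix (coordSubspace n ℓ) * projMatrix ξ'.1).charpoly) :
    ∃ γ : On n, MemK h γ ∧ γ • ξ = ξ' := by
  let b := (stdOrthonormalBasis ℝ ξ.1).reindex (finCongr ξ.2)
  let b' := (stdOrthonormalBasis ℝ ξ'.1).reindex (finCongr ξ'.2)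
  have hcharpoly : (compress b (coordSubspace n ℓ)).charpoly =
      (compress b' (coordSubspace n ℓ)).charpoly := by
    refine mul_left_cancel₀ (pow_ne_zero n X_ne_zero) ?_
    rw [← X_pow_mul_charpoly_projMatrix_mul, ← X_pow_mul_charpoly_projMatrix_mul,
      Matrix.charpoly_mul_comm, hχ, Matrix.charpoly_mul_comm]
  obtain ⟨U, hU⟩ := exists_orthogonal_conj_of_charpoly_eq (compress_isHermitian b _)
    (compress_isHermitian b' _) hcharpoly
  set Θ := frameMatrix b
  set Θ' := frameMatrix b' * (U : Matrix (Fin i) (Fin i) ℝ)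
  have hgram : Θᵀ * Θ = Θ'ᵀ * Θ' := by
    rw [frameMatrix_transpose_mul, Matrix.transpose_mul, Matrix.mul_assoc,
      ← Matrix.mul_assoc _ (frameMatrix b'), frameMatrix_transpose_mul, Matrix.one_mul,
      transpose_mul_coe]
  have hcompress : Θᵀ * projMatrix (coordSubspace n ℓ) * Θ =
      Θ'ᵀ * projMatrix (coordSubspace n ℓ) * Θ' := by
    rw [Matrix.transpose_mul]
    simpa only [compress, Matrix.mul_assoc] using hU
  obtain ⟨a, c, hγ⟩ := exists_blockDiagOn_mul_eq h hgram hcompress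
  refine ⟨blockDiagOn h a c, memK_iff_exists_blockDiagOn.2 ⟨a, c, rfl⟩,
    Subtype.ext (projMatrix_injective ?_)⟩
  calc projMatrix (blockDiagOn h a c • ξ).1 = Θ' * Θ'ᵀ := by
        rw [projMatrix_smul, ← frameMatrix_mul_transpose b, hγ, Matrix.transpose_mul]
        simp only [Matrix.mul_assoc, Θ]
    _ = projMatrix ξ'.1 := by
        rw [Matrix.transpose_mul, Matrix.mul_assoc, ← Matrix.mul_assoc U.1, coe_mul_transpose,
          Matrix.one_mul, frameMatrix_mul_transpose]

end Orbits

section Invariance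

open Polynomial

variable {n i k ℓ : ℕ}

lemma isAngleSpectrum_lam (ξ : Gr n i) (Θ : OrthonormalBasis (Fin i) ℝ ξ.1)
    (Ψ : OrthonormalBasis (Fin ℓ) ℝ (coordSubspace n ℓ)) :
    IsAngleSpectrum (coordSubspace n ℓ) ξ.1 (lam ξ Θ Ψ) := by
  by_cases h : i ≤ ℓ
  · have hlam : lam ξ Θ Ψ = eigs (compress_isHermitian Θ (coordSubspace n ℓ)) ∘
        Fin.cast (min_eq_left h) := funext fun j => dif_pos h
    exact hlam ▸ (isAngleSpectrum_eigs Θ _).symm.comp_cast _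
  · have hlam : lam ξ Θ Ψ = eigs (compress_isHermitian Ψ ξ.1) ∘
        Fin.cast (min_eq_right (le_of_not_ge h)) := funext fun j => dif_neg h
    exact hlam ▸ (isAngleSpectrum_eigs Ψ _).comp_cast _

lemma IsAngleSpectrum.unique {U V : Submodule ℝ (EuclideanSpace ℝ (Fin n))} {x y : Fin k → ℝ}
    (hx : IsAngleSpectrum U V x) (hy : IsAngleSpectrum U V y) : x = y :=
  eq_of_prod_X_sub_C_eq hx.1.1 hy.1.1
    (mul_left_cancel₀ (pow_ne_zero n X_ne_zero) (hx.2.symm.trans hy.2))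

lemma IsAngleSpectrum.charpoly_eq {U V U' V' : Submodule ℝ (EuclideanSpace ℝ (Fin n))}
    {x : Fin k → ℝ} (h : IsAngleSpectrum U V x) (h' : IsAngleSpectrum U' V' x) :
    (projMatrix U * projMatrix V).charpoly = (projMatrix U' * projMatrix V').charpoly :=
  mul_left_cancel₀ (pow_ne_zero k X_ne_zero) (h.2.trans h'.2.symm)

lemma charpoly_projMatrix_smul_mul_projMatrix_smul (γ : On n) (η : Gr n k) (ξ : Gr n i) :
    (projMatrix (γ • η).1 * projMatrix (γ • ξ).1).charpoly =
      (projMatrix η.1 * projMatrix ξ.1).charpoly := by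
  have hconj : projMatrix (γ • η).1 * projMatrix (γ • ξ).1 =
      γ.1 * (projMatrix η.1 * (γ.1ᵀ * γ.1) * projMatrix ξ.1 * γ.1ᵀ) := by
    simp only [projMatrix_smul, Matrix.mul_assoc]
  rw [hconj, Matrix.charpoly_mul_comm, Matrix.mul_assoc, transpose_mul_coe, Matrix.mul_one,
    Matrix.mul_one]

lemma IsAngleSpectrum.smul {η : Gr n ℓ} {ξ : Gr n i} {x : Fin k → ℝ}
    (h : IsAngleSpectrum η.1 ξ.1 x) (γ : On n) : IsAngleSpectrum (γ • η).1 (γ • ξ).1 x :=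
  ⟨h.1, by rw [charpoly_projMatrix_smul_mul_projMatrix_smul, h.2]⟩

lemma MemK.smul_basePoint {h : ℓ ≤ n} {γ : On n} (hγ : MemK h γ) :
    γ • basePoint h = basePoint h := by
  obtain ⟨a, b, rfl⟩ := memK_iff_exists_blockDiagOn.1 hγ
  refine Subtype.ext (projMatrix_injective ?_)
  set e := splitEquiv h
  have hblocks : (projMatrix (blockDiagOn h a b • basePoint h).1).submatrix e e =
      (projMatrix (coordSubspace n ℓ)).submatrix e e := by
    rw [projMatrix_smul, ← Matrix.submatrix_mul_equiv _ _ e e e,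
      ← Matrix.submatrix_mul_equiv _ _ e e e, ← Matrix.transpose_submatrix, blockDiagOn_submatrix,
      basePoint, projMatrix_coordSubspace_submatrix, Matrix.fromBlocks_transpose,
      Matrix.fromBlocks_multiply, Matrix.fromBlocks_multiply]
    simp [coe_mul_transpose]
  exact (Matrix.reindex e.symm e.symm).injective hblocks

variable {L : Gr n i → Fin k → ℝ}

lemma angles_smul_of_memK (hL : ∀ ξ, IsAngleSpectrum (coordSubspace n ℓ) ξ.1 (L ξ)) {h : ℓ ≤ n}
    {γ : On n} (hγ : MemK h γ) (ξ : Gr n i) : L (γ • ξ) = L ξ := by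
  have hξ : IsAngleSpectrum (γ • basePoint h).1 (γ • ξ).1 (L ξ) :=
    IsAngleSpectrum.smul (η := basePoint h) (hL ξ) γ
  rw [hγ.smul_basePoint] at hξ
  exact (hL _).unique hξ

lemma exists_memK_smul_eq_of_angles_eq
    (hL : ∀ ξ, IsAngleSpectrum (coordSubspace n ℓ) ξ.1 (L ξ)) (h : ℓ ≤ n) {ξ ξ' : Gr n i}
    (hξ : L ξ = L ξ') : ∃ γ, MemK h γ ∧ γ • ξ = ξ' :=
  exists_memK_smul_eq h ((hL ξ).charpoly_eq (hξ ▸ hL ξ'))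

end Invariance

section AngleLawOnGrassmannian

variable {n i ℓ : ℕ}

lemma map_grMeasure {E : Type*} [MeasurableSpace E] (hin : i ≤ n) {L : Gr n i → E}
    (hL : Measurable L) : (grMeasure hin).map L = (haarOn n).map fun γ => L (γ • basePoint hin) :=
  Measure.map_map hL (continuous_orbit _).measurable

lemma cConst_eq_angleLawConst_of_le (h : i ≤ ℓ) : cConst n i ℓ = angleLawConst n ℓ i := by
  rw [angleLawConst, cConst, min_eq_left h, if_pos h]

lemma cConst_eq_angleLawConst_of_ge (h : ℓ ≤ i) : cConst n i ℓ = angleLawConst n i ℓ := by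
  rcases h.eq_or_lt with rfl | hlt
  · exact cConst_eq_angleLawConst_of_le le_rfl
  · rw [angleLawConst, cConst, min_eq_right h, if_neg hlt.not_ge]

lemma cConst_pos (hiℓ : i + ℓ ≤ n) : 0 < cConst n i ℓ := by
  rcases le_total i ℓ with h | h
  · exact cConst_eq_angleLawConst_of_le (n := n) h ▸ angleLawConst_pos h hiℓ
  · exact cConst_eq_angleLawConst_of_ge (n := n) h ▸ angleLawConst_pos h (by omega)

lemma continuous_angles {k : ℕ} {L : Gr n i → Fin k → ℝ}
    (hL : ∀ ξ, IsAngleSpectrum (coordSubspace n ℓ) ξ.1 (L ξ)) : Continuous L :=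
  continuous_of_isAngleSpectrum continuous_projMatrix hL

lemma map_angles_grMeasure_of_le (hin : i ≤ n) (hiℓ : i + ℓ ≤ n) (h : i ≤ ℓ)
    {L : Gr n i → Fin i → ℝ} (hL : ∀ ξ, IsAngleSpectrum (coordSubspace n ℓ) ξ.1 (L ξ)) :
    (grMeasure hin).map L = ENNReal.ofReal (angleLawConst n ℓ i) •
      nu i (((ℓ : ℝ) - i - 1) / 2) (((n : ℝ) - ℓ - i - 1) / 2) := by
  have hℓn : ℓ ≤ n := by omega
  have hLγ : Measurable fun γ : On n => L (γ • basePoint hin) :=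
    ((continuous_angles hL).comp (continuous_orbit _)).measurable
  -- The angles between `ℝ^ℓ` and `γ ℝ^i` are those between `ℝ^i` and `γ⁻¹ ℝ^ℓ`.
  have hswap (γ : On n) : IsAngleSpectrum (coordSubspace n i) (γ • basePoint hℓn).1
      (L (γ⁻¹ • basePoint hin)) := by
    have h := (IsAngleSpectrum.smul (η := basePoint hℓn) (hL (γ⁻¹ • basePoint hin)) γ).symm
    rwa [smul_inv_smul] at h
  rw [← map_angles_haarOn hℓn h hiℓ hswap, map_grMeasure hin (continuous_angles hL).measurable]
  conv_lhs => rw [← Measure.map_inv_eq_self (haarOn n)]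
  exact Measure.map_map hLγ measurable_inv

lemma map_angles_grMeasure {m : ℕ} (hm : m = min i ℓ) (hin : i ≤ n) (hiℓ : i + ℓ ≤ n)
    {L : Gr n i → Fin m → ℝ} (hL : ∀ ξ, IsAngleSpectrum (coordSubspace n ℓ) ξ.1 (L ξ)) :
    (grMeasure hin).map L = ENNReal.ofReal (cConst n i ℓ) •
      nu m ((|(ℓ : ℝ) - i| - 1) / 2) (((n : ℝ) - ℓ - i - 1) / 2) := by
  rcases le_total i ℓ with h | h
  · obtain rfl : m = i := hm.trans (min_eq_left h)
    rw [cConst_eq_angleLawConst_of_le h, abs_of_nonneg (sub_nonneg.2 (Nat.cast_le.2 h))]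
    exact map_angles_grMeasure_of_le hin hiℓ h hL
  · obtain rfl : m = ℓ := hm.trans (min_eq_right h)
    rw [cConst_eq_angleLawConst_of_ge h, abs_sub_comm,
      abs_of_nonneg (sub_nonneg.2 (Nat.cast_le.2 h)), sub_right_comm (n : ℝ),
      map_grMeasure hin (continuous_angles hL).measurable]
    exact map_angles_haarOn hin h (by omega) fun γ => hL _

end AngleLawOnGrassmannian

section ImageMeasures

variable {X Y : Type*} [TopologicalSpace X] [MeasurableSpace X]
  [TopologicalSpace Y] [T2Space Y] [MeasurableSpace Y] [BorelSpace Y] {μ : Measure X}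
  [IsFiniteMeasure μ] [μ.InnerRegularCompactLTTop] {h : X → Y}

lemma exists_measurableSet_subset_of_nullMeasurableSet_preimage (hh : Continuous h) {D : Set Y}
    (hD : NullMeasurableSet (h ⁻¹' D) μ) :
    ∃ B ⊆ D, MeasurableSet B ∧ μ (h ⁻¹' D) ≤ μ (h ⁻¹' B) := by
  obtain ⟨t, htD, ht, hte⟩ := hD.exists_measurable_subset_ae_eq
  have hK (N : ℕ) : ∃ K ⊆ t, IsCompact K ∧ μ t < μ K + (N : ENNReal)⁻¹ :=
    ht.exists_isCompact_lt_add (measure_ne_top μ t) (ENNReal.inv_ne_zero.2 (by simp))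
  choose K hKt hKc hKμ using hK
  refine ⟨⋃ N, h '' K N, Set.iUnion_subset fun N => Set.image_subset_iff.2 ((hKt N).trans htD),
    MeasurableSet.iUnion fun N => ((hKc N).image hh).isClosed.measurableSet, ?_⟩
  have hle (N : ℕ) : μ t ≤ μ (h ⁻¹' ⋃ N, h '' K N) + (N : ENNReal)⁻¹ :=
    (hKμ N).le.trans (add_le_add_left (measure_mono (Set.image_subset_iff.1
      (Set.subset_iUnion (fun N => h '' K N) N))) _)
  rw [← measure_congr hte]
  simpa using ge_of_tendsto' (tendsto_const_nhds.add ENNReal.tendsto_inv_nat_nhds_zero) hle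

variable [OpensMeasurableSpace X]

lemma nullMeasurableSet_map_of_preimage (hh : Continuous h) {E : Set Y}
    (hE : NullMeasurableSet (h ⁻¹' E) μ) : NullMeasurableSet E (μ.map h) := by
  obtain ⟨B, hBE, hB, hμB⟩ := exists_measurableSet_subset_of_nullMeasurableSet_preimage hh hE
  obtain ⟨B', hBE', hB', hμB'⟩ :=
    exists_measurableSet_subset_of_nullMeasurableSet_preimage hh (D := Eᶜ) hE.compl
  have hEB' : E ⊆ B'ᶜ := Set.subset_compl_comm.1 hBE'
  have hnull : μ.map h (B'ᶜ \ B) = 0 := by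
    rw [Measure.map_apply hh.measurable (hB'.compl.diff hB), Set.preimage_sdiff,
      measure_sdiff (Set.preimage_mono (hBE.trans hEB'))
        (hB.preimage hh.measurable).nullMeasurableSet (measure_ne_top _ _),
      Set.preimage_compl, measure_compl (hB'.preimage hh.measurable) (measure_ne_top _ _),
      tsub_tsub, tsub_eq_zero_iff_le, ← measure_add_measure_compl₀ hE, add_comm]
    exact add_le_add hμB' hμB
  refine ⟨B, hB, ae_eq_set.2 ⟨measure_mono_null (Set.sdiff_subset_sdiff_left hEB') hnull, ?_⟩⟩
  rw [Set.sdiff_eq_empty.2 hBE, measure_empty]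

lemma aestronglyMeasurable_map_of_comp {E : Type*} [TopologicalSpace E]
    [TopologicalSpace.PseudoMetrizableSpace E] [SecondCountableTopology E] [MeasurableSpace E]
    [BorelSpace E] (hh : Continuous h) {f : Y → E} (hf : AEStronglyMeasurable (f ∘ h) μ) :
    AEStronglyMeasurable f (μ.map h) := by
  have hnull : NullMeasurable f (μ.map h) := fun s hs =>
    nullMeasurableSet_map_of_preimage hh (hf.aemeasurable.nullMeasurable hs)
  exact hnull.aemeasurable.aestronglyMeasurable

lemma exists_integrable_map_of_factorsThrough {E : Type*} [NormedAddCommGroup E]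
    [SecondCountableTopology E] (hh : Continuous h) {f : X → E} (hf : Integrable f μ)
    (hfh : f.FactorsThrough h) :
    ∃ f₀ : Y → E, Integrable f₀ (μ.map h) ∧ ∀ x, f x = f₀ (h x) := by
  obtain ⟨f₀, rfl⟩ := (Function.factorsThrough_iff f).1 hfh
  borelize E
  have hf₀ := aestronglyMeasurable_map_of_comp hh hf.aestronglyMeasurable
  exact ⟨f₀, (integrable_map_measure hf₀ hh.measurable.aemeasurable).2 hf, fun _ => rfl⟩

end ImageMeasures

section Averaging

variable {E : Type*} [NormedAddCommGroup E] [NormedSpace ℝ E]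

lemma ae_eq_integral_of_ae_invariant {X G : Type*} [MeasurableSpace X] [MeasurableSpace G]
    [CompleteSpace E] {μ : Measure X} [SFinite μ] {κ : Measure G} [IsProbabilityMeasure κ]
    {act : G → X → X} (hact : Measurable act.uncurry)
    (hq : ∀ k, Measure.QuasiMeasurePreserving (act k) μ μ) {f g : X → E}
    (hg : StronglyMeasurable g) (hfg : f =ᵐ[μ] g) (hf : ∀ k, ∀ᵐ x ∂μ, f (act k x) = f x) :
    f =ᵐ[μ] fun x => ∫ k, g (act k x) ∂κ := by
  have hinv : ∀ᵐ k ∂κ, ∀ᵐ x ∂μ, g (act k x) = g x := by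
    refine .of_forall fun k => ?_
    filter_upwards [hf k, hfg, (hq k).ae hfg] with x h1 h2 h3
    rw [← h3, h1, h2]
  have hset : MeasurableSet {z : G × X | g (act z.1 z.2) = g z.2} :=
    (hg.comp_measurable hact).measurableSet_eq_fun (hg.comp_measurable measurable_snd)
  filter_upwards [(Measure.ae_ae_comm hset).1 hinv, hfg] with x h1 h2
  simp [integral_congr_ae h1, h2]

variable {n i ℓ : ℕ}

instance : ContinuousSMul (On n) (Gr n i) where
  continuous_smul := by
    have hγ : Continuous fun z : On n × Gr n i => z.1.1 :=
      continuous_subtype_val.comp continuous_fst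
    refine continuous_induced_rng.2 ?_
    simp only [Function.comp_def, projMatrix_smul]
    exact (hγ.matrix_mul (continuous_projMatrix.comp continuous_snd)).matrix_mul
      hγ.matrix_transpose

instance : SecondCountableTopology (Gr n i) :=
  have : SecondCountableTopology (Matrix (Fin n) (Fin n) ℝ) :=
    inferInstanceAs (SecondCountableTopology (Fin n → Fin n → ℝ))
  Topology.IsInducing.secondCountableTopology (f := fun ξ : Gr n i => projMatrix ξ.1) ⟨rfl⟩

lemma measurePreserving_smul_grMeasure (hin : i ≤ n) (γ : On n) :
    MeasurePreserving (γ • ·) (grMeasure hin) (grMeasure hin) :=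
  ⟨(continuous_smul_left γ).measurable, grMeasure_map_smul hin γ⟩

lemma integral_blockDiagOn_smul_smul (hℓn : ℓ ≤ n) (g : Gr n i → E) (a : On (n - ℓ)) (b : On ℓ)
    (ξ : Gr n i) :
    ∫ k : On (n - ℓ) × On ℓ, g (blockDiagOn hℓn k.1 k.2 • blockDiagOn hℓn a b • ξ)
        ∂(haarOn (n - ℓ)).prod (haarOn ℓ) =
      ∫ k : On (n - ℓ) × On ℓ, g (blockDiagOn hℓn k.1 k.2 • ξ)
        ∂(haarOn (n - ℓ)).prod (haarOn ℓ) := by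
  simp_rw [← mul_smul, ← blockDiagOn_mul]
  exact integral_mul_right_eq_self (μ := (haarOn (n - ℓ)).prod (haarOn ℓ))
    (fun k => g (blockDiagOn hℓn k.1 k.2 • ξ)) (a, b)

lemma exists_memK_invariant_ae_eq [CompleteSpace E] (hin : i ≤ n) (hℓn : ℓ ≤ n) {f : Gr n i → E}
    (hf : AEStronglyMeasurable f (grMeasure hin))
    (hinv : ∀ γ, MemK hℓn γ → ∀ᵐ ξ ∂grMeasure hin, f (γ • ξ) = f ξ) :
    ∃ F : Gr n i → E, (∀ γ, MemK hℓn γ → ∀ ξ, F (γ • ξ) = F ξ) ∧ f =ᵐ[grMeasure hin] F := by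
  have := isProbabilityMeasure_grMeasure hin
  obtain ⟨g, hg, hfg⟩ := hf
  have hact : Continuous fun z : (On (n - ℓ) × On ℓ) × Gr n i =>
      blockDiagOn hℓn z.1.1 z.1.2 • z.2 :=
    ((continuous_blockDiagOn hℓn).comp continuous_fst).smul continuous_snd
  refine ⟨fun ξ => ∫ k, g (blockDiagOn hℓn k.1 k.2 • ξ) ∂(haarOn (n - ℓ)).prod (haarOn ℓ),
    fun γ hγ ξ => ?_, ?_⟩
  · obtain ⟨a, b, rfl⟩ := memK_iff_exists_blockDiagOn.1 hγ
    exact integral_blockDiagOn_smul_smul hℓn g a b ξ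
  · exact ae_eq_integral_of_ae_invariant
      (act := fun (k : On (n - ℓ) × On ℓ) ξ => blockDiagOn hℓn k.1 k.2 • ξ) hact.measurable
      (fun k => (measurePreserving_smul_grMeasure hin _).quasiMeasurePreserving) hg hfg
      fun k => hinv _ (memK_iff_exists_blockDiagOn.2 ⟨k.1, k.2, rfl⟩)

end Averaging

section InvariantFunctions

variable {E : Type*} [NormedAddCommGroup E] {n i ℓ m : ℕ}

instance (n : ℕ) : (haarOn n).InnerRegularCompactLTTop := by
  unfold haarOn; infer_instance

instance (hin : i ≤ n) : (grMeasure hin).InnerRegularCompactLTTop :=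
  Measure.InnerRegularCompactLTTop.map_of_continuous (continuous_orbit _)

variable {L : Gr n i → Fin m → ℝ}

lemma integrable_map_angles_iff (hm : m = min i ℓ) (hin : i ≤ n) (hiℓ : i + ℓ ≤ n)
    (hL : ∀ ξ, IsAngleSpectrum (coordSubspace n ℓ) ξ.1 (L ξ)) {f₀ : (Fin m → ℝ) → E} :
    Integrable f₀ ((grMeasure hin).map L) ↔
      Integrable f₀ (nu m ((|(ℓ : ℝ) - i| - 1) / 2) (((n : ℝ) - ℓ - i - 1) / 2)) := by
  rw [map_angles_grMeasure hm hin hiℓ hL]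
  exact integrable_smul_measure (ENNReal.ofReal_pos.2 (cConst_pos hiℓ)).ne' ENNReal.ofReal_ne_top

lemma exists_eq_comp_angles_of_memK_invariant [SecondCountableTopology E] (hm : m = min i ℓ)
    (hin : i ≤ n) (hℓn : ℓ ≤ n) (hiℓ : i + ℓ ≤ n)
    (hL : ∀ ξ, IsAngleSpectrum (coordSubspace n ℓ) ξ.1 (L ξ)) {f : Gr n i → E}
    (hf : Integrable f (grMeasure hin)) (hinv : ∀ γ, MemK hℓn γ → ∀ ξ, f (γ • ξ) = f ξ) :
    ∃ f₀ : (Fin m → ℝ) → E,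
      Integrable f₀ (nu m ((|(ℓ : ℝ) - i| - 1) / 2) (((n : ℝ) - ℓ - i - 1) / 2)) ∧
        ∀ ξ, f ξ = f₀ (L ξ) := by
  have := isProbabilityMeasure_grMeasure hin
  have hfL : f.FactorsThrough L := fun ξ ξ' h => by
    obtain ⟨γ, hγ, rfl⟩ := exists_memK_smul_eq_of_angles_eq hL hℓn h
    exact (hinv γ hγ ξ).symm
  obtain ⟨f₀, hf₀, h⟩ := exists_integrable_map_of_factorsThrough (continuous_angles hL) hf hfL
  exact ⟨f₀, (integrable_map_angles_iff hm hin hiℓ hL).1 hf₀, h⟩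

lemma integrable_comp_angles (hm : m = min i ℓ) (hin : i ≤ n) (hiℓ : i + ℓ ≤ n)
    (hL : ∀ ξ, IsAngleSpectrum (coordSubspace n ℓ) ξ.1 (L ξ)) {f₀ : (Fin m → ℝ) → E}
    (hf₀ : Integrable f₀ (nu m ((|(ℓ : ℝ) - i| - 1) / 2) (((n : ℝ) - ℓ - i - 1) / 2))) :
    Integrable (fun ξ => f₀ (L ξ)) (grMeasure hin) :=
  ((integrable_map_angles_iff hm hin hiℓ hL).2 hf₀).comp_measurable
    (continuous_angles hL).measurable

lemma integral_comp_angles [NormedSpace ℝ E] (hm : m = min i ℓ) (hin : i ≤ n) (hiℓ : i + ℓ ≤ n)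
    (hL : ∀ ξ, IsAngleSpectrum (coordSubspace n ℓ) ξ.1 (L ξ)) {f₀ : (Fin m → ℝ) → E}
    (hf₀ : Integrable f₀ (nu m ((|(ℓ : ℝ) - i| - 1) / 2) (((n : ℝ) - ℓ - i - 1) / 2))) :
    ∫ ξ, f₀ (L ξ) ∂grMeasure hin = cConst n i ℓ •
      ∫ x, f₀ x ∂nu m ((|(ℓ : ℝ) - i| - 1) / 2) (((n : ℝ) - ℓ - i - 1) / 2) := by
  have hint := (integrable_map_angles_iff hm hin hiℓ hL).2 hf₀
  rw [← integral_map (continuous_angles hL).measurable.aemeasurable hint.aestronglyMeasurable,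
    map_angles_grMeasure hm hin hiℓ hL, integral_smul_measure,
    ENNReal.toReal_ofReal (cConst_pos hiℓ).le]

end InvariantFunctions

end InvGrass

end

open InvGrass in
theorem theorem1p1_general {E : Type*} [NormedAddCommGroup E] [NormedSpace ℝ E]
    [CompleteSpace E] [SecondCountableTopology E] {n i ℓ : ℕ} (hin : i ≤ n) (hℓn : ℓ ≤ n)
    (hiℓ : i + ℓ ≤ n) (α β : ℝ) (hα : α = (|(ℓ : ℝ) - i| - 1) / 2)
    (hβ : β = ((n : ℝ) - ℓ - i - 1) / 2) (Θ : ∀ ξ : Gr n i, OrthonormalBasis (Fin i) ℝ ξ.1)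
    (Ψ : OrthonormalBasis (Fin ℓ) ℝ (coordSubspace n ℓ)) :
    (∀ f : Gr n i → E, Integrable f (grMeasure hin) →
      ((∀ γ : On n, MemK hℓn γ → ∀ ξ, f (γ • ξ) = f ξ) ↔
        ∃ f₀ : (Fin (min i ℓ) → ℝ) → E, Integrable f₀ (nu (min i ℓ) α β) ∧
          ∀ ξ, f ξ = f₀ (lam ξ (Θ ξ) Ψ))) ∧
    (∀ f : Gr n i → E, Integrable f (grMeasure hin) →
      ((∀ γ : On n, MemK hℓn γ → ∀ᵐ ξ ∂(grMeasure hin), f (γ • ξ) = f ξ) ↔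
        ∃ f₀ : (Fin (min i ℓ) → ℝ) → E, Integrable f₀ (nu (min i ℓ) α β) ∧
          ∀ᵐ ξ ∂(grMeasure hin), f ξ = f₀ (lam ξ (Θ ξ) Ψ))) ∧
    (∀ (f : Gr n i → E) (f₀ : (Fin (min i ℓ) → ℝ) → E),
      Integrable f₀ (nu (min i ℓ) α β) →
      (∀ᵐ ξ ∂(grMeasure hin), f ξ = f₀ (lam ξ (Θ ξ) Ψ)) →
        Integrable f (grMeasure hin) ∧
          ∫ ξ, f ξ ∂(grMeasure hin) = cConst n i ℓ • ∫ x, f₀ x ∂(nu (min i ℓ) α β)) := by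
  subst hα hβ
  have hlam := fun ξ : Gr n i => isAngleSpectrum_lam ξ (Θ ξ) Ψ
  have hfactor (f : Gr n i → E) := exists_eq_comp_angles_of_memK_invariant (f := f) rfl hin hℓn
    hiℓ hlam
  have hK {γ : On n} (hγ : MemK hℓn γ) := angles_smul_of_memK hlam hγ
  refine ⟨fun f hf => ⟨hfactor f hf, ?_⟩, fun f hf => ⟨fun hinv => ?_, ?_⟩,
    fun f f₀ hf₀ hff₀ => ⟨(integrable_comp_angles rfl hin hiℓ hlam hf₀).congr
      (Filter.EventuallyEq.symm hff₀),
      (integral_congr_ae hff₀).trans (integral_comp_angles rfl hin hiℓ hlam hf₀)⟩⟩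
  · rintro ⟨f₀, -, h⟩ γ hγ ξ
    rw [h, h, hK hγ]
  · obtain ⟨F, hF, hfF⟩ := exists_memK_invariant_ae_eq hin hℓn hf.aestronglyMeasurable hinv
    obtain ⟨f₀, hf₀, h⟩ := hfactor F (hf.congr hfF) hF
    exact ⟨f₀, hf₀, hfF.trans (.of_forall h)⟩
  · rintro ⟨f₀, -, h⟩ γ hγ
    filter_upwards [h, (measurePreserving_smul_grMeasure hin γ).quasiMeasurePreserving.ae h]
      with ξ hξ hγξ
    rw [hξ, hγξ, hK hγ]

open InvGrass in
theorem theorem1p1 {𝕜 : Type*} [RCLike 𝕜] {n i ℓ : ℕ}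
    (hi : 1 ≤ i) (hin : i < n) (hℓ : 1 ≤ ℓ) (hℓn : ℓ < n) (hiℓ : i + ℓ ≤ n)
    (α β : ℝ) (hα : α = (|(ℓ : ℝ) - i| - 1) / 2) (hβ : β = ((n : ℝ) - ℓ - i - 1) / 2)
    (Θ : ∀ ξ : Gr n i, OrthonormalBasis (Fin i) ℝ ξ.1)
    (Ψ : OrthonormalBasis (Fin ℓ) ℝ (coordSubspace n ℓ)) :
    (∀ f : Gr n i → 𝕜, Integrable f (grMeasure hin.le) →
      ((∀ γ : On n, MemK hℓn.le γ → ∀ ξ, f (γ • ξ) = f ξ) ↔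
        ∃ f₀ : (Fin (min i ℓ) → ℝ) → 𝕜, Integrable f₀ (nu (min i ℓ) α β) ∧
          ∀ ξ, f ξ = f₀ (lam ξ (Θ ξ) Ψ))) ∧
    (∀ f : Gr n i → 𝕜, Integrable f (grMeasure hin.le) →
      ((∀ γ : On n, MemK hℓn.le γ → ∀ᵐ ξ ∂(grMeasure hin.le), f (γ • ξ) = f ξ) ↔
        ∃ f₀ : (Fin (min i ℓ) → ℝ) → 𝕜, Integrable f₀ (nu (min i ℓ) α β) ∧
          ∀ᵐ ξ ∂(grMeasure hin.le), f ξ = f₀ (lam ξ (Θ ξ) Ψ))) ∧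
    (∀ (f : Gr n i → 𝕜) (f₀ : (Fin (min i ℓ) → ℝ) → 𝕜),
      Integrable f₀ (nu (min i ℓ) α β) →
      (∀ᵐ ξ ∂(grMeasure hin.le), f ξ = f₀ (lam ξ (Θ ξ) Ψ)) →
        Integrable f (grMeasure hin.le) ∧
          ∫ ξ, f ξ ∂(grMeasure hin.le) =
            (cConst n i ℓ : 𝕜) * ∫ x, f₀ x ∂(nu (min i ℓ) α β)) := by
  simpa only [RCLike.real_smul_eq_coe_mul] using
    theorem1p1_general (E := 𝕜) hin.le hℓn.le hiℓ α β hα hβ Θ Ψ
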